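/- Let $\mathbb F$ be a field of characteristic $0$ and let $\mathcal V$ be an algebra of differential functions in $u_1,\dots,u_\ell$ which is a domain: a commutative differential $\mathbb F$-algebra $(\mathcal V,\partial)$ extending the algebra of differential polynomials $\mathbb F[u_i^{(n)}\mid 1\le i\le\ell,\ n\ge0]$ (with $\partial u_i^{(n)}=u_i^{(n+1)}$), with commuting derivations $\frac{\partial}{\partial u_i^{(n)}}$ of $\mathcal V$ which extend the usual partial derivatives, such that $\frac{\partial f}{\partial u_i^{(n)}}\neq0$ for only finitely many $(i,n)$, for each $f\in\mathcal V$, and $[\frac{\partial}{\partial u_i^{(n)}},\partial]=\frac{\partial}{\partial u_i^{(n-1)}}$ (which is $0$ for $n=0$). Let $\mathcal V((\partial^{-1}))$ be the algebra of pseudodifferential operators, with product determined by $\partial^n\circ f=\sum_{k\ge0}\binom nk f^{(k)}\partial^{n-k}$ ($n\in\mathbb Z$), and identify $\sum a_n\partial^n$ with its symbol $\sum a_n\lambda^n\in\mathcal V((\lambda^{-1}))$. The adjoint is $(\sum a_n\partial^n)^*=\sum(-\partial)^n\circ a_n$, and $(A^*)_{ij}=(A_{ji})^*$ for matrices. An operator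 $L\in\mathcal V((\partial^{-1}))$ is rational if $L=AB^{-1}$ for some $A,B\in\mathcal V[\partial]$, $B\ne0$. To $H\in\mathrm{Mat}_{\ell\times\ell}\,\mathcal V((\partial^{-1}))$ one associates the $\lambda$-bracket (Master Formula) $$\{f_\lambda g\}_H=\sum_{i,j=1}^{\ell}\sum_{k,n\ge0}\frac{\partial g}{\partial u_j^{(n)}}(\lambda+\partial)^nH_{ji}(\lambda+\partial)(-\lambda-\partial)^k\frac{\partial f}{\partial u_i^{(k)}}\in\mathcal V((\lambda^{-1})),\qquad f,g\in\mathcal V .$$ Let $\mathcal V_{\lambda,\mu}=\mathcal V[[\lambda^{-1},\mu^{-1},(\lambda+\mu)^{-1}]][\lambda,\mu]$, i.e. the quotient of $\mathcal V[[\lambda^{-1},\mu^{-1},\nu^{-1}]][\lambda,\mu,\nu]$ by the multiples of $\nu-\lambda-\mu$. It is embedded in $\mathcal V((\lambda^{-1}))((\mu^{-1}))$, $\mathcal V((\mu^{-1}))((\lambda^{-1}))$ and $\mathcal V(((\lambda+\mu)^{-1}))((\lambda^{-1}))$ by geometric expansion in the domains $|\mu|>|\lambda|$, $|\lambda|>|\mu|$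 and $|\lambda|>|\lambda+\mu|$, respectively. $H$ is a non-local Poisson structure on $\mathcal V$ if it is skewadjoint ($H^*=-H$), all its entries are rational, and for all $i,j,k$ $$\{{u_i}_\lambda\{{u_j}_\mu u_k\}_H\}_H-\{{u_j}_\mu\{{u_i}_\lambda u_k\}_H\}_H=\{{\{{u_i}_\lambda u_j\}_H}_{\lambda+\mu}u_k\}_H ,$$ where the three terms lie in $\mathcal V_{\lambda,\mu}$ via these embeddings and the equality holds in $\mathcal V_{\lambda,\mu}$. Let $H$ be a non-local Poisson structure on $\mathcal V$ and let $\theta_1,\dots,\theta_m\in\mathcal V$. Let $D_\theta$ be the $m\times\ell$ matrix differential operator with entries $(D_\theta)_{\alpha i}=\sum_{n\ge0}\frac{\partial\theta_\alpha}{\partial u_i^{(n)}}\partial^n$, let $D_\theta^*$ be its adjoint, and assume that $C=D_\theta\circ H\circ D_\theta^*$ is invertible in $\mathrm{Mat}_{m\times m}\,\mathcal V((\partial^{-1}))$. Then $C_{\alpha\beta}(\lambda)=\{{\theta_\beta}_\lambda\theta_\alpha\}_H$ for all $\alpha,\beta$. Let $$\widetilde H^D=H-H\circ D_\theta^*\circ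 C^{-1}\circ D_\theta\circ H ,$$ $$\{f_\lambda g\}_H^D=\{f_\lambda g\}_H-\sum_{\alpha,\beta=1}^m{\{{\theta_\beta}_{\lambda+\partial}g\}_H}_\to(C^{-1})_{\beta\alpha}(\lambda+\partial)\{f_\lambda\theta_\alpha\}_H ,$$ where the arrow means that the powers of $\lambda+\partial$ are put to the right of the coefficients and act on what follows. Then: (a) $\{f_\lambda g\}_H^D=\{f_\lambda g\}_{\widetilde H^D}$ for all $f,g\in\mathcal V$, and $\widetilde H^D$ is a non-local Poisson structure on $\mathcal V$. (b) $\widetilde H^D\circ D_\theta^*=0$ and $D_\theta\circ\widetilde H^D=0$. Thus all the $\theta_\alpha$ are central for $\widetilde H^D$, i.e. $\{f_\lambda\theta_\alpha\}_{\widetilde H^D}=\{{\theta_\alpha}_\lambda f\}_{\widetilde H^D}=0$ for all $f\in\mathcal V$ and all $\alpha$. -/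

import Mathlib

namespace DiracReduction

section Series

variable (V : Type*) [AddCommGroup V]

/-- `V((x⁻¹))`: formal Laurent series `∑ aₙ xⁿ` in `x⁻¹`, as families of coefficients `n ↦ aₙ`
which vanish for all sufficiently large `n`. -/
def laurentInv : AddSubgroup (ℤ → V) where
  carrier := {a | ∃ N : ℤ, ∀ n, N < n → a n = 0}
  zero_mem' := ⟨0, fun _ _ => rfl⟩
  add_mem' := by
    rintro a b ⟨N, hN⟩ ⟨M, hM⟩
    refine ⟨max N M, fun n hn => ?_⟩
    simp [hN n (lt_of_le_of_lt (le_max_left _ _) hn), hM n (lt_of_le_of_lt (le_max_right _ _) hn)]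
  neg_mem' := by
    rintro a ⟨N, hN⟩
    exact ⟨N, fun n hn => by simp [hN n hn]⟩

/-- `V[[λ⁻¹, μ⁻¹, ν⁻¹]][λ, μ, ν]`: series `∑ T m n p λᵐ μⁿ νᵖ` over exponents `m, n, p ≤ N`,
for some `N`. -/
def triSeries : AddSubgroup (ℤ → ℤ → ℤ → V) where
  carrier := {T | ∃ N : ℤ, ∀ m n p, (N < m ∨ N < n ∨ N < p) → T m n p = 0}
  zero_mem' := ⟨0, fun _ _ _ _ => rfl⟩
  add_mem' := by
    rintro a b ⟨N, hN⟩ ⟨M, hM⟩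
    refine ⟨max N M, fun m n p h => ?_⟩
    have h1 := hN m n p (by
      rcases h with h | h | h
      · exact Or.inl (lt_of_le_of_lt (le_max_left _ _) h)
      · exact Or.inr (Or.inl (lt_of_le_of_lt (le_max_left _ _) h))
      · exact Or.inr (Or.inr (lt_of_le_of_lt (le_max_left _ _) h)))
    have h2 := hM m n p (by
      rcases h with h | h | h
      · exact Or.inl (lt_of_le_of_lt (le_max_right _ _) h)
      · exact Or.inr (Or.inl (lt_of_le_of_lt (le_max_right _ _) h))
      · exact Or.inr (Or.inr (lt_of_le_of_lt (le_max_right _ _) h)))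
    simp [h1, h2]
  neg_mem' := by
    rintro a ⟨N, hN⟩
    exact ⟨N, fun m n p h => by simp [hN m n p h]⟩

/-- Multiplication by `ν - λ - μ` on `V[[λ⁻¹, μ⁻¹, ν⁻¹]][λ, μ, ν]`. -/
def mulNuSubLambdaSubMu : triSeries V →+ triSeries V where
  toFun T := ⟨fun m n p => T.1 m n (p - 1) - T.1 (m - 1) n p - T.1 m (n - 1) p, by
    obtain ⟨T, N, hN⟩ := T
    refine ⟨N + 1, fun m n p h => ?_⟩
    have h1 := hN m n (p - 1) (by omega)
    have h2 := hN (m - 1) n p (by omega)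
    have h3 := hN m (n - 1) p (by omega)
    simp [h1, h2, h3]⟩
  map_zero' := by
    ext m n p
    simp
  map_add' S T := by
    ext m n p
    simp only [AddSubgroup.coe_add, Pi.add_apply]
    abel

/-- The space `V_{λ,μ} = V[[λ⁻¹, μ⁻¹, (λ+μ)⁻¹]][λ, μ]`, that is, the quotient of
`V[[λ⁻¹, μ⁻¹, ν⁻¹]][λ, μ, ν]` by the multiples of `ν - λ - μ`. -/
abbrev LambdaMuSpace : Type _ := triSeries V ⧸ (mulNuSubLambdaSubMu V).range

variable {V}

/-- `ι_{μ,λ}`: the element of `V((λ⁻¹))((μ⁻¹))` obtained from `T` by expanding the powers of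
`ν = λ + μ` in the domain `|μ| > |λ|`, `νᵖ = ∑ₖ (p choose k) λᵏ μᵖ⁻ᵏ`. The value at `i, j` is the
coefficient of `λⁱ μʲ`; only finitely many terms of the sum over `(p, k)` are non-zero. -/
noncomputable def expandMuLambda (T : triSeries V) (i j : ℤ) : V :=
  ∑ᶠ x : ℤ × ℕ, Ring.choose x.1 x.2 • T.1 (i - x.2) (j + x.2 - x.1) x.1

/-- `ι_{λ,μ}`: the element of `V((μ⁻¹))((λ⁻¹))` obtained from `T` by expanding the powers of
`ν = λ + μ` in the domain `|λ| > |μ|`, `νᵖ = ∑ₖ (p choose k) μᵏ λᵖ⁻ᵏ`. The value at `i, j` is the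
coefficient of `λⁱ μʲ`. -/
noncomputable def expandLambdaMu (T : triSeries V) (i j : ℤ) : V :=
  ∑ᶠ x : ℤ × ℕ, Ring.choose x.1 x.2 • T.1 (i + x.2 - x.1) (j - x.2) x.1

/-- `ι_{λ,λ+μ}`: the element of `V((ν⁻¹))((λ⁻¹))`, `ν = λ + μ`, obtained from `T` by expanding the
powers of `μ = ν - λ` in the domain `|λ| > |ν|`, `μⁿ = ∑ₖ (n choose k) νᵏ (-λ)ⁿ⁻ᵏ`. The value at
`i, j` is the coefficient of `λⁱ νʲ`. -/
noncomputable def expandLambdaNu (T : triSeries V) (i j : ℤ) : V :=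
  ∑ᶠ x : ℤ × ℕ, (((x.1 - x.2).negOnePow : ℤ) * Ring.choose x.1 x.2) •
    T.1 (i + x.2 - x.1) x.1 (j - x.2)

/-- The Jacobi identity `{a_λ {b_μ c}} - {b_μ {a_λ c}} = {{a_λ b}_{λ+μ} c}` for the triple `a, b, c`,
understood in the space `V_{λ,μ}`: the three terms, which a priori lie in `V((λ⁻¹))((μ⁻¹))`,
`V((μ⁻¹))((λ⁻¹))` and `V(((λ+μ)⁻¹))((λ⁻¹))`, are the expansions of elements of `V_{λ,μ}`,
and the equality holds for these elements. -/
def JacobiIdentity (br : V → V → laurentInv V) (a b c : V) : Prop :=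
  ∃ P Q R : triSeries V,
    (∀ i j : ℤ, expandMuLambda P i j = (br a ((br b c).1 j)).1 i) ∧
    (∀ i j : ℤ, expandLambdaMu Q i j = (br b ((br a c).1 i)).1 j) ∧
    (∀ i j : ℤ, expandLambdaNu R i j = (br ((br a b).1 i) c).1 j) ∧
    (P : LambdaMuSpace V) - (Q : LambdaMuSpace V) = (R : LambdaMuSpace V)

end Series

section PseudoDiff

/-- `V((∂⁻¹))`: a pseudodifferential operator `∑ aₙ ∂ⁿ`, identified with its symbol `∑ aₙ λⁿ`
in `V((λ⁻¹))`. -/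
abbrev PsDO (V : Type*) [AddCommGroup V] : Type _ := laurentInv V

variable {F V : Type*} [Field F] [CommRing V] [Algebra F V]

/-- The operator `a ∂ⁿ`. -/
def PsDO.monomial (n : ℤ) (a : V) : PsDO V :=
  ⟨Pi.single n a, n, fun k hk => by simp [hk.ne']⟩

/-- The product of pseudodifferential operators, determined by
`∂ⁿ ∘ b = ∑ₖ (n choose k) b⁽ᵏ⁾ ∂ⁿ⁻ᵏ`. On symbols this is `A(λ + ∂) B(λ)`. For each `q` only finitely
many terms of the sum over `(n, k)` below are non-zero. -/
noncomputable def PsDO.comp (D : Derivation F V V) (A B : PsDO V) : PsDO V :=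
  ⟨fun q => ∑ᶠ x : ℤ × ℕ, Ring.choose x.1 x.2 • (A.1 x.1 * D^[x.2] (B.1 (q - x.1 + x.2))), by
    obtain ⟨A, N, hN⟩ := A
    obtain ⟨B, M, hM⟩ := B
    refine ⟨N + M, fun q hq => ?_⟩
    refine finsum_eq_zero_of_forall_eq_zero fun x => ?_
    by_cases h : N < x.1
    · simp [hN _ h]
    · have : B (q - x.1 + x.2) = 0 := hM _ (by omega)
      simp [this]⟩

/-- The formal adjoint `A* = ∑ (-∂)ⁿ ∘ aₙ` of `A = ∑ aₙ ∂ⁿ`. -/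
noncomputable def PsDO.adjoint (D : Derivation F V V) (A : PsDO V) : PsDO V :=
  ⟨fun q => ∑ᶠ k : ℕ, (((q + k).negOnePow : ℤ) * Ring.choose (q + k) k) • D^[k] (A.1 (q + k)), by
    obtain ⟨A, N, hN⟩ := A
    refine ⟨N, fun q hq => ?_⟩
    refine finsum_eq_zero_of_forall_eq_zero fun k => ?_
    have : A (q + k) = 0 := hN _ (by omega)
    simp [this]⟩

theorem PsDO.comp_finite (D : Derivation F V V) (A B : PsDO V) (q : ℤ) :
    (Function.support fun x : ℤ × ℕ =>
      Ring.choose x.1 x.2 • (A.1 x.1 * D^[x.2] (B.1 (q - x.1 + x.2)))).Finite := by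
  obtain ⟨A, N, hN⟩ := A
  obtain ⟨B, M, hM⟩ := B
  refine ((Set.finite_Icc (q - M) N).prod (Set.finite_Iic (N + M - q).toNat)).subset ?_
  intro x hx
  have h1 : ¬ N < x.1 := fun h => hx (by simp [hN _ h])
  have h2 : ¬ M < q - x.1 + x.2 := fun h => hx (by
    simp [hM _ h])
  simp only [Set.mem_prod, Set.mem_Icc, Set.mem_Iic]
  omega

theorem PsDO.adjoint_finite (D : Derivation F V V) (A : PsDO V) (q : ℤ) :
    (Function.support fun k : ℕ =>
      (((q + k).negOnePow : ℤ) * Ring.choose (q + k) k) • D^[k] (A.1 (q + k))).Finite := by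
  obtain ⟨A, N, hN⟩ := A
  refine (Set.finite_Iic (N - q).toNat).subset ?_
  intro k hk
  have h1 : ¬ N < q + k := fun h => hk (by simp [hN _ h])
  simp only [Set.mem_Iic]
  omega

/-- `A` is a differential operator, `A ∈ V[∂]`. -/
def PsDO.IsDifferential (A : PsDO V) : Prop := ∀ n < 0, A.1 n = 0

/-- `L ∈ V((∂⁻¹))` is a rational pseudodifferential operator with coefficients in `V`:
`L = A ∘ B⁻¹` with `A, B ∈ V[∂]`, `B ≠ 0`. For a domain `V`, with field of fractions `K`,
`B` is invertible in the skewfield `K((∂⁻¹)) ⊇ V((∂⁻¹))`, and the equation is written as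
`L ∘ B = A`. -/
def PsDO.IsRational (D : Derivation F V V) (L : PsDO V) : Prop :=
  ∃ A B : PsDO V, A.IsDifferential ∧ B.IsDifferential ∧ B ≠ 0 ∧ PsDO.comp D L B = A

/-- The product of matrices of pseudodifferential operators. -/
noncomputable def matComp (D : Derivation F V V) {l m n : ℕ}
    (A : Matrix (Fin l) (Fin m) (PsDO V)) (B : Matrix (Fin m) (Fin n) (PsDO V)) :
    Matrix (Fin l) (Fin n) (PsDO V) :=
  fun i j => ∑ k, PsDO.comp D (A i k) (B k j)

/-- The adjoint of a matrix of pseudodifferential operators, `(A*)ᵢⱼ = (Aⱼᵢ)*`. -/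
noncomputable def matAdjoint (D : Derivation F V V) {l m : ℕ}
    (A : Matrix (Fin l) (Fin m) (PsDO V)) : Matrix (Fin m) (Fin l) (PsDO V) :=
  fun i j => PsDO.adjoint D (A j i)

/-- The identity matrix pseudodifferential operator. -/
def matOne (V : Type*) [CommRing V] (m : ℕ) : Matrix (Fin m) (Fin m) (PsDO V) :=
  Matrix.diagonal fun _ => PsDO.monomial 0 1

/-- `B` is the (two-sided) inverse of `A` in `Mat_{m×m} V((∂⁻¹))`. -/
def IsMatInverse (D : Derivation F V V) {m : ℕ} (A B : Matrix (Fin m) (Fin m) (PsDO V)) : Prop :=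
  matComp D A B = matOne V m ∧ matComp D B A = matOne V m

/-- The matrix `C_{αβ}(λ) = {θ_β _λ θ_α}`. -/
def bracketMatrix (br : V → V → laurentInv V) {m : ℕ} (θ : Fin m → V) :
    Matrix (Fin m) (Fin m) (PsDO V) :=
  fun α β => br (θ β) (θ α)

/-- The Dirac modification of a `λ`-bracket by `θ₁, …, θₘ`, where `Cinv` is the inverse of the matrix
`bracketMatrix br θ`:
`{a_λ b}ᴰ = {a_λ b} - ∑ {θ_β _{λ+∂} b}_→ (C⁻¹)_{βα}(λ+∂) {a_λ θ_α}`. -/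
noncomputable def diracBracket (D : Derivation F V V) (br : V → V → laurentInv V) {m : ℕ}
    (θ : Fin m → V) (Cinv : Matrix (Fin m) (Fin m) (PsDO V)) (a b : V) : laurentInv V :=
  br a b - ∑ α, ∑ β, PsDO.comp D (br (θ β) b) (PsDO.comp D (Cinv β α) (br a (θ α)))

end PseudoDiff

/-- The structure of an algebra of differential functions in the variables `u₁, …, u_ℓ` on the
commutative `F`-algebra `V`. -/
structure DifferentialFunctionAlgebra (F V : Type*) [Field F] [CommRing V] [Algebra F V]
    (ℓ : ℕ) where
  /-- the derivation `∂` of the differential algebra `V` -/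
  D : Derivation F V V
  /-- the inclusion of the algebra of differential polynomials `R_ℓ = F[uᵢ⁽ⁿ⁾]`;
  the variable `(i, n)` stands for `uᵢ⁽ⁿ⁾` -/
  incl : MvPolynomial (Fin ℓ × ℕ) F →ₐ[F] V
  incl_injective : Function.Injective incl
  D_incl_X : ∀ i n, D (incl (MvPolynomial.X (i, n))) = incl (MvPolynomial.X (i, n + 1))
  /-- the derivations `∂/∂uᵢ⁽ⁿ⁾` -/
  pd : Fin ℓ → ℕ → Derivation F V V
  pd_incl : ∀ i n p, pd i n (incl p) = incl (MvPolynomial.pderiv (i, n) p)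
  pd_comm : ∀ i n j k f, pd i n (pd j k f) = pd j k (pd i n f)
  pd_finite : ∀ f, {x : Fin ℓ × ℕ | pd x.1 x.2 f ≠ 0}.Finite
  pd_zero_D : ∀ i f, pd i 0 (D f) = D (pd i 0 f)
  pd_succ_D : ∀ i n f, pd i (n + 1) (D f) = D (pd i (n + 1) f) + pd i n f

namespace DifferentialFunctionAlgebra

variable {F V : Type*} [Field F] [CommRing V] [Algebra F V] {ℓ m : ℕ}
  (𝒱 : DifferentialFunctionAlgebra F V ℓ)

/-- The variable `uᵢ`. -/
noncomputable def u (i : Fin ℓ) : V := 𝒱.incl (MvPolynomial.X (i, 0))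

/-- The Frechet derivative `D_θ(∂)_{α i} = ∑ₙ (∂θ_α/∂uᵢ⁽ⁿ⁾) ∂ⁿ`, an `m × ℓ` matrix. -/
def frechet (θ : Fin m → V) : Matrix (Fin m) (Fin ℓ) (PsDO V) :=
  fun α i => ⟨fun n => if 0 ≤ n then 𝒱.pd i n.toNat (θ α) else 0, by
    obtain ⟨N, hN⟩ := ((𝒱.pd_finite (θ α)).image Prod.snd).bddAbove
    refine ⟨N, fun n hn => ?_⟩
    have h0 : 0 ≤ n := by omega
    by_contra h
    simp only [if_pos h0] at h
    have := hN ⟨(i, n.toNat), h, rfl⟩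
    simp only at this
    omega⟩

/-- The `λ`-bracket `{f_λ g}_H` given by the Master Formula
`∑ (∂g/∂uⱼ⁽ⁿ⁾) (λ+∂)ⁿ Hⱼᵢ(λ+∂) (-λ-∂)ᵏ (∂f/∂uᵢ⁽ᵏ⁾)`,
the sum being over `i, j` and the pairs `x = (k, n)`; it has finitely many non-zero terms. -/
noncomputable def masterBracket (H : Matrix (Fin ℓ) (Fin ℓ) (PsDO V)) (f g : V) : laurentInv V :=
  ∑ i, ∑ j, ∑ᶠ x : ℕ × ℕ,
    PsDO.comp 𝒱.D (PsDO.monomial x.2 (𝒱.pd j x.2 g))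
      (PsDO.comp 𝒱.D (H j i)
        (PsDO.comp 𝒱.D (PsDO.monomial x.1 ((-1) ^ x.1)) (PsDO.monomial 0 (𝒱.pd i x.1 f))))

/-- A non-local Poisson structure: a skewadjoint rational matrix pseudodifferential operator
such that the `λ`-bracket of the Master Formula satisfies the Jacobi identity on the generators
`u₁, …, u_ℓ`. -/
structure IsNonlocalPoissonStructure (H : Matrix (Fin ℓ) (Fin ℓ) (PsDO V)) : Prop where
  skewadjoint : matAdjoint 𝒱.D H = -H
  rational : ∀ i j, (H i j).IsRational 𝒱.D
  jacobi : ∀ i j k, JacobiIdentity (𝒱.masterBracket H) (𝒱.u i) (𝒱.u j) (𝒱.u k)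

/-- `C = D_θ ∘ H ∘ D_θ*`. -/
noncomputable def constraintOperator (H : Matrix (Fin ℓ) (Fin ℓ) (PsDO V)) (θ : Fin m → V) :
    Matrix (Fin m) (Fin m) (PsDO V) :=
  matComp 𝒱.D (matComp 𝒱.D (𝒱.frechet θ) H) (matAdjoint 𝒱.D (𝒱.frechet θ))

/-- The Dirac modification `H - H ∘ D_θ* ∘ C⁻¹ ∘ D_θ ∘ H`, where `Cinv` is the inverse of
`C = D_θ ∘ H ∘ D_θ*`. -/
noncomputable def diracModification (H : Matrix (Fin ℓ) (Fin ℓ) (PsDO V)) (θ : Fin m → V)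
    (Cinv : Matrix (Fin m) (Fin m) (PsDO V)) : Matrix (Fin ℓ) (Fin ℓ) (PsDO V) :=
  H - matComp 𝒱.D (matComp 𝒱.D H (matAdjoint 𝒱.D (𝒱.frechet θ)))
        (matComp 𝒱.D Cinv (matComp 𝒱.D (𝒱.frechet θ) H))

end DifferentialFunctionAlgebra

end DiracReduction

/-! Put W = C⁻¹ ∘ D_θ ∘ H and Π = 1 - D_θ* ∘ W. Skewadjointness passes from H to C and to C⁻¹, and
the identities H^D = H ∘ Π, H^D ∘ D_θ* = 0, D_θ ∘ H^D = 0 and Π* ∘ H^D = H^D are matrix algebra.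
They yield part (b); the skewadjointness of H^D is equally formal. The Master Formula reads {f_λ
g}_H = D_g ∘ H ∘ D_f*, so the Dirac bracket is the bracket of H^D by associativity
(`diracBracket_eq`).

The substance is the Jacobi identity. On generators its terms are derivatives of entries of H along
columns of H, the third one after taking adjoints (`jacobiIdentity_iff`). For a derivation δ from V
to V((λ⁻¹)) that commutes with ∂, differentiating D_θ ∘ H^D = 0 and H^D ∘ D_θ* = 0 leads to δ(H^D) =
Π* ∘ δ(H) ∘ Π - W* ∘ δ(D_θ) ∘ H^D - H^D ∘ δ(D_θ*) ∘ W (`matMap_diracModification`), where C⁻¹ is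
never differentiated. For δ along a column of H^D = H ∘ Π, the first summand is a Jacobi term of H
with Π acting in λ and μ and Π* in ν = λ + μ. The other summands contain second derivatives of the
θ_α, and the symmetry of these (`exists_hessian`, `exists_adjoint_hessian`) makes them cancel in the
Jacobi identity (`jacobiIdentity_diracModification`).

The three terms lie in different spaces of iterated series, so all operations are carried out on
series in λ, μ, ν. The maps `triLeft`, `triRightLambda` and `triRightMu` commute with multiplication
by ν - λ - μ, and become explicit products after each expansion; for |λ| > |ν| the substitution μ =
ν - λ produces adjoints. Elements of V_{λ,μ} for H thereby give elements for H^D, and no injectivity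
of the expansions is needed.

For rationality, counting unknowns against equations gives non-zero solutions of linear systems over
V[∂] (`exists_left_kernel`). This yields the Ore condition, hence closure of rational operators
under sums and products, and rationality of the entries of C⁻¹ (`isRational_inverse`). -/

namespace DiracReduction

/-! ### Laurent series with coefficients in a group, and their twisted product -/

section Basics

variable {X Y Z W : Type*} [AddCommGroup X] [AddCommGroup Y] [AddCommGroup Z] [AddCommGroup W]

theorem laurentInv_ext {A B : laurentInv X} (h : ∀ n, A.1 n = B.1 n) : A = B :=
  Subtype.ext (funext h)

@[simp] theorem coe_add_apply (A B : laurentInv X) (n : ℤ) : (A + B).1 n = A.1 n + B.1 n := rfl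
@[simp] theorem coe_sub_apply (A B : laurentInv X) (n : ℤ) : (A - B).1 n = A.1 n - B.1 n := rfl
@[simp] theorem coe_neg_apply (A : laurentInv X) (n : ℤ) : (-A).1 n = -A.1 n := rfl
@[simp] theorem coe_zero_apply (n : ℤ) : (0 : laurentInv X).1 n = 0 := rfl

/-- The coefficient of `xⁿ` as an additive map. -/
def coeffHom (X : Type*) [AddCommGroup X] (n : ℤ) : laurentInv X →+ X where
  toFun A := A.1 n
  map_zero' := rfl
  map_add' _ _ := rfl

@[simp] theorem coeffHom_apply (n : ℤ) (A : laurentInv X) : coeffHom X n A = A.1 n := rfl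

theorem coe_sum_apply {ι : Type*} (s : Finset ι) (f : ι → laurentInv X) (n : ℤ) :
    (∑ i ∈ s, f i).1 n = ∑ i ∈ s, (f i).1 n :=
  map_sum (coeffHom X n) f s

theorem coe_zsmul_apply (z : ℤ) (A : laurentInv X) (n : ℤ) : (z • A).1 n = z • A.1 n :=
  map_zsmul (coeffHom X n) z A

/-- `A = O(xᴺ)`: the exponents in `A` are at most `N`. -/
def OrdLE (A : laurentInv X) (N : ℤ) : Prop := ∀ n, N < n → A.1 n = 0

theorem exists_ordLE (A : laurentInv X) : ∃ N, OrdLE A N := A.2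

theorem OrdLE.mono {A : laurentInv X} {N M : ℤ} (h : OrdLE A N) (hNM : N ≤ M) : OrdLE A M :=
  fun n hn => h n (lt_of_le_of_lt hNM hn)

/-- The monomial `a xⁿ`. -/
def single (n : ℤ) : X →+ laurentInv X where
  toFun a := ⟨Pi.single n a, n, fun k hk => by simp [hk.ne']⟩
  map_zero' := by ext; simp
  map_add' a b := by ext; simp [Pi.single_add]

theorem single_apply (n : ℤ) (a : X) (k : ℤ) : (single n a).1 k = if k = n then a else 0 := by
  simp only [single, AddMonoidHom.coe_mk, ZeroHom.coe_mk, Pi.single_apply]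

@[simp] theorem single_apply_same (n : ℤ) (a : X) : (single n a).1 n = a := by
  simp [single_apply]

theorem ordLE_single (n : ℤ) (a : X) : OrdLE (single n a) n := fun k hk => by
  simp [single_apply, hk.ne']

/-- An additive function on `laurentInv X` which kills the monomials and all series of
sufficiently low order is zero. -/
theorem eq_zero_of_single (f : laurentInv X → Z) (hadd : ∀ A B, f (A + B) = f A + f B)
    (hcont : ∃ d, ∀ A, OrdLE A d → f A = 0) (hs : ∀ n x, f (single n x) = 0)
    (A : laurentInv X) : f A = 0 := by
  obtain ⟨d, hd⟩ := hcont
  obtain ⟨N, hN⟩ := exists_ordLE A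
  let g : laurentInv X →+ Z := ⟨⟨f, by simpa using hadd 0 0⟩, hadd⟩
  have hg : ∀ B, g B = f B := fun _ => rfl
  -- Only finitely many exponents lie above d; removing their monomials leaves a series of order at
  -- most d.
  have key : A = (A - ∑ n ∈ Finset.Ioc d N, single n (A.1 n)) +
      ∑ n ∈ Finset.Ioc d N, single n (A.1 n) := by abel
  rw [key, hadd, hd, zero_add, ← hg, map_sum]
  · exact Finset.sum_eq_zero fun n _ => hs _ _
  · intro k hk
    rw [coe_sub_apply, coe_sum_apply]
    simp only [single_apply, Finset.sum_ite_eq, Finset.mem_Ioc]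
    by_cases h : k ≤ N
    · simp [hk, h]
    · simp [h, hN k (by omega)]

/-- Continuity is required one output coefficient at a time, since the order below which inputs stop
mattering depends on q. -/
theorem eq_of_single {f g : laurentInv X → laurentInv Z} (hf : ∀ A B, f (A + B) = f A + f B)
    (hg : ∀ A B, g (A + B) = g A + g B)
    (hfc : ∀ q, ∃ d, ∀ A, OrdLE A d → (f A).1 q = 0)
    (hgc : ∀ q, ∃ d, ∀ A, OrdLE A d → (g A).1 q = 0)
    (hs : ∀ n x, f (single n x) = g (single n x)) (A : laurentInv X) : f A = g A := by
  refine laurentInv_ext fun q => sub_eq_zero.1 ?_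
  refine eq_zero_of_single (fun A => (f A).1 q - (g A).1 q) ?_ ?_ ?_ A
  · intro A B
    simp only [hf, hg, coe_add_apply]
    abel
  · obtain ⟨d, hd⟩ := hfc q
    obtain ⟨e, he⟩ := hgc q
    exact ⟨min d e, fun A hA => by
      simp [hd A (hA.mono (min_le_left _ _)), he A (hA.mono (min_le_right _ _))]⟩
  · intro n x
    simp [hs]

/-- Apply an additive map to all coefficients. -/
def lmap (φ : X →+ Y) : laurentInv X →+ laurentInv Y where
  toFun A := ⟨fun n => φ (A.1 n), by
    obtain ⟨A, N, hN⟩ := A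
    exact ⟨N, fun n hn => by simp [hN n hn]⟩⟩
  map_zero' := by ext; simp
  map_add' A B := by ext; simp

@[simp] theorem lmap_apply (φ : X →+ Y) (A : laurentInv X) (n : ℤ) :
    (lmap φ A).1 n = φ (A.1 n) := rfl

theorem lmap_single (φ : X →+ Y) (n : ℤ) (a : X) : lmap φ (single n a) = single n (φ a) :=
  laurentInv_ext fun k => by
    simp only [lmap_apply, single_apply]
    split_ifs <;> simp

theorem lmap_id (A : laurentInv X) : lmap (AddMonoidHom.id X) A = A :=
  laurentInv_ext fun _ => rfl

theorem act_finite (β : X →+ Y →+ Z) (D : Y →+ Y) (A : laurentInv X) (B : laurentInv Y) (q : ℤ) :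
    (Function.support fun x : ℤ × ℕ =>
      Ring.choose x.1 x.2 • β (A.1 x.1) (D^[x.2] (B.1 (q - x.1 + x.2)))).Finite := by
  obtain ⟨A, N, hN⟩ := A
  obtain ⟨B, M, hM⟩ := B
  refine ((Set.finite_Icc (q - M) N).prod (Set.finite_Iic (N + M - q).toNat)).subset ?_
  intro x hx
  have h1 : ¬ N < x.1 := fun h => hx (by simp [hN _ h])
  have h2 : ¬ M < q - x.1 + x.2 := fun h => hx (by
    simp [hM _ h])
  simp only [Set.mem_prod, Set.mem_Icc, Set.mem_Iic]
  omega

/-- The biadditive map `(A, B) ↦ A(x + D) B(x)`, where coefficients are multiplied by means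
of `β`, and `D` acts on the coefficients of `B`. -/
noncomputable def act (β : X →+ Y →+ Z) (D : Y →+ Y) :
    laurentInv X →+ laurentInv Y →+ laurentInv Z :=
  AddMonoidHom.mk' (fun A => AddMonoidHom.mk' (fun B =>
    ⟨fun q => ∑ᶠ x : ℤ × ℕ, Ring.choose x.1 x.2 • β (A.1 x.1) (D^[x.2] (B.1 (q - x.1 + x.2))), by
      obtain ⟨A, N, hN⟩ := A
      obtain ⟨B, M, hM⟩ := B
      refine ⟨N + M, fun q hq => finsum_eq_zero_of_forall_eq_zero fun x => ?_⟩
      by_cases h : N < x.1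
      · simp [hN _ h]
      · have : B (q - x.1 + x.2) = 0 := hM _ (by omega)
        simp [this]⟩)
    (fun B C => laurentInv_ext fun q => by
      simp only [coe_add_apply]
      rw [← finsum_add_distrib (act_finite β D A B q) (act_finite β D A C q)]
      simp only [iterate_map_add, map_add, smul_add]))
    (fun A B => by
      ext C q
      simp only [AddMonoidHom.mk'_apply, AddMonoidHom.add_apply, AddSubgroup.coe_add,
        Pi.add_apply]
      rw [← finsum_add_distrib (act_finite β D A C q) (act_finite β D B C q)]
      simp only [map_add, AddMonoidHom.add_apply, smul_add])

theorem act_apply (β : X →+ Y →+ Z) (D : Y →+ Y) (A : laurentInv X) (B : laurentInv Y) (q : ℤ) :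
    (act β D A B).1 q =
      ∑ᶠ x : ℤ × ℕ, Ring.choose x.1 x.2 • β (A.1 x.1) (D^[x.2] (B.1 (q - x.1 + x.2))) := rfl

theorem OrdLE.act {β : X →+ Y →+ Z} {D : Y →+ Y} {A : laurentInv X} {B : laurentInv Y}
    {N M : ℤ} (hN : OrdLE A N) (hM : OrdLE B M) : OrdLE (act β D A B) (N + M) := by
  intro q hq
  refine finsum_eq_zero_of_forall_eq_zero fun x => ?_
  by_cases h : N < x.1
  · simp [hN _ h]
  · have : B.1 (q - x.1 + x.2) = 0 := hM _ (by omega)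
    simp [this]

theorem finsum_eq_finsum_comp {ι κ : Type*} (e : κ → ι) (he : Function.Injective e) (f : ι → Z)
    (h : ∀ x, x ∉ Set.range e → f x = 0) : ∑ᶠ x, f x = ∑ᶠ k, f (e k) := by
  rw [← finsum_mem_range he]
  refine finsum_congr fun x => ?_
  by_cases hx : x ∈ Set.range e
  · simp only [hx, finsum_true]
  · simp only [hx, finsum_false, h x hx]

theorem finsum_nat_eq_sum (f : ℕ → Z) (s : ℕ) (h : ∀ k, s < k → f k = 0) :
    ∑ᶠ k, f k = ∑ k ∈ Finset.range (s + 1), f k :=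
  finsum_eq_sum_of_support_subset _ fun k hk => by
    simp only [Finset.coe_range, Set.mem_Iio]
    by_contra hlt
    exact hk (h k (by omega))

theorem act_single_left (β : X →+ Y →+ Z) (D : Y →+ Y) (n : ℤ) (a : X) (B : laurentInv Y)
    (q : ℤ) : (act β D (single n a) B).1 q =
      ∑ᶠ k : ℕ, Ring.choose n k • β a (D^[k] (B.1 (q - n + k))) := by
  rw [act_apply, finsum_eq_finsum_comp (fun k : ℕ => (n, k)) (fun _ _ h => (Prod.ext_iff.1 h).2)]
  · simp
  · rintro ⟨n', k⟩ h
    have : n' ≠ n := fun h' => h ⟨k, by rw [h']⟩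
    simp [single_apply, this]

theorem act_single_right (β : X →+ Y →+ Z) (D : Y →+ Y) (A : laurentInv X) (m : ℤ) (b : Y)
    (q : ℤ) : (act β D A (single m b)).1 q =
      ∑ᶠ k : ℕ, Ring.choose (q - m + k) k • β (A.1 (q - m + k)) (D^[k] b) := by
  -- A pair (n, k) meets the monomial exactly when q - n + k = m, so k determines n.
  rw [act_apply, finsum_eq_finsum_comp (fun k : ℕ => (q - m + k, k))
    (fun _ _ h => (Prod.ext_iff.1 h).2)]
  · refine finsum_congr fun k => ?_
    simp only
    rw [show q - (q - m + k) + k = m by ring, single_apply_same]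
  · rintro ⟨n', k⟩ h
    have : q - n' + k ≠ m := fun h' => h ⟨k, by ext <;> simp; omega⟩
    simp [single_apply, this]

/-- The coefficient of `a xⁿ ∘ b xᵐ` at `x^(n + m - i)`. -/
theorem act_single_single (β : X →+ Y →+ Z) (D : Y →+ Y) (n m : ℤ) (a : X) (b : Y) (q : ℤ)
    (i : ℕ) (hi : q = n + m - i) :
    (act β D (single n a) (single m b)).1 q = Ring.choose n i • β a (D^[i] b) := by
  rw [act_single_left, finsum_eq_single _ i]
  · rw [show q - n + i = m by omega, single_apply_same]
  · intro k hk
    have : q - n + k ≠ m := by omega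
    simp [single_apply, this]

theorem act_single_single_of_lt (β : X →+ Y →+ Z) (D : Y →+ Y) (n m : ℤ) (a : X) (b : Y) (q : ℤ)
    (hq : n + m < q) : (act β D (single n a) (single m b)).1 q = 0 :=
  (ordLE_single n a).act (ordLE_single m b) q hq

/-- Compatibility of `act` with maps of coefficients. -/
theorem lmap_act {X' Y' Z' : Type*} [AddCommGroup X'] [AddCommGroup Y'] [AddCommGroup Z']
    {β : X →+ Y →+ Z} {D : Y →+ Y} {β' : X' →+ Y' →+ Z'} {D' : Y' →+ Y'}
    (φ : X →+ X') (ψ : Y →+ Y') (χ : Z →+ Z') (hβ : ∀ x y, χ (β x y) = β' (φ x) (ψ y))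
    (hD : ∀ y, ψ (D y) = D' (ψ y)) (A : laurentInv X) (B : laurentInv Y) :
    lmap χ (act β D A B) = act β' D' (lmap φ A) (lmap ψ B) := by
  refine laurentInv_ext fun q => ?_
  have hk : ∀ (k : ℕ) (y : Y), ψ (D^[k] y) = D'^[k] (ψ y) := fun k y =>
    Function.Semiconj.iterate_right (f := ψ) (ga := D) (gb := D') hD k y
  rw [lmap_apply, act_apply, act_apply, AddMonoidHom.map_finsum _ (act_finite β D A B q)]
  refine finsum_congr fun x => ?_
  rw [map_zsmul, hβ, hk]
  rfl

/-- The Leibniz rule for maps of coefficients. -/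
theorem lmap_act_leibniz {X' Y' : Type*} [AddCommGroup X'] [AddCommGroup Y']
    {β : X →+ Y →+ Z} {D : Y →+ Y} {β₁ : X' →+ Y →+ W} {β₂ : X →+ Y' →+ W} {D' : Y' →+ Y'}
    (φ : X →+ X') (ψ : Y →+ Y') (χ : Z →+ W)
    (hβ : ∀ x y, χ (β x y) = β₁ (φ x) y + β₂ x (ψ y))
    (hD : ∀ y, ψ (D y) = D' (ψ y)) (A : laurentInv X) (B : laurentInv Y) :
    lmap χ (act β D A B) = act β₁ D (lmap φ A) B + act β₂ D' A (lmap ψ B) := by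
  refine laurentInv_ext fun q => ?_
  have hk : ∀ (k : ℕ) (y : Y), ψ (D^[k] y) = D'^[k] (ψ y) := fun k y =>
    Function.Semiconj.iterate_right (f := ψ) (ga := D) (gb := D') hD k y
  rw [lmap_apply, coe_add_apply, act_apply, act_apply, act_apply,
    AddMonoidHom.map_finsum _ (act_finite β D A B q),
    ← finsum_add_distrib (act_finite β₁ D (lmap φ A) B q) (act_finite β₂ D' A (lmap ψ B) q)]
  refine finsum_congr fun x => ?_
  rw [map_zsmul, hβ, hk, smul_add]
  rfl

theorem iterate_leibniz {β : X →+ Y →+ Z} {DX : X →+ X} {DY : Y →+ Y} {DZ : Z →+ Z}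
    (h : ∀ x y, DZ (β x y) = β (DX x) y + β x (DY y)) (t : ℕ) (x : X) (y : Y) :
    DZ^[t] (β x y) =
      ∑ ij ∈ Finset.HasAntidiagonal.antidiagonal t, t.choose ij.1 • β (DX^[ij.1] x) (DY^[ij.2] y) := by
  induction t with
  | zero => simp
  | succ t ih =>
    rw [Finset.sum_antidiagonal_choose_succ_nsmul (fun i j => β (DX^[i] x) (DY^[j] y)),
      Function.iterate_succ_apply', ih, map_sum, ← Finset.sum_add_distrib]
    refine Finset.sum_congr rfl fun ij hij => ?_
    rw [map_nsmul, h, smul_add, ← Function.iterate_succ_apply' DX, ← Function.iterate_succ_apply' DY,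
      add_comm, Nat.choose_symm_of_eq_add (Finset.HasAntidiagonal.mem_antidiagonal.1 hij).symm]

end Basics

/-! ### Associativity of the twisted product -/

/-- Choosing i + r and then i of these amounts to choosing i first and r from the remaining n - i;
the sum over r is then Vandermonde's identity for (n - i) + m. -/
theorem choose_trinomial (n m : ℤ) (i j : ℕ) :
    ∑ r ∈ Finset.range (j + 1), Ring.choose n (i + r) * ((i + r).choose i : ℤ) *
      Ring.choose m (j - r) = Ring.choose n i * Ring.choose (n + m - i) j := by
  have h : ∀ r, Ring.choose n (i + r) * ((i + r).choose i : ℤ) =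
      Ring.choose n i * Ring.choose (n - i) r := fun r => by
    have := Ring.choose_smul_choose n (Nat.le_add_right i r)
    rw [nsmul_eq_mul] at this
    simpa [mul_comm] using this
  simp only [h, mul_assoc]
  rw [← Finset.mul_sum, show n + m - i = (n - i) + m by ring,
    Ring.add_choose_eq j (Commute.all (n - (i : ℤ)) m), Finset.Nat.sum_antidiagonal_eq_sum_range_succ
      (fun a b => Ring.choose (n - (i : ℤ)) a * Ring.choose m b)]

section Assoc

variable {X Y Z W W' U : Type*} [AddCommGroup X] [AddCommGroup Y] [AddCommGroup Z]
  [AddCommGroup W] [AddCommGroup W'] [AddCommGroup U]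

theorem ordLE_act_const_left (β : X →+ Y →+ Z) (D : Y →+ Y) (B : laurentInv Y) (q : ℤ) :
    ∃ d, ∀ A, OrdLE A d → (act β D A B).1 q = 0 := by
  obtain ⟨N, hN⟩ := exists_ordLE B
  exact ⟨q - N - 1, fun A hA => hA.act hN q (by omega)⟩

theorem ordLE_act_const_right (β : X →+ Y →+ Z) (D : Y →+ Y) (A : laurentInv X) (q : ℤ) :
    ∃ d, ∀ B, OrdLE B d → (act β D A B).1 q = 0 := by
  obtain ⟨N, hN⟩ := exists_ordLE A
  exact ⟨q - N - 1, fun B hB => hN.act hB q (by omega)⟩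

/-- Associativity of the product of symbols, for compatible multiplications of the
coefficients. -/
theorem act_assoc {β₁₂ : X →+ Y →+ W} {β₃ : W →+ Z →+ U} {β₂₃ : Y →+ Z →+ W'}
    {β₁ : X →+ W' →+ U} {DY : Y →+ Y} {DZ : Z →+ Z} {DW : W' →+ W'}
    (hβ : ∀ x y z, β₃ (β₁₂ x y) z = β₁ x (β₂₃ y z))
    (hD : ∀ y z, DW (β₂₃ y z) = β₂₃ (DY y) z + β₂₃ y (DZ z))
    (A : laurentInv X) (B : laurentInv Y) (C : laurentInv Z) :
    act β₃ DZ (act β₁₂ DY A B) C = act β₁ DW A (act β₂₃ DZ B C) := by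
  revert A
  obtain ⟨NB, hB⟩ := exists_ordLE B
  obtain ⟨NC, hC⟩ := exists_ordLE C
  refine eq_of_single (by simp) (by simp) (fun q => ⟨q - NB - NC - 1, fun A hA =>
    (hA.act hB).act hC q (by omega)⟩) (fun q => ordLE_act_const_left _ _ _ _) fun n a => ?_
  clear hB NB
  revert B
  refine eq_of_single (by simp) (by simp) (fun q => ⟨q - n - NC - 1, fun B hB =>
    ((ordLE_single n a).act hB).act hC q (by omega)⟩) (fun q => ⟨q - n - NC - 1, fun B hB =>
    (ordLE_single n a).act (hB.act hC) q (by omega)⟩) fun m b => ?_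
  clear hC NC
  revert C
  refine eq_of_single (by simp) (by simp) (fun q => ordLE_act_const_right _ _ _ _)
    (fun q => ⟨q - n - m - 1, fun B hB =>
    (ordLE_single n a).act ((ordLE_single m b).act hB) q (by omega)⟩) fun k c => ?_
  refine laurentInv_ext fun q => ?_
  by_cases hq : n + m + k < q
  · rw [((ordLE_single n a).act (ordLE_single m b)).act (ordLE_single k c) q hq,
      (ordLE_single n a).act ((ordLE_single m b).act (ordLE_single k c)) q (by omega)]
  -- In this coefficient s derivatives are spent altogether. Both bracketings are written as sums
  -- over the number i of them that fall on b, the other s - i falling on c.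
  obtain ⟨s, hs⟩ : ∃ s : ℕ, q = n + m + k - s := ⟨(n + m + k - q).toNat, by omega⟩
  have hl : (act β₃ DZ (act β₁₂ DY (single n a) (single m b)) (single k c)).1 q =
      ∑ i ∈ Finset.range (s + 1), (Ring.choose n i * Ring.choose (n + m - i) (s - i)) •
        β₁ a (β₂₃ (DY^[i] b) (DZ^[s - i] c)) := by
    rw [act_single_right, finsum_nat_eq_sum _ s, ← Finset.sum_range_reflect]
    · refine Finset.sum_congr rfl fun i hi => ?_
      have hi' : i ≤ s := by simpa [Nat.lt_succ_iff] using hi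
      rw [show s + 1 - 1 - i = s - i by omega,
        act_single_single β₁₂ DY n m a b (q - k + (s - i : ℕ)) i (by omega),
        show q - k + ((s - i : ℕ) : ℤ) = n + m - i by omega, map_zsmul, AddMonoidHom.smul_apply, hβ,
        smul_smul, mul_comm]
    · intro j hj
      rw [act_single_single_of_lt _ _ _ _ _ _ _ (by omega)]
      simp
  have hr : (act β₁ DW (single n a) (act β₂₃ DZ (single m b) (single k c))).1 q =
      ∑ t ∈ Finset.range (s + 1), ∑ i ∈ Finset.range (t + 1),
        (Ring.choose n t * (t.choose i : ℤ) * Ring.choose m (s - t)) •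
        β₁ a (β₂₃ (DY^[i] b) (DZ^[s - i] c)) := by
    rw [act_single_left, finsum_nat_eq_sum _ s]
    · refine Finset.sum_congr rfl fun t ht => ?_
      have ht' : t ≤ s := by simpa [Nat.lt_succ_iff] using ht
      rw [act_single_single β₂₃ DZ m k b c _ (s - t) (by omega)]
      have hit : ∀ (z : ℤ) (w : W'), DW^[t] (z • w) = z • DW^[t] w := fun z w => by
        induction t generalizing w with
        | zero => rfl
        | succ t ih => rw [Function.iterate_succ_apply, map_zsmul, ih (by simp; omega) (by omega)]; rfl
      rw [hit, iterate_leibniz hD,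
        Finset.Nat.sum_antidiagonal_eq_sum_range_succ
          (fun i j => t.choose i • β₂₃ (DY^[i] b) (DZ^[j] (DZ^[s - t] c))),
        map_zsmul, map_sum, Finset.smul_sum, Finset.smul_sum]
      refine Finset.sum_congr rfl fun i hi => ?_
      have hi' : i ≤ t := by simpa [Nat.lt_succ_iff] using hi
      rw [← Function.iterate_add_apply, show t - i + (s - t) = s - i by omega, map_nsmul,
        ← natCast_zsmul, smul_smul, smul_smul]
      congr 1
      ring
    · intro t ht
      rw [act_single_single_of_lt _ _ _ _ _ _ _ (by omega)]
      simp
  -- With i outermost and t = i + r, the scalars on the right add up by `choose_trinomial`.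
  rw [hl, hr, Finset.sum_comm' (t' := Finset.range (s + 1)) (s' := fun i => Finset.Ico i (s + 1))
    (fun t i => by simp only [Finset.mem_range, Finset.mem_Ico]; omega)]
  refine Finset.sum_congr rfl fun i hi => ?_
  have hi' : i ≤ s := by simpa [Nat.lt_succ_iff] using hi
  rw [Finset.sum_Ico_eq_sum_range, ← Finset.sum_smul, ← choose_trinomial,
    show s + 1 - i = s - i + 1 by omega]
  congr 1
  refine Finset.sum_congr rfl fun r hr => ?_
  rw [show s - (i + r) = s - i - r by omega]

end Assoc
end DiracReduction

namespace DiracReduction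

/-! ### The ring of pseudodifferential operators -/

section PsdRing

variable {F V : Type*} [Field F] [CommRing V] [Algebra F V]

/-- A derivation as an additive map. -/
def dHom (D : Derivation F V V) : V →+ V := D.toLinearMap.toAddMonoidHom

@[simp] theorem dHom_apply (D : Derivation F V V) (a : V) : dHom D a = D a := rfl

/-- The product of pseudodifferential operators as a biadditive map. -/
noncomputable def compHom (D : Derivation F V V) :
    laurentInv V →+ laurentInv V →+ laurentInv V :=
  act AddMonoidHom.mul (dHom D)

theorem comp_eq_compHom (D : Derivation F V V) (A B : laurentInv V) :
    PsDO.comp D A B = compHom D A B := rfl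

theorem monomial_eq_single (n : ℤ) (a : V) : PsDO.monomial n a = single n a := rfl

theorem compHom_assoc (D : Derivation F V V) (A B C : laurentInv V) :
    compHom D (compHom D A B) C = compHom D A (compHom D B C) :=
  act_assoc (fun _ _ _ => mul_assoc _ _ _)
    (fun y z => by simp [mul_comm, add_comm]) A B C

theorem iterate_derivation_one (D : Derivation F V V) (k : ℕ) (hk : k ≠ 0) :
    (dHom D)^[k] (1 : V) = 0 := by
  obtain ⟨k, rfl⟩ := Nat.exists_eq_succ_of_ne_zero hk
  rw [Function.iterate_succ_apply, dHom_apply, Derivation.map_one_eq_zero, iterate_map_zero]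

theorem compHom_single_one (D : Derivation F V V) (A : laurentInv V) (m q : ℤ) :
    (compHom D A (single m 1)).1 q = A.1 (q - m) := by
  rw [compHom, act_single_right, finsum_eq_single _ 0]
  · simp
  · intro k hk
    simp [iterate_derivation_one D k hk]

theorem compHom_const (D : Derivation F V V) (a : V) (B : laurentInv V) (q : ℤ) :
    (compHom D (single 0 a) B).1 q = a * B.1 q := by
  rw [compHom, act_single_left, finsum_eq_single _ 0]
  · simp
  · intro k hk
    rw [Ring.choose_zero_pos ℤ (Nat.pos_of_ne_zero hk), zero_smul]

/-- `V((∂⁻¹))` with its ring structure. -/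
def Psd (_ : Derivation F V V) : Type _ := laurentInv V

variable (D : Derivation F V V)

instance : AddCommGroup (Psd D) := inferInstanceAs (AddCommGroup (laurentInv V))

noncomputable instance : Ring (Psd D) :=
  { (inferInstance : AddCommGroup (Psd D)) with
    mul := fun A B => compHom D A B
    one := (single 0 1 : laurentInv V)
    left_distrib := fun A B C => map_add (compHom D A) B C
    right_distrib := fun A B C => DFunLike.congr_fun (map_add (compHom D) A B) C
    zero_mul := fun A => DFunLike.congr_fun (map_zero (compHom D)) A
    mul_zero := fun A => map_zero (compHom D A)
    mul_assoc := compHom_assoc D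
    one_mul := fun A => laurentInv_ext fun q => by
      refine (compHom_const D 1 A q).trans (one_mul _)
    mul_one := fun A => laurentInv_ext fun q => by
      refine (compHom_single_one D A 0 q).trans (by rw [sub_zero]) }

namespace Psd

/-- The operator `∂ⁿ`. -/
def xpow (n : ℤ) : Psd D := single n 1

/-- A function as an operator of order `0`. -/
def const : V →+ Psd D := single 0

theorem const_apply (a : V) (q : ℤ) : (const D a).1 q = if q = 0 then a else 0 :=
  single_apply 0 a q

theorem xpow_zero : xpow D 0 = 1 := rfl

theorem mul_xpow_apply (A : Psd D) (m q : ℤ) : (A * xpow D m).1 q = A.1 (q - m) :=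
  compHom_single_one D A m q

theorem const_mul_apply (a : V) (A : Psd D) (q : ℤ) : (const D a * A).1 q = a * A.1 q :=
  compHom_const D a A q

theorem const_mul_xpow (n : ℤ) (a : V) : const D a * xpow D n = single n a :=
  laurentInv_ext fun q => by
    rw [const_mul_apply, xpow]
    simp only [single_apply]
    split_ifs <;> simp

theorem xpow_add (n m : ℤ) : xpow D (n + m) = xpow D n * xpow D m :=
  laurentInv_ext fun q => by
    rw [mul_xpow_apply, xpow, xpow]
    simp only [single_apply]
    congr 1
    simp only [eq_iff_iff]
    omega

theorem const_mul (a b : V) : const D (a * b) = const D a * const D b :=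
  laurentInv_ext fun q => by
    rw [const_mul_apply, const_apply, const_apply]
    split_ifs <;> simp

theorem x_mul_const (a : V) :
    xpow D 1 * const D a = const D a * xpow D 1 + const D (D a) := by
  rw [const_mul_xpow]
  refine laurentInv_ext fun q => ?_
  change (act _ _ (single 1 1) (single 0 a)).1 q = (single 1 a).1 q + (single 0 (D a)).1 q
  rw [act_single_left, finsum_nat_eq_sum _ 1, Finset.sum_range_succ, Finset.sum_range_one]
  · simp only [single_apply]
    by_cases h1 : q = 1
    · subst h1; simp
    · by_cases h0 : q = 0
      · subst h0; simp
      · have : q - 1 ≠ 0 := by omega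
        simp [h1, h0, this]
  · intro k hk
    have : Ring.choose (1 : ℤ) k = 0 := by
      have := Ring.choose_natCast (R := ℤ) 1 k
      rw [Nat.cast_one] at this
      rw [this, Nat.choose_eq_zero_of_lt hk, Nat.cast_zero]
    rw [this, zero_smul]

end Psd

/-! ### The adjoint as an anti-involution -/

/-- The adjoint as an additive map. -/
noncomputable def adjHom : laurentInv V →+ laurentInv V :=
  AddMonoidHom.mk' (PsDO.adjoint D) fun A B => laurentInv_ext fun q => by
    refine Eq.trans ?_ (finsum_add_distrib (PsDO.adjoint_finite D A q) (PsDO.adjoint_finite D B q))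
    refine finsum_congr fun k => ?_
    rw [← smul_add, ← iterate_map_add]
    rfl

theorem adjHom_apply (A : laurentInv V) (q : ℤ) : (adjHom D A).1 q =
    ∑ᶠ k : ℕ, (((q + k).negOnePow : ℤ) * Ring.choose (q + k) k) • D^[k] (A.1 (q + k)) := rfl

theorem OrdLE.adjHom {A : laurentInv V} {N : ℤ} (h : OrdLE A N) : OrdLE (adjHom D A) N := by
  intro q hq
  rw [adjHom_apply]
  refine finsum_eq_zero_of_forall_eq_zero fun k => ?_
  rw [h _ (by omega), iterate_map_zero, smul_zero]

/-- The sum defining the adjoint is the binomial expansion of (-∂)ⁿ ∘ a: at the exponent n - s only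
the index k = s meets the monomial. -/
theorem adjHom_single (n : ℤ) (a : V) : adjHom D (single n a) =
    ((n.negOnePow : ℤ) • (Psd.xpow D n * Psd.const D a) : Psd D) := by
  refine laurentInv_ext fun q => ?_
  change _ = coeffHom V q ((n.negOnePow : ℤ) • act AddMonoidHom.mul (dHom D) (single n 1) (single 0 a))
  rw [map_zsmul, coeffHom_apply]
  by_cases hq : n < q
  · rw [(ordLE_single n a).adjHom D q hq, act_single_single_of_lt _ _ _ _ _ _ _ (by omega),
      smul_zero]
  · obtain ⟨s, hs⟩ : ∃ s : ℕ, q = n - s := ⟨(n - q).toNat, by omega⟩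
    rw [act_single_single _ _ n 0 1 a q s (by omega), adjHom_apply, finsum_eq_single _ s,
      show q + s = n by omega, single_apply_same, smul_smul]
    · simp
      rfl
    · intro k hk
      have : q + k ≠ n := by omega
      simp [single_apply, this, iterate_map_zero]

namespace Psd

variable {D}

/-- The adjoint on the ring of pseudodifferential operators. -/
noncomputable def adj : Psd D →+ Psd D := adjHom D

theorem adj_single (n : ℤ) (a : V) : adj (D := D) (single n a) =
    (n.negOnePow : ℤ) • (xpow D n * const D a) := adjHom_single D n a

theorem adj_const_mul_xpow (n : ℤ) (a : V) : adj (const D a * xpow D n) =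
    (n.negOnePow : ℤ) • (xpow D n * const D a) := by
  rw [const_mul_xpow, adj_single]

theorem adj_xpow (n : ℤ) : adj (xpow D n) = (n.negOnePow : ℤ) • xpow D n := by
  have := adj_const_mul_xpow (D := D) n 1
  rwa [show const D 1 = 1 from rfl, one_mul, mul_one] at this

theorem adj_const (a : V) : adj (const D a) = const D a := by
  have := adj_const_mul_xpow (D := D) 0 a
  rw [xpow_zero, one_mul, mul_one] at this
  simpa using this

theorem adj_eq_of_single {f g : Psd D →+ Psd D}
    (hfc : ∀ q, ∃ d, ∀ A : Psd D, OrdLE A d → (f A).1 q = 0)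
    (hgc : ∀ q, ∃ d, ∀ A : Psd D, OrdLE A d → (g A).1 q = 0)
    (hs : ∀ n x, f (const D x * xpow D n) = g (const D x * xpow D n)) (A : Psd D) :
    f A = g A := by
  simp only [const_mul_xpow] at hs
  exact eq_of_single (f := f) (g := g) (map_add f) (map_add g) hfc hgc hs A

theorem ordLE_mul {A B : Psd D} {N M : ℤ} (hA : OrdLE A N) (hB : OrdLE B M) :
    OrdLE (A * B) (N + M) := hA.act hB

theorem ordLE_adj {A : Psd D} {N : ℤ} (hA : OrdLE A N) : OrdLE (adj A) N := hA.adjHom D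

theorem adj_const_mul (a : V) (A : Psd D) : adj (const D a * A) = adj A * const D a := by
  refine adj_eq_of_single (f := adj.comp (AddMonoidHom.mulLeft (const D a)))
    (g := (AddMonoidHom.mulRight (const D a)).comp adj)
    (fun q => ⟨q - 1, fun A hA => ordLE_adj (ordLE_mul (ordLE_single 0 a) hA) q (by omega)⟩)
    (fun q => ⟨q - 1, fun A hA => ordLE_mul (ordLE_adj hA) (ordLE_single 0 a) q (by omega)⟩) ?_ A
  intro n b
  simp only [AddMonoidHom.comp_apply, AddMonoidHom.coe_mulLeft, AddMonoidHom.coe_mulRight]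
  rw [← mul_assoc, ← const_mul, adj_const_mul_xpow, adj_const_mul_xpow, smul_mul_assoc, mul_assoc,
    ← const_mul, mul_comm b a]

/-- On b ∂ⁿ, the term produced by [∂, b] = b' is the one that appears when ∂ is moved past b inside
∂ⁿ ∘ b ∘ ∂. -/
theorem adj_x_mul (A : Psd D) : adj (xpow D 1 * A) = -(adj A * xpow D 1) := by
  refine adj_eq_of_single (f := adj.comp (AddMonoidHom.mulLeft (xpow D 1)))
    (g := -(AddMonoidHom.mulRight (xpow D 1)).comp adj)
    (fun q => ⟨q - 2, fun A hA => ordLE_adj (ordLE_mul (ordLE_single 1 1) hA) q (by omega)⟩)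
    (fun q => ⟨q - 2, fun A hA => by
      refine neg_eq_zero.2 (ordLE_mul (ordLE_adj hA) (ordLE_single 1 1) q (by omega))⟩) ?_ A
  intro n b
  simp only [AddMonoidHom.comp_apply, AddMonoidHom.coe_mulLeft, AddMonoidHom.coe_mulRight,
    AddMonoidHom.neg_apply]
  rw [← mul_assoc, x_mul_const, add_mul, mul_assoc, ← xpow_add, map_add, adj_const_mul_xpow,
    adj_const_mul_xpow, adj_const_mul_xpow, smul_mul_assoc, mul_assoc, add_comm 1 n, xpow_add,
    Int.negOnePow_succ, ← smul_neg]
  simp only [Units.val_neg, neg_smul, smul_neg, mul_assoc, x_mul_const, mul_add,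
    smul_add]
  abel

/-- By continuity A may be taken to be a ∂ⁿ. Left factors a and ∂ are covered by `adj_const_mul` and
`adj_x_mul`, and the powers of ∂ follow by induction in both directions. -/
theorem adj_mul (A B : Psd D) : adj (A * B) = adj B * adj A := by
  obtain ⟨NB, hB⟩ := exists_ordLE B
  refine adj_eq_of_single (f := adj.comp (AddMonoidHom.mulRight B))
    (g := (AddMonoidHom.mulLeft (adj B)).comp adj)
    (fun q => ⟨q - NB - 1, fun A hA => ordLE_adj (ordLE_mul hA hB) q (by omega)⟩)
    (fun q => ⟨q - NB - 1, fun A hA => ordLE_mul (ordLE_adj hB) (ordLE_adj hA) q (by omega)⟩) ?_ A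
  intro n a
  simp only [AddMonoidHom.comp_apply, AddMonoidHom.coe_mulLeft, AddMonoidHom.coe_mulRight]
  have key : ∀ C : Psd D, adj (xpow D n * C) = (n.negOnePow : ℤ) • (adj C * xpow D n) := by
    induction n using Int.induction_on with
    | zero => intro C; simp [xpow_zero]
    | succ n ih =>
      intro C
      rw [xpow_add, mul_assoc, ih, adj_x_mul, Int.negOnePow_succ, Units.val_neg, neg_smul,
        ← smul_neg, neg_mul, mul_assoc, ← xpow_add, ← xpow_add, add_comm 1]
    | pred n ih =>
      intro C
      have h1 := ih (xpow D (-1) * C)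
      -- For negative powers, the rule for ∂ is applied to ∂⁻¹ ∘ C and then solved for (∂⁻¹ ∘ C)* by
      -- composing with ∂⁻¹.
      have h2 := adj_x_mul (xpow D (-1) * C)
      rw [← mul_assoc, ← xpow_add, show (1 : ℤ) + -1 = 0 by norm_num, xpow_zero, one_mul] at h2
      have h3 : adj (xpow D (-1) * C) = -(adj C * xpow D (-1)) := by
        rw [h2, neg_mul, neg_neg, mul_assoc, ← xpow_add, show (1 : ℤ) + -1 = 0 by norm_num,
          xpow_zero, mul_one]
      rw [sub_eq_add_neg, xpow_add, mul_assoc, h1, h3, ← sub_eq_add_neg, Int.negOnePow_sub,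
        Int.negOnePow_one, neg_mul, mul_assoc, ← xpow_add, ← xpow_add, add_comm (-1 : ℤ)]
      simp
  rw [mul_assoc, adj_const_mul, key, adj_const_mul_xpow, smul_mul_assoc, mul_smul_comm, mul_assoc]

@[simp] theorem adj_adj (A : Psd D) : adj (adj A) = A := by
  refine adj_eq_of_single (f := adj.comp adj) (g := AddMonoidHom.id _)
    (fun q => ⟨q - 1, fun A hA => ordLE_adj (ordLE_adj hA) q (by omega)⟩)
    (fun q => ⟨q - 1, fun A hA => hA q (by omega)⟩) ?_ A
  intro n a
  simp only [AddMonoidHom.comp_apply, AddMonoidHom.id_apply]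
  rw [adj_const_mul_xpow, map_zsmul, adj_mul, adj_xpow, adj_const, mul_smul_comm, smul_smul,
    ← Units.val_mul, ← Int.negOnePow_add, Int.negOnePow_even _ ⟨n, rfl⟩, Units.val_one, one_smul]

end Psd

end PsdRing
end DiracReduction

namespace DiracReduction

/-! ### Differential modules and series in two variables -/

section DiffModule

variable {F V : Type*} [Field F] [CommRing V] [Algebra F V]

/-- `b` is an action of the differential ring `(V, D)` on the differential module `(M, d)`. -/
structure IsDiffModule {M : Type*} [AddCommGroup M] (D : Derivation F V V) (b : V →+ M →+ M)
    (d : M →+ M) : Prop where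
  one_act : ∀ x, b 1 x = x
  mul_act : ∀ a a' x, b (a * a') x = b a (b a' x)
  leibniz : ∀ a x, d (b a x) = b (D a) x + b a (d x)

namespace IsDiffModule

variable {M : Type*} [AddCommGroup M] {D : Derivation F V V} {b : V →+ M →+ M} {d : M →+ M}

theorem act_comm (h : IsDiffModule D b d) (a a' : V) (x : M) : b a (b a' x) = b a' (b a x) := by
  rw [← h.mul_act, mul_comm, h.mul_act]

theorem left_left (h : IsDiffModule D b d) (A B : laurentInv V) (X : laurentInv M) :
    act b d (compHom D A B) X = act b d A (act b d B X) :=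
  act_assoc h.mul_act h.leibniz A B X

theorem right_right (h : IsDiffModule D b d) (X : laurentInv M) (A B : laurentInv V) :
    act b.flip (dHom D) (act b.flip (dHom D) X A) B = act b.flip (dHom D) X (compHom D A B) :=
  act_assoc (fun x a a' => by
    simp only [AddMonoidHom.flip_apply, AddMonoidHom.mul_apply]
    rw [← h.mul_act, mul_comm])
    (fun y z => by simp [mul_comm, add_comm]) X A B

/-- The scalars commute because V is commutative, and the Leibniz rule differentiates the product;
these are the two inputs of `act_assoc`. -/
theorem left_right (h : IsDiffModule D b d) (A : laurentInv V) (X : laurentInv M)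
    (B : laurentInv V) :
    act b.flip (dHom D) (act b d A X) B = act b d A (act b.flip (dHom D) X B) :=
  act_assoc (fun a x a' => by simp [h.act_comm a a'])
    (fun y z => by simp [h.leibniz, add_comm]) A X B

theorem const_left (b : V →+ M →+ M) (d : M →+ M) (a : V) (X : laurentInv M) :
    act b d (single 0 a) X = lmap (b a) X :=
  laurentInv_ext fun q => by
    rw [act_single_left, finsum_eq_single _ 0]
    · simp
    · intro k hk
      rw [Ring.choose_zero_pos ℤ (Nat.pos_of_ne_zero hk), zero_smul]

theorem one_left (h : IsDiffModule D b d) (X : laurentInv M) :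
    act b d (single 0 1) X = X :=
  (const_left b d 1 X).trans (laurentInv_ext fun _ => h.one_act _)

theorem one_right (h : IsDiffModule D b d) (X : laurentInv M) :
    act b.flip (dHom D) X (single 0 1) = X :=
  laurentInv_ext fun q => by
    rw [act_single_right, finsum_eq_single _ 0]
    · simp [h.one_act]
    · intro k hk
      simp [iterate_derivation_one D k hk]

end IsDiffModule

variable (D : Derivation F V V)

/-- The action of `V` on `V((λ⁻¹))` by multiplication from the left. -/
noncomputable def leftMul : V →+ laurentInv V →+ laurentInv V := (compHom D).comp (single 0)

/-- The operator `λ + ∂` on `V((λ⁻¹))`. -/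
noncomputable def leftDer : laurentInv V →+ laurentInv V := compHom D (single 1 1)

/-- The action of `V` on `V((ν⁻¹))` by multiplication from the right. -/
noncomputable def rightMul : V →+ laurentInv V →+ laurentInv V := (compHom D).flip.comp (single 0)

/-- Multiplication by `-ν` on `V((ν⁻¹))`. -/
noncomputable def rightDer : laurentInv V →+ laurentInv V := -(compHom D).flip (single 1 1)

theorem leftMul_apply (a : V) (X : laurentInv V) : leftMul D a X = compHom D (single 0 a) X := rfl

theorem leftDer_apply (X : laurentInv V) : leftDer D X = compHom D (single 1 1) X := rfl

theorem rightMul_apply (a : V) (X : laurentInv V) : rightMul D a X = compHom D X (single 0 a) :=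
  rfl

theorem rightDer_apply (X : laurentInv V) : rightDer D X = -compHom D X (single 1 1) := rfl

theorem compHom_single_zero (a b : V) :
    compHom D (single 0 a) (single 0 b) = single 0 (a * b) := (Psd.const_mul D a b).symm

theorem compHom_x_const (a : V) : compHom D (single 1 1) (single 0 a) =
    compHom D (single 0 a) (single 1 1) + single 0 (D a) := Psd.x_mul_const D a

theorem compHom_one_left (A : laurentInv V) : compHom D (single 0 1) A = A :=
  one_mul (M := Psd D) A

theorem compHom_one_right (A : laurentInv V) : compHom D A (single 0 1) = A :=
  mul_one (M := Psd D) A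

theorem compHom_xpow (n m : ℤ) :
    compHom D (single n 1) (single m 1) = single (n + m) 1 := (Psd.xpow_add D n m).symm

theorem compHom_const_xpow (n : ℤ) (a : V) :
    compHom D (single 0 a) (single n 1) = single n a := Psd.const_mul_xpow D n a

theorem isDiffModule_left : IsDiffModule D (leftMul D) (leftDer D) where
  one_act := compHom_one_left D
  mul_act a a' x := by
    simp only [leftMul_apply]
    rw [← compHom_assoc, compHom_single_zero]
  leibniz a x := by
    simp only [leftMul_apply, leftDer_apply]
    rw [← compHom_assoc, compHom_x_const, map_add, AddMonoidHom.add_apply, compHom_assoc, add_comm]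

/-- Right multiplication by -∂ is a compatible derivation because -a ∘ ∂ = a' - ∂ ∘ a; right
multiplication is an action since V is commutative. -/
theorem isDiffModule_right : IsDiffModule D (rightMul D) (rightDer D) where
  one_act := compHom_one_right D
  mul_act a a' x := by
    simp only [rightMul_apply]
    rw [compHom_assoc, compHom_single_zero, mul_comm]
  leibniz a x := by
    simp only [rightMul_apply, rightDer_apply]
    rw [map_neg, AddMonoidHom.neg_apply, compHom_assoc, compHom_assoc, compHom_x_const, map_add]
    abel

theorem leftDer_iterate_xpow (k : ℕ) (m : ℤ) :
    (leftDer D)^[k] (single m 1) = single (m + k) 1 := by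
  induction k with
  | zero => simp
  | succ k ih =>
    rw [Function.iterate_succ_apply', ih, leftDer_apply, compHom_xpow]
    push_cast
    congr 2
    ring

theorem rightDer_iterate (k : ℕ) (X : laurentInv V) :
    (rightDer D)^[k] X = (-1 : ℤ) ^ k • compHom D X (single k 1) := by
  induction k with
  | zero => simp [compHom_one_right]
  | succ k ih =>
    rw [Function.iterate_succ_apply', ih, rightDer_apply, map_zsmul, AddMonoidHom.smul_apply,
      compHom_assoc, compHom_xpow, pow_succ, mul_neg_one, neg_smul]
    push_cast
    rfl

/-- The series `X` in two variables has total degree at most `d`. -/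
def Deg2 (X : laurentInv (laurentInv V)) (d : ℤ) : Prop := ∀ q, OrdLE (X.1 q) (d - q)

/-- Series of order at most `N`. -/
def ordSub (V : Type*) [AddCommGroup V] (N : ℤ) : AddSubgroup (laurentInv V) where
  carrier := {A | OrdLE A N}
  zero_mem' := fun _ _ => rfl
  add_mem' ha hb := fun n hn => by simp [ha n hn, hb n hn]
  neg_mem' ha := fun n hn => by simp [ha n hn]

theorem act_mem {X Y Z : Type*} [AddCommGroup X] [AddCommGroup Y] [AddCommGroup Z]
    {β : X →+ Y →+ Z} {D : Y →+ Y} (A : laurentInv X) (B : laurentInv Y) (q : ℤ)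
    (S : AddSubgroup Z) (h : ∀ (n : ℤ) (k : ℕ), β (A.1 n) (D^[k] (B.1 (q - n + k))) ∈ S) :
    (act β D A B).1 q ∈ S := by
  rw [act_apply, finsum_eq_sum _ (act_finite β D A B q)]
  exact S.sum_mem fun x _ => S.zsmul_mem (h _ _) _

theorem act_apply_apply {X Y : Type*} [AddCommGroup X] [AddCommGroup Y]
    (β : X →+ Y →+ laurentInv V) (D : Y →+ Y) (A : laurentInv X) (B : laurentInv Y) (q i : ℤ) :
    ((act β D A B).1 q).1 i = ∑ᶠ x : ℤ × ℕ, Ring.choose x.1 x.2 •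
      (β (A.1 x.1) (D^[x.2] (B.1 (q - x.1 + x.2)))).1 i := by
  rw [act_apply]
  refine ((coeffHom V i).map_finsum (act_finite β D A B q)).trans (finsum_congr fun x => ?_)
  rw [map_zsmul]
  rfl

theorem OrdLE.leftMul {X : laurentInv V} {e : ℤ} (h : OrdLE X e) (a : V) :
    OrdLE (leftMul D a X) e := by
  have := (ordLE_single 0 a).act (β := AddMonoidHom.mul) (D := dHom D) h
  rwa [zero_add] at this

theorem OrdLE.rightMul {X : laurentInv V} {e : ℤ} (h : OrdLE X e) (a : V) :
    OrdLE (rightMul D a X) e := by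
  have := h.act (β := AddMonoidHom.mul) (D := dHom D) (ordLE_single 0 a)
  rwa [add_zero] at this

theorem OrdLE.leftDer {X : laurentInv V} {e : ℤ} (h : OrdLE X e) :
    OrdLE (leftDer D X) (e + 1) := by
  have := (ordLE_single 1 (1 : V)).act (β := AddMonoidHom.mul) (D := dHom D) h
  rwa [add_comm] at this

theorem OrdLE.rightDer {X : laurentInv V} {e : ℤ} (h : OrdLE X e) :
    OrdLE (rightDer D X) (e + 1) :=
  fun n hn => by
    rw [rightDer_apply, coe_neg_apply, neg_eq_zero]
    exact h.act (β := AddMonoidHom.mul) (D := dHom D) (ordLE_single 1 (1 : V)) n hn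

/-- Each use of `d` raises the inner order by at most one, and the product formula lowers the outer
exponent by one in exchange, so the total degree grows only through A. -/
theorem Deg2.act_left {b : V →+ laurentInv V →+ laurentInv V} {d : laurentInv V →+ laurentInv V}
    (hb : ∀ a X e, OrdLE X e → OrdLE (b a X) e) (hd : ∀ X e, OrdLE X e → OrdLE (d X) (e + 1))
    {A : laurentInv V} {X : laurentInv (laurentInv V)} {N e : ℤ} (hA : OrdLE A N)
    (hX : Deg2 X e) : Deg2 (act b d A X) (N + e) := by
  intro q
  refine act_mem A X q (ordSub V (N + e - q)) fun n k => ?_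
  by_cases hn : N < n
  · rw [hA n hn, map_zero, AddMonoidHom.zero_apply]
    exact (ordSub V _).zero_mem
  · have hk : ∀ (k : ℕ) (Y : laurentInv V) (c : ℤ), OrdLE Y c → OrdLE (d^[k] Y) (c + k) := by
      intro k Y c hY
      induction k with
      | zero => simpa using hY
      | succ k ih =>
        rw [Function.iterate_succ_apply']
        have := hd _ _ ih
        rwa [add_assoc] at this
    refine hb _ _ _ ((hk k _ _ (hX _)).mono ?_)
    omega

theorem Deg2.act_right {b : V →+ laurentInv V →+ laurentInv V}
    (hb : ∀ a X e, OrdLE X e → OrdLE (b a X) e)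
    {A : laurentInv V} {X : laurentInv (laurentInv V)} {N e : ℤ} (hA : OrdLE A N)
    (hX : Deg2 X e) : Deg2 (act b.flip (dHom D) X A) (N + e) := by
  intro q
  refine act_mem X A q (ordSub V (N + e - q)) fun n k => ?_
  by_cases hn : N < q - n + k
  · rw [hA _ hn, iterate_map_zero, map_zero]
    exact (ordSub V _).zero_mem
  · exact hb _ _ _ ((hX _).mono (by omega))

theorem Deg2.lmap {φ : laurentInv V →+ laurentInv V} {N e : ℤ}
    (hφ : ∀ X e, OrdLE X e → OrdLE (φ X) (N + e)) {X : laurentInv (laurentInv V)} (hX : Deg2 X e) :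
    Deg2 (lmap φ X) (N + e) := fun q => (hφ _ _ (hX q)).mono (by omega)

end DiffModule

/-! ### Series in λ, μ, ν and their expansions -/

section Tri

variable {V : Type*} [AddCommGroup V]

theorem triSeries_ext {S T : triSeries V} (h : ∀ m n p, S.1 m n p = T.1 m n p) : S = T :=
  Subtype.ext (funext fun m => funext fun n => funext fun p => h m n p)

/-- The coefficient of `λᵐ μⁿ`, a series in `ν`. -/
def sliceNu (m n : ℤ) : triSeries V →+ laurentInv V where
  toFun T := ⟨T.1 m n, by
    obtain ⟨T, N, hN⟩ := T
    exact ⟨N, fun p hp => hN _ _ _ (Or.inr (Or.inr hp))⟩⟩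
  map_zero' := rfl
  map_add' _ _ := rfl

@[simp] theorem sliceNu_apply (m n p : ℤ) (T : triSeries V) : (sliceNu m n T).1 p = T.1 m n p := rfl

/-- The coefficient of `μⁿ`, a series in `λ` with coefficients series in `ν`. -/
def sliceLambdaNu (n : ℤ) : triSeries V →+ laurentInv (laurentInv V) where
  toFun T := ⟨fun m => sliceNu m n T, by
    obtain ⟨T, N, hN⟩ := T
    exact ⟨N, fun m hm => laurentInv_ext fun p => hN _ _ _ (Or.inl hm)⟩⟩
  map_zero' := rfl
  map_add' _ _ := rfl

@[simp] theorem sliceLambdaNu_apply (m n : ℤ) (T : triSeries V) :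
    (sliceLambdaNu n T).1 m = sliceNu m n T := rfl

/-- Exchange of `λ` and `μ`. -/
def triSwap : triSeries V →+ triSeries V where
  toFun T := ⟨fun m n p => T.1 n m p, by
    obtain ⟨T, N, hN⟩ := T
    exact ⟨N, fun m n p h => hN _ _ _ (by tauto)⟩⟩
  map_zero' := rfl
  map_add' _ _ := rfl

@[simp] theorem triSwap_apply (T : triSeries V) (m n p : ℤ) :
    (triSwap T).1 m n p = T.1 n m p := rfl

@[simp] theorem triSwap_triSwap (T : triSeries V) : triSwap (triSwap T) = T := rfl

/-- `λᵐ μⁿ A(ν)`. -/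
def triNu (m n : ℤ) : laurentInv V →+ triSeries V where
  toFun A := ⟨fun m' n' p => if m' = m ∧ n' = n then A.1 p else 0, by
    obtain ⟨A, N, hN⟩ := A
    refine ⟨max N (max m n), fun m' n' p h => ?_⟩
    by_cases h' : m' = m ∧ n' = n
    · exact (if_pos h').trans (hN _ (by omega))
    · exact if_neg h'⟩
  map_zero' := triSeries_ext fun m' n' p => by simp
  map_add' A B := triSeries_ext fun m' n' p => by
    simp only [AddSubgroup.coe_add, Pi.add_apply]
    split_ifs <;> simp

theorem triNu_apply (m n : ℤ) (A : laurentInv V) (m' n' p : ℤ) :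
    (triNu m n A).1 m' n' p = if m' = m ∧ n' = n then A.1 p else 0 := rfl

/-- `A(λ) μⁿ`. -/
def triLambda (n : ℤ) : laurentInv V →+ triSeries V where
  toFun A := ⟨fun m' n' p => if n' = n ∧ p = 0 then A.1 m' else 0, by
    obtain ⟨A, N, hN⟩ := A
    refine ⟨max N (max n 0), fun m' n' p h => ?_⟩
    by_cases h' : n' = n ∧ p = 0
    · exact (if_pos h').trans (hN _ (by omega))
    · exact if_neg h'⟩
  map_zero' := triSeries_ext fun m' n' p => by simp
  map_add' A B := triSeries_ext fun m' n' p => by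
    simp only [AddSubgroup.coe_add, Pi.add_apply]
    split_ifs <;> simp

theorem triLambda_apply (n : ℤ) (A : laurentInv V) (m' n' p : ℤ) :
    (triLambda n A).1 m' n' p = if n' = n ∧ p = 0 then A.1 m' else 0 := rfl

theorem triSwap_triLambda_single (n m : ℤ) (a : V) :
    triSwap (triLambda n (single m a)) = triLambda m (single n a) :=
  triSeries_ext fun m' n' p => by
    rw [triSwap_apply, triLambda_apply, triLambda_apply, single_apply, single_apply]
    split_ifs <;> first | rfl | omega

theorem triNu_const (m n : ℤ) (a : V) : triNu m n (single 0 a) = triLambda n (single m a) :=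
  triSeries_ext fun m' n' p => by
    rw [triNu_apply, triLambda_apply, single_apply, single_apply]
    split_ifs <;> first | rfl | omega

/-- `T` has total degree at most `d`. -/
def TriDeg (T : triSeries V) (d : ℤ) : Prop := ∀ m n p, d < m + n + p → T.1 m n p = 0

theorem TriDeg.swap {T : triSeries V} {d : ℤ} (h : TriDeg T d) : TriDeg (triSwap T) d :=
  fun m n p hd => h n m p (by omega)

theorem TriDeg.slice {T : triSeries V} {d : ℤ} (h : TriDeg T d) (n : ℤ) :
    ∀ m, OrdLE ((sliceLambdaNu n T).1 m) (d - n - m) :=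
  fun m p hp => h m n p (by omega)

/-- An additive function on `triSeries V` which kills the monomials and all series of
sufficiently low total degree is zero. -/
theorem eq_zero_of_triNu {Z : Type*} [AddCommGroup Z] (f : triSeries V → Z)
    (hadd : ∀ S T, f (S + T) = f S + f T) (hcont : ∃ d, ∀ T, TriDeg T d → f T = 0)
    (hs : ∀ m n p a, f (triNu m n (single p a)) = 0) (T : triSeries V) : f T = 0 := by
  obtain ⟨d, hd⟩ := hcont
  obtain ⟨N, hN⟩ := T.2
  let g : triSeries V →+ Z := ⟨⟨f, by simpa using hadd 0 0⟩, hadd⟩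
  have hg : ∀ B, g B = f B := fun _ => rfl
  -- If all exponents are at most N and one is at most d - 2N, then their sum is at most d.
  -- Subtracting the monomials in this box thus leaves total degree at most d.
  let I := Finset.Ioc (d - 2 * N) N
  let S : triSeries V := ∑ m ∈ I, ∑ n ∈ I, ∑ p ∈ I, triNu m n (single p (T.1 m n p))
  have hS : f S = 0 := by
    rw [← hg, map_sum]
    refine Finset.sum_eq_zero fun m _ => ?_
    rw [map_sum]
    refine Finset.sum_eq_zero fun n _ => ?_
    rw [map_sum]
    exact Finset.sum_eq_zero fun p _ => hs _ _ _ _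
  have hco : ∀ m n p, S.1 m n p = if m ∈ I ∧ n ∈ I ∧ p ∈ I then T.1 m n p else 0 := by
    intro m n p
    have : S.1 m n p = ∑ m' ∈ I, ∑ n' ∈ I, ∑ p' ∈ I,
        (triNu m' n' (single p' (T.1 m' n' p'))).1 m n p := by
      simp only [S, AddSubgroup.val_finsetSum, Finset.sum_apply]
    rw [this]
    simp only [triNu_apply, single_apply]
    by_cases hm : m ∈ I
    · rw [Finset.sum_eq_single_of_mem m hm]
      · by_cases hn : n ∈ I
        · rw [Finset.sum_eq_single_of_mem n hn]
          · simp [hm, hn]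
          · intro n' _ hne
            simp [hne.symm]
        · rw [if_neg (by tauto)]
          refine Finset.sum_eq_zero fun n' hn' => Finset.sum_eq_zero fun p' _ => if_neg ?_
          rintro ⟨-, rfl⟩
          exact hn hn'
      · intro m' _ hne
        simp [hne.symm]
    · rw [if_neg (by tauto)]
      refine Finset.sum_eq_zero fun m' hm' => Finset.sum_eq_zero fun n' _ =>
        Finset.sum_eq_zero fun p' _ => if_neg ?_
      rintro ⟨rfl, -⟩
      exact hm hm'
  have key : T = (T - S) + S := by abel
  rw [key, hadd, hS, add_zero]
  refine hd _ fun m n p hmnp => ?_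
  change T.1 m n p - S.1 m n p = 0
  rw [hco]
  split_ifs with h
  · exact sub_self _
  · rw [sub_zero]
    refine hN m n p ?_
    simp only [I, Finset.mem_Ioc] at h
    omega

theorem expandMuLambda_finite (T : triSeries V) (i j : ℤ) :
    (Function.support fun x : ℤ × ℕ =>
      Ring.choose x.1 x.2 • T.1 (i - x.2) (j + x.2 - x.1) x.1).Finite := by
  obtain ⟨N, hN⟩ := T.2
  refine ((Set.finite_Icc (j - N) N).prod (Set.finite_Iic (2 * N - j).toNat)).subset ?_
  intro x hx
  have h : ¬ (N < i - x.2 ∨ N < j + x.2 - x.1 ∨ N < x.1) := fun h => hx (by simp [hN _ _ _ h])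
  simp only [Set.mem_prod, Set.mem_Icc, Set.mem_Iic]
  omega

theorem expandLambdaNu_finite (T : triSeries V) (i j : ℤ) :
    (Function.support fun x : ℤ × ℕ => (((x.1 - x.2).negOnePow : ℤ) * Ring.choose x.1 x.2) •
      T.1 (i + x.2 - x.1) x.1 (j - x.2)).Finite := by
  obtain ⟨N, hN⟩ := T.2
  refine ((Set.finite_Icc (i - N) N).prod (Set.finite_Iic (2 * N - i).toNat)).subset ?_
  intro x hx
  have h : ¬ (N < i + x.2 - x.1 ∨ N < x.1 ∨ N < j - x.2) := fun h => hx (by simp [hN _ _ _ h])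
  simp only [Set.mem_prod, Set.mem_Icc, Set.mem_Iic]
  omega

/-- `expandMuLambda` as an additive map with values in `V((λ⁻¹))((μ⁻¹))`. -/
noncomputable def iotaMu : triSeries V →+ laurentInv (laurentInv V) :=
  AddMonoidHom.mk' (fun T => ⟨fun j => ⟨fun i => expandMuLambda T i j, by
      obtain ⟨N, hN⟩ := T.2
      -- In every summand the three exponents add up to i + j, and each must be at most N.
      refine ⟨3 * N - j, fun i hi => finsum_eq_zero_of_forall_eq_zero fun x => ?_⟩
      rw [hN _ _ _ (by omega), smul_zero]⟩, by
      obtain ⟨N, hN⟩ := T.2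
      refine ⟨2 * N, fun j hj => laurentInv_ext fun i =>
        finsum_eq_zero_of_forall_eq_zero fun x => ?_⟩
      rw [hN _ _ _ (by omega), smul_zero]⟩)
    fun S T => laurentInv_ext fun j => laurentInv_ext fun i => by
      refine Eq.trans ?_
        (finsum_add_distrib (expandMuLambda_finite S i j) (expandMuLambda_finite T i j))
      refine finsum_congr fun x => ?_
      rw [← smul_add]
      rfl

theorem iotaMu_apply (T : triSeries V) (i j : ℤ) :
    ((iotaMu T).1 j).1 i = expandMuLambda T i j := rfl

/-- `expandLambdaNu` as an additive map with values in `V((ν⁻¹))((λ⁻¹))`. -/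
noncomputable def iotaNu : triSeries V →+ laurentInv (laurentInv V) :=
  AddMonoidHom.mk' (fun T => ⟨fun i => ⟨fun j => expandLambdaNu T i j, by
      obtain ⟨N, hN⟩ := T.2
      refine ⟨3 * N - i, fun j hj => finsum_eq_zero_of_forall_eq_zero fun x => ?_⟩
      rw [hN _ _ _ (by omega), smul_zero]⟩, by
      obtain ⟨N, hN⟩ := T.2
      refine ⟨2 * N, fun i hi => laurentInv_ext fun j =>
        finsum_eq_zero_of_forall_eq_zero fun x => ?_⟩
      rw [hN _ _ _ (by omega), smul_zero]⟩)
    fun S T => laurentInv_ext fun i => laurentInv_ext fun j => by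
      refine Eq.trans ?_
        (finsum_add_distrib (expandLambdaNu_finite S i j) (expandLambdaNu_finite T i j))
      refine finsum_congr fun x => ?_
      rw [← smul_add]
      rfl

theorem iotaNu_apply (T : triSeries V) (i j : ℤ) :
    ((iotaNu T).1 i).1 j = expandLambdaNu T i j := rfl

end Tri

end DiracReduction

namespace DiracReduction

/-! ### Operators acting in λ, μ and ν, compared with the expansions -/

section TriOps

variable {F V : Type*} [Field F] [CommRing V] [Algebra F V] (D : Derivation F V V)

/-- `A(ν + ∂) T`. -/
noncomputable def triLeft (A : laurentInv V) : triSeries V →+ triSeries V where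
  toFun T := ⟨fun m n => (compHom D A (sliceNu m n T)).1, by
    obtain ⟨N, hN⟩ := T.2
    obtain ⟨M, hM⟩ := exists_ordLE A
    refine ⟨max N (M + N), fun m n p h => ?_⟩
    by_cases hmn : N < m ∨ N < n
    · have : sliceNu m n T = 0 := laurentInv_ext fun p => hN _ _ _ (by tauto)
      beta_reduce
      rw [this, map_zero]
      rfl
    · have : OrdLE (sliceNu m n T) N := fun p hp => hN _ _ _ (by tauto)
      exact hM.act this p (by omega)⟩
  map_zero' := triSeries_ext fun m n p => by simp
  map_add' S T := triSeries_ext fun m n p => by simp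

theorem triLeft_apply (A : laurentInv V) (T : triSeries V) (m n p : ℤ) :
    (triLeft D A T).1 m n p = (compHom D A (sliceNu m n T)).1 p := rfl

/-- `T(λ + ∂, μ, ν + ∂) A(λ)`. -/
noncomputable def triRightLambda (A : laurentInv V) : triSeries V →+ triSeries V where
  toFun T := ⟨fun m n p => ((act (rightMul D).flip (dHom D) (sliceLambdaNu n T) A).1 m).1 p, by
    obtain ⟨N, hN⟩ := T.2
    obtain ⟨M, hM⟩ := exists_ordLE A
    refine ⟨max N (N + M), fun m n p h => ?_⟩
    by_cases hn : N < n
    · have : sliceLambdaNu n T = 0 :=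
        laurentInv_ext fun m => laurentInv_ext fun p => hN _ _ _ (by tauto)
      beta_reduce
      rw [this, map_zero]
      rfl
    · by_cases hm : N + M < m
      · have : OrdLE (sliceLambdaNu n T) N :=
          fun m hm => laurentInv_ext fun p => hN _ _ _ (by tauto)
        beta_reduce
        rw [this.act hM m (by omega)]
        rfl
      · refine act_mem (sliceLambdaNu n T) A m (ordSub V N) (fun m k => ?_) p (by omega)
        exact OrdLE.rightMul D (fun p hp => hN _ _ _ (by tauto)) _⟩
  map_zero' := triSeries_ext fun m n p => by simp
  map_add' S T := triSeries_ext fun m n p => by simp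

theorem triRightLambda_apply (A : laurentInv V) (T : triSeries V) (m n p : ℤ) :
    (triRightLambda D A T).1 m n p =
      ((act (rightMul D).flip (dHom D) (sliceLambdaNu n T) A).1 m).1 p := rfl

theorem sliceLambdaNu_triRightLambda (A : laurentInv V) (T : triSeries V) (n : ℤ) :
    sliceLambdaNu n (triRightLambda D A T) =
      act (rightMul D).flip (dHom D) (sliceLambdaNu n T) A := rfl

theorem sliceLambdaNu_triLeft (A : laurentInv V) (T : triSeries V) (n : ℤ) :
    sliceLambdaNu n (triLeft D A T) = lmap (compHom D A) (sliceLambdaNu n T) := rfl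

/-- `T(λ, μ + ∂, ν + ∂) A(μ)`. -/
noncomputable def triRightMu (A : laurentInv V) : triSeries V →+ triSeries V :=
  triSwap.comp ((triRightLambda D A).comp triSwap)

theorem triRightMu_apply (A : laurentInv V) (T : triSeries V) :
    triRightMu D A T = triSwap (triRightLambda D A (triSwap T)) := rfl

theorem triSwap_triLeft (A : laurentInv V) (T : triSeries V) :
    triSwap (triLeft D A T) = triLeft D A (triSwap T) := rfl

theorem triSwap_triRightMu (A : laurentInv V) (T : triSeries V) :
    triSwap (triRightMu D A T) = triRightLambda D A (triSwap T) := rfl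

theorem triSwap_triRightLambda (A : laurentInv V) (T : triSeries V) :
    triSwap (triRightLambda D A T) = triRightMu D A (triSwap T) := rfl

theorem triLeft_triNu (A B : laurentInv V) (m n : ℤ) :
    triLeft D A (triNu m n B) = triNu m n (compHom D A B) :=
  triSeries_ext fun m' n' p => by
    rw [triLeft_apply, triNu_apply]
    split_ifs with h
    · rw [show sliceNu m' n' (triNu m n B) = B from laurentInv_ext fun p => if_pos h]
    · rw [show sliceNu m' n' (triNu m n B) = 0 from laurentInv_ext fun p => if_neg h, map_zero]
      rfl

theorem triLeft_triLeft (A B : laurentInv V) (T : triSeries V) :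
    triLeft D A (triLeft D B T) = triLeft D (compHom D A B) T :=
  triSeries_ext fun m n p =>
    congrArg (fun X : laurentInv V => X.1 p) (compHom_assoc D A B (sliceNu m n T)).symm

/-- Every monomial arises from λᵐ μⁿ by a left action, so maps compatible with left actions need
only be computed on λᵐ μⁿ. -/
theorem triNu_eq_triLeft (m n : ℤ) (B : laurentInv V) :
    triNu m n B = triLeft D B (triLambda n (single m 1)) := by
  rw [← triNu_const, triLeft_triNu, compHom_one_right]

theorem triRightLambda_triLeft (A B : laurentInv V) (T : triSeries V) :
    triRightLambda D A (triLeft D B T) = triLeft D B (triRightLambda D A T) := by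
  refine triSeries_ext fun m n p => ?_
  rw [triRightLambda_apply, sliceLambdaNu_triLeft]
  have := lmap_act (β := (rightMul D).flip) (D := dHom D) (β' := (rightMul D).flip) (D' := dHom D)
    (compHom D B) (AddMonoidHom.id V) (compHom D B)
    (fun x y => (compHom_assoc D B x (single 0 y)).symm) (fun _ => rfl) (sliceLambdaNu n T) A
  exact (congrArg (fun X : laurentInv (laurentInv V) => (X.1 m).1 p) this).symm

theorem triRightMu_triLeft (A B : laurentInv V) (T : triSeries V) :
    triRightMu D A (triLeft D B T) = triLeft D B (triRightMu D A T) := by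
  rw [triRightMu_apply, triSwap_triLeft, triRightLambda_triLeft, triSwap_triLeft]
  rfl

theorem act_rightMul_lmap_single (Y A : laurentInv V) :
    act (rightMul D).flip (dHom D) (lmap (single 0) Y) A = lmap (single 0) (compHom D Y A) := by
  have := lmap_act (β := AddMonoidHom.mul) (D := dHom D) (β' := (rightMul D).flip) (D' := dHom D)
    (single 0) (AddMonoidHom.id V) (single 0)
    (fun x y => (compHom_single_zero D x y).symm) (fun _ => rfl) Y A
  rw [lmap_id] at this
  exact this.symm

theorem sliceLambdaNu_triLambda (n n' : ℤ) (Y : laurentInv V) :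
    sliceLambdaNu n' (triLambda n Y) = if n' = n then lmap (single 0) Y else 0 := by
  refine laurentInv_ext fun m => laurentInv_ext fun p => ?_
  rw [sliceLambdaNu_apply, sliceNu_apply, triLambda_apply]
  by_cases h : n' = n
  · simp [h, single_apply]
  · simp [h]

theorem triRightLambda_triLambda (A Y : laurentInv V) (n : ℤ) :
    triRightLambda D A (triLambda n Y) = triLambda n (compHom D Y A) := by
  refine triSeries_ext fun m n' p => ?_
  rw [triRightLambda_apply, sliceLambdaNu_triLambda, ← sliceNu_apply m n' p, ← sliceLambdaNu_apply,
    sliceLambdaNu_triLambda]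
  split_ifs
  · rw [act_rightMul_lmap_single]
  · rw [map_zero]
    rfl

theorem triRightMu_triLambda_single (A : laurentInv V) (m n : ℤ) :
    triRightMu D A (triLambda n (single m 1)) =
      triSwap (triLambda m (compHom D (single n 1) A)) := by
  rw [triRightMu_apply, triSwap_triLambda_single, triRightLambda_triLambda]

variable {D} in
theorem TriDeg.left {T : triSeries V} {d N : ℤ} (h : TriDeg T d) {A : laurentInv V}
    (hA : OrdLE A N) : TriDeg (triLeft D A T) (N + d) := fun m n p hp => by
  have : OrdLE (sliceNu m n T) (d - m - n) := fun p hp => h m n p (by omega)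
  exact hA.act this p (by omega)

variable {D} in
theorem TriDeg.rightLambda {T : triSeries V} {d N : ℤ} (h : TriDeg T d) {A : laurentInv V}
    (hA : OrdLE A N) : TriDeg (triRightLambda D A T) (N + d) := fun m n p hp => by
  have : Deg2 (sliceLambdaNu n T) (d - n) := fun m => h.slice n m
  exact this.act_right D (fun a X e h => h.rightMul D a) hA m p (by omega)

variable {D} in
theorem TriDeg.rightMu {T : triSeries V} {d N : ℤ} (h : TriDeg T d) {A : laurentInv V}
    (hA : OrdLE A N) : TriDeg (triRightMu D A T) (N + d) :=
  TriDeg.swap (TriDeg.rightLambda (D := D) (TriDeg.swap h) hA)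

theorem TriDeg.expandMu {T : triSeries V} {d : ℤ} (h : TriDeg T d) : Deg2 (iotaMu T) d := by
  refine fun j i hi => finsum_eq_zero_of_forall_eq_zero fun x => ?_
  rw [h _ _ _ (by omega), smul_zero]

theorem TriDeg.expandNu {T : triSeries V} {d : ℤ} (h : TriDeg T d) : Deg2 (iotaNu T) d := by
  refine fun j i hi => finsum_eq_zero_of_forall_eq_zero fun x => ?_
  rw [h _ _ _ (by omega), smul_zero]

/-- Two additive maps on `triSeries V` which are bounded with respect to the total degree agree
if they agree on the monomials. -/
theorem eq_of_triLeft {f g : triSeries V →+ laurentInv (laurentInv V)} {N M : ℤ}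
    (hf : ∀ T d, TriDeg T d → Deg2 (f T) (N + d)) (hg : ∀ T d, TriDeg T d → Deg2 (g T) (M + d))
    (h : ∀ B m n, f (triLeft D B (triLambda n (single m 1))) =
      g (triLeft D B (triLambda n (single m 1)))) (T : triSeries V) : f T = g T := by
  refine laurentInv_ext fun q => laurentInv_ext fun i => sub_eq_zero.1 ?_
  refine eq_zero_of_triNu (fun T => ((f T).1 q).1 i - ((g T).1 q).1 i) ?_ ?_ ?_ T
  · intro S T
    simp only [map_add, coe_add_apply]
    abel
  · refine ⟨min (q + i - N) (q + i - M) - 1, fun T hT => ?_⟩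
    rw [hf T _ hT q i (by omega), hg T _ hT q i (by omega), sub_zero]
  · intro m n p a
    rw [triNu_eq_triLeft D, h, sub_self]

/-- For |μ| > |λ| the variable ν becomes μ + λ with μ as the outer variable. This is the left
action, whose derivation λ + ∂ here acts on λᵐ simply as multiplication by λ. -/
theorem iotaMu_triNu (m n : ℤ) (A : laurentInv V) :
    iotaMu (triNu m n A) = act (leftMul D) (leftDer D) A (single n (single m 1)) := by
  refine laurentInv_ext fun j => laurentInv_ext fun i => ?_
  rw [act_apply_apply, iotaMu_apply]
  refine finsum_congr fun x => ?_
  congr 1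
  rw [triNu_apply, leftMul_apply, compHom_const, single_apply]
  by_cases h : j - x.1 + x.2 = n
  · rw [if_pos h, leftDer_iterate_xpow, single_apply]
    split_ifs <;> first | omega | simp
  · rw [if_neg h, iterate_map_zero, if_neg (by omega), coe_zero_apply, mul_zero]

theorem Deg2.act_leftMul {A : laurentInv V} {X : laurentInv (laurentInv V)} {N e : ℤ}
    (hA : OrdLE A N) (hX : Deg2 X e) : Deg2 (act (leftMul D) (leftDer D) A X) (N + e) :=
  hX.act_left (fun a _ _ h => h.leftMul D a) (fun _ _ h => h.leftDer D) hA

theorem Deg2.act_rightMul {A : laurentInv V} {X : laurentInv (laurentInv V)} {N e : ℤ}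
    (hA : OrdLE A N) (hX : Deg2 X e) : Deg2 (act (rightMul D) (rightDer D) A X) (N + e) :=
  hX.act_left (fun a _ _ h => h.rightMul D a) (fun _ _ h => h.rightDer D) hA

theorem iotaMu_triLeft (A : laurentInv V) (T : triSeries V) :
    iotaMu (triLeft D A T) = act (leftMul D) (leftDer D) A (iotaMu T) := by
  obtain ⟨N, hN⟩ := exists_ordLE A
  refine eq_of_triLeft D (f := iotaMu.comp (triLeft D A))
    (g := (act (leftMul D) (leftDer D) A).comp iotaMu) (N := N) (M := N)
    (fun T d h => (h.left hN).expandMu) (fun T d h => h.expandMu.act_leftMul D hN) ?_ T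
  intro B m n
  simp only [AddMonoidHom.comp_apply]
  rw [triLeft_triLeft, ← triNu_eq_triLeft, ← triNu_eq_triLeft, iotaMu_triNu D, iotaMu_triNu D,
    (isDiffModule_left D).left_left]

theorem iotaMu_triLambda (n : ℤ) (Y : laurentInv V) : iotaMu (triLambda n Y) = single n Y := by
  refine laurentInv_ext fun j => laurentInv_ext fun i => ?_
  rw [iotaMu_apply, expandMuLambda, finsum_eq_single _ (0, 0)]
  · simp only [triLambda_apply, single_apply]
    by_cases h : j = n <;> simp [h]
  · rintro ⟨p, l⟩ hx
    rw [triLambda_apply]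
    split_ifs with h
    · obtain ⟨-, rfl⟩ := h
      rw [Ring.choose_zero_pos ℤ (Nat.pos_of_ne_zero fun h => hx (Prod.ext rfl h)), zero_smul]
    · rw [smul_zero]

theorem iotaMu_triSwap_triLambda (m : ℤ) (Y : laurentInv V) :
    iotaMu (triSwap (triLambda m Y)) = lmap (single m) Y := by
  refine laurentInv_ext fun j => laurentInv_ext fun i => ?_
  rw [iotaMu_apply, expandMuLambda, finsum_eq_single _ (0, 0)]
  · simp only [triSwap_apply, triLambda_apply, lmap_apply, single_apply]
    by_cases h : i = m <;> simp [h]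
  · rintro ⟨p, l⟩ hx
    rw [triSwap_apply, triLambda_apply]
    split_ifs with h
    · obtain ⟨-, rfl⟩ := h
      rw [Ring.choose_zero_pos ℤ (Nat.pos_of_ne_zero fun h => hx (Prod.ext rfl h)), zero_smul]
    · rw [smul_zero]

/-- Multiplication from the right on the coefficients commutes with the left action. -/
theorem lmap_flip_act_left (A B : laurentInv V) (X : laurentInv (laurentInv V)) :
    lmap ((compHom D).flip B) (act (leftMul D) (leftDer D) A X) =
      act (leftMul D) (leftDer D) A (lmap ((compHom D).flip B) X) :=
  lmap_act (AddMonoidHom.id V) ((compHom D).flip B) ((compHom D).flip B)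
    (fun x y => compHom_assoc D (single 0 x) y B)
    (fun y => compHom_assoc D (single 1 1) y B) A X

/-- The outer variable μ is not involved: each coefficient, an element of V((λ⁻¹)), is composed with
A from the right. -/
theorem iotaMu_triRightLambda (A : laurentInv V) (T : triSeries V) :
    iotaMu (triRightLambda D A T) = lmap ((compHom D).flip A) (iotaMu T) := by
  obtain ⟨N, hN⟩ := exists_ordLE A
  refine eq_of_triLeft D (f := iotaMu.comp (triRightLambda D A))
    (g := (lmap ((compHom D).flip A)).comp iotaMu) (N := N) (M := N)
    (fun T d h => (h.rightLambda hN).expandMu) (fun T d h => h.expandMu.lmap fun X e hX => ?_) ?_ T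
  · rw [add_comm]
    exact hX.act hN
  intro B m n
  simp only [AddMonoidHom.comp_apply]
  rw [triRightLambda_triLeft, triRightLambda_triLambda, iotaMu_triLeft, iotaMu_triLambda,
    iotaMu_triLeft, iotaMu_triLambda, lmap_flip_act_left, lmap_single]
  rfl

/-- Here A multiplies in the outer variable. Since left and right actions commute, the check reduces
to T = λᵐ μⁿ. -/
theorem iotaMu_triRightMu (A : laurentInv V) (T : triSeries V) :
    iotaMu (triRightMu D A T) = act (leftMul D).flip (dHom D) (iotaMu T) A := by
  obtain ⟨N, hN⟩ := exists_ordLE A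
  refine eq_of_triLeft D (f := iotaMu.comp (triRightMu D A))
    (g := ((act (leftMul D).flip (dHom D)).flip A).comp iotaMu) (N := N) (M := N)
    (fun T d h => (h.rightMu hN).expandMu)
    (fun T d h => h.expandMu.act_right D (fun a _ _ h => h.leftMul D a) hN) ?_ T
  intro B m n
  simp only [AddMonoidHom.comp_apply, AddMonoidHom.flip_apply]
  rw [triRightMu_triLeft, triRightMu_triLambda_single, iotaMu_triLeft, iotaMu_triSwap_triLambda,
    iotaMu_triLeft, iotaMu_triLambda, (isDiffModule_left D).left_right]
  congr 1
  refine (lmap_act (β := AddMonoidHom.mul) (D := dHom D) (β' := (leftMul D).flip) (D' := dHom D)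
    (single m) (AddMonoidHom.id V) (single m) (fun x y => ?_) (fun _ => rfl) (single n 1) A).trans ?_
  · rw [AddMonoidHom.flip_apply, leftMul_apply, AddMonoidHom.id_apply, AddMonoidHom.mul_apply,
      ← compHom_const_xpow D m x, ← compHom_assoc, compHom_single_zero, compHom_const_xpow, mul_comm]
  · rw [lmap_single, lmap_id]

theorem iotaNu_triNu (m n : ℤ) (B : laurentInv V) (i : ℤ) :
    (iotaNu (triNu m n B)).1 i = if 0 ≤ m + n - i then
      (((n - (m + n - i)).negOnePow : ℤ) * Ring.choose n (m + n - i).toNat) •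
        compHom D B (single (m + n - i) 1) else 0 := by
  refine laurentInv_ext fun j => ?_
  rw [iotaNu_apply, expandLambdaNu]
  split_ifs with h
  · rw [finsum_eq_single _ (n, (m + n - i).toNat)]
    · have h' : (((m + n - i).toNat : ℕ) : ℤ) = m + n - i := Int.toNat_of_nonneg h
      rw [coe_zsmul_apply, compHom_single_one, triNu_apply]
      simp only [h']
      rw [if_pos ⟨by ring, trivial⟩]
    · rintro ⟨n', l⟩ hx
      rw [triNu_apply, if_neg, smul_zero]
      rintro ⟨h1, h2⟩
      simp only at h1 h2
      exact hx (by ext <;> simp <;> omega)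
  · refine finsum_eq_zero_of_forall_eq_zero fun x => ?_
    rw [triNu_apply, if_neg, smul_zero]
    omega

theorem iotaNu_triLeft (A : laurentInv V) (T : triSeries V) :
    iotaNu (triLeft D A T) = lmap (compHom D A) (iotaNu T) := by
  obtain ⟨N, hN⟩ := exists_ordLE A
  refine eq_of_triLeft D (f := iotaNu.comp (triLeft D A))
    (g := (lmap (compHom D A)).comp iotaNu) (N := N) (M := N)
    (fun T d h => (h.left hN).expandNu) (fun T d h => h.expandNu.lmap fun X e hX => hN.act hX) ?_ T
  intro B m n
  simp only [AddMonoidHom.comp_apply]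
  rw [triLeft_triLeft, ← triNu_eq_triLeft, ← triNu_eq_triLeft]
  refine laurentInv_ext fun i => ?_
  rw [lmap_apply, iotaNu_triNu D, iotaNu_triNu D]
  split_ifs
  · rw [map_zsmul, compHom_assoc]
  · rw [map_zero]

/-- In this expansion μ = -(λ - ν), and λ - ν is how ∂ acts through the right module structure on
V((ν⁻¹)); hence the sign (-1)ⁿ. -/
theorem iotaNu_triLambda (n : ℤ) (Y : laurentInv V) :
    iotaNu (triLambda n Y) = (n.negOnePow : ℤ) •
      act (rightMul D) (rightDer D) (single n 1) (lmap (single 0) Y) := by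
  have hneg : ∀ k : ℕ, ((n - k).negOnePow : ℤ) = (n.negOnePow : ℤ) * (-1) ^ k := fun k => by
    rw [Int.negOnePow_sub, Units.val_mul, Int.negOnePow_def (k : ℤ)]
    simp
  refine laurentInv_ext fun i => laurentInv_ext fun j => ?_
  rw [coe_zsmul_apply, coe_zsmul_apply, act_apply_apply, iotaNu_apply, expandLambdaNu]
  rw [finsum_eq_finsum_comp (fun k : ℕ => (n, k)) (fun _ _ h => (Prod.ext_iff.1 h).2),
    finsum_eq_finsum_comp (fun k : ℕ => (n, k)) (fun _ _ h => (Prod.ext_iff.1 h).2)]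
  · simp only [triLambda_apply, single_apply_same, (isDiffModule_right D).one_act, lmap_apply,
      rightDer_iterate, coe_zsmul_apply, compHom_single_one, single_apply, true_and]
    by_cases hj : 0 ≤ j
    · have h' : ((j.toNat : ℕ) : ℤ) = j := Int.toNat_of_nonneg hj
      rw [finsum_eq_single _ j.toNat, finsum_eq_single _ j.toNat]
      · rw [h', if_pos (sub_self j), if_pos (sub_self j), ← h', hneg, h', smul_smul, smul_smul]
        rw [show i + j - n = i - n + j by ring, mul_right_comm, mul_assoc]
      · intro k hk
        rw [if_neg (by omega), smul_zero, smul_zero]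
      · intro k hk
        rw [if_neg (by omega), smul_zero]
    · rw [finsum_eq_zero_of_forall_eq_zero, finsum_eq_zero_of_forall_eq_zero, smul_zero]
      · intro k
        rw [if_neg (by omega), smul_zero, smul_zero]
      · intro k
        rw [if_neg (by omega), smul_zero]
  · rintro ⟨n', k⟩ h
    have : n' ≠ n := fun h' => h ⟨k, by rw [h']⟩
    simp [single_apply, this]
  · rintro ⟨n', k⟩ h
    have : n' ≠ n := fun h' => h ⟨k, by rw [h']⟩
    simp [triLambda_apply, this]

/-- Multiplication from the left on the coefficients commutes with the right action. -/
theorem lmap_act_right (A B : laurentInv V) (X : laurentInv (laurentInv V)) :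
    lmap (compHom D B) (act (rightMul D).flip (dHom D) X A) =
      act (rightMul D).flip (dHom D) (lmap (compHom D B) X) A := by
  have := lmap_act (β := (rightMul D).flip) (D := dHom D) (β' := (rightMul D).flip) (D' := dHom D)
    (compHom D B) (AddMonoidHom.id V) (compHom D B)
    (fun x y => (compHom_assoc D B x (single 0 y)).symm) (fun _ => rfl) X A
  rwa [lmap_id] at this

/-- Multiplication from the left on the coefficients commutes with the left action. -/
theorem lmap_act_left (A B : laurentInv V) (X : laurentInv (laurentInv V)) :
    lmap (compHom D B) (act (rightMul D) (rightDer D) A X) =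
      act (rightMul D) (rightDer D) A (lmap (compHom D B) X) := by
  have := lmap_act (β := rightMul D) (D := rightDer D) (β' := rightMul D) (D' := rightDer D)
    (AddMonoidHom.id V) (compHom D B) (compHom D B)
    (fun x y => (compHom_assoc D B y (single 0 x)).symm)
    (fun y => by
      rw [rightDer_apply, rightDer_apply, map_neg, compHom_assoc]) A X
  rwa [lmap_id] at this

theorem iotaNu_triRightLambda (A : laurentInv V) (T : triSeries V) :
    iotaNu (triRightLambda D A T) = act (rightMul D).flip (dHom D) (iotaNu T) A := by
  obtain ⟨N, hN⟩ := exists_ordLE A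
  refine eq_of_triLeft D (f := iotaNu.comp (triRightLambda D A))
    (g := ((act (rightMul D).flip (dHom D)).flip A).comp iotaNu) (N := N) (M := N)
    (fun T d h => (h.rightLambda hN).expandNu)
    (fun T d h => h.expandNu.act_right D (fun a _ _ h => h.rightMul D a) hN) ?_ T
  intro B m n
  simp only [AddMonoidHom.comp_apply, AddMonoidHom.flip_apply]
  rw [triRightLambda_triLeft, triRightLambda_triLambda, iotaNu_triLeft, iotaNu_triLambda D,
    iotaNu_triLeft, iotaNu_triLambda D, ← lmap_act_right, ← act_rightMul_lmap_single,
    map_zsmul (act (rightMul D).flip (dHom D)), AddMonoidHom.smul_apply,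
    (isDiffModule_right D).left_right]

/-- Substituting -(λ - ν) for μ in y μⁿ gives (-1)ⁿ (λ - ν)ⁿ y, the action of (-∂)ⁿ ∘ y; this is
where adjoints enter. -/
theorem iotaNu_triSwap_triLambda (m : ℤ) (Y : laurentInv V) :
    iotaNu (triSwap (triLambda m Y)) =
      act (rightMul D) (rightDer D) (adjHom D Y) (single m (single 0 1)) := by
  refine laurentInv_ext fun q => laurentInv_ext fun i => sub_eq_zero.1 ?_
  refine eq_zero_of_single (fun Y => ((iotaNu (triSwap (triLambda m Y))).1 q).1 i -
    ((act (rightMul D) (rightDer D) (adjHom D Y) (single m (single 0 1))).1 q).1 i) ?_ ?_ ?_ Y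
  · intro A B
    simp only [map_add, AddMonoidHom.add_apply, coe_add_apply]
    abel
  · refine ⟨q + i - m - 1, fun A hA => ?_⟩
    have h1 : TriDeg (triLambda m A) (q + i - 1) := fun m' n' p hp => by
      rw [triLambda_apply]
      split_ifs
      · exact hA _ (by omega)
      · rfl
    have h2 : Deg2 (single m (single 0 (1 : V))) m := fun j => by
      rw [single_apply]
      split_ifs with h
      · rw [h, sub_self]
        exact ordLE_single 0 1
      · exact fun _ _ => rfl
    rw [h1.swap.expandNu q i (by omega),
      h2.act_rightMul D (hA.adjHom D) q i (by omega), sub_zero]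
  · intro n y
    rw [triSwap_triLambda_single, iotaNu_triLambda D, adjHom_single, lmap_single]
    have := (isDiffModule_right D).left_left (single n 1) (single 0 y) (single m (single 0 1))
    rw [IsDiffModule.const_left, lmap_single, rightMul_apply, compHom_one_left] at this
    rw [← this]
    refine sub_eq_zero.2 (congrArg (fun X : laurentInv (laurentInv V) => (X.1 q).1 i) ?_)
    rw [← AddMonoidHom.smul_apply, ← map_zsmul]
    rfl

/-- Right composition in μ becomes a left action because the substitution for μ passes to adjoints,
which reverse products. -/
theorem iotaNu_triRightMu (A : laurentInv V) (T : triSeries V) :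
    iotaNu (triRightMu D A T) = act (rightMul D) (rightDer D) (adjHom D A) (iotaNu T) := by
  obtain ⟨N, hN⟩ := exists_ordLE A
  refine eq_of_triLeft D (f := iotaNu.comp (triRightMu D A))
    (g := (act (rightMul D) (rightDer D) (adjHom D A)).comp iotaNu) (N := N) (M := N)
    (fun T d h => (h.rightMu hN).expandNu)
    (fun T d h => h.expandNu.act_rightMul D (hN.adjHom D)) ?_ T
  intro B m n
  simp only [AddMonoidHom.comp_apply]
  rw [triRightMu_triLeft, triRightMu_triLambda_single, iotaNu_triLeft, iotaNu_triSwap_triLambda D,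
    iotaNu_triLeft, ← triSwap_triLambda_single, iotaNu_triSwap_triLambda D, ← lmap_act_left,
    ← (isDiffModule_right D).left_left]
  congr 3
  exact Psd.adj_mul (D := D) (single n 1) A

theorem triRightLambda_mulNu (A : laurentInv V) (T : triSeries V) :
    triRightLambda D A (mulNuSubLambdaSubMu V T) = mulNuSubLambdaSubMu V (triRightLambda D A T) := by
  -- On slices, ν - λ is minus the action of ∂ for the right module structure, which commutes with
  -- right products in λ; the factor μ only shifts n.
  have h : ∀ (T : triSeries V) (n : ℤ), sliceLambdaNu n (mulNuSubLambdaSubMu V T) =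
      -act (rightMul D) (rightDer D) (single 1 1) (sliceLambdaNu n T) -
        sliceLambdaNu (n - 1) T := by
    intro T n
    refine laurentInv_ext fun m => ?_
    rw [coe_sub_apply, coe_neg_apply, act_single_left, finsum_nat_eq_sum _ 1, Finset.sum_range_succ,
      Finset.sum_range_one]
    · refine laurentInv_ext fun p => ?_
      simp only [(isDiffModule_right D).one_act, coe_sub_apply, coe_neg_apply, coe_add_apply,
        rightDer_iterate, Ring.choose_zero_right, Ring.choose_one_right, one_smul,
        coe_zsmul_apply, compHom_single_one]
      simp [mulNuSubLambdaSubMu, sliceLambdaNu, sliceNu]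
      abel
    · intro k hk
      have : Ring.choose (1 : ℤ) k = 0 := by
        have := Ring.choose_natCast (R := ℤ) 1 k
        rw [Nat.cast_one] at this
        rw [this, Nat.choose_eq_zero_of_lt hk, Nat.cast_zero]
      rw [this, zero_smul]
  have key : ∀ n, sliceLambdaNu n (triRightLambda D A (mulNuSubLambdaSubMu V T)) =
      sliceLambdaNu n (mulNuSubLambdaSubMu V (triRightLambda D A T)) := by
    intro n
    rw [h, sliceLambdaNu_triRightLambda, h, map_sub, map_neg, AddMonoidHom.sub_apply,
      AddMonoidHom.neg_apply, (isDiffModule_right D).left_right]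
    rfl
  exact triSeries_ext fun m n p =>
    congrArg (fun X : laurentInv (laurentInv V) => (X.1 m).1 p) (key n)

theorem triSwap_mulNu (T : triSeries V) :
    triSwap (mulNuSubLambdaSubMu V T) = mulNuSubLambdaSubMu V (triSwap T) :=
  triSeries_ext fun _ _ _ => sub_right_comm _ _ _

theorem triRightMu_mulNu (A : laurentInv V) (T : triSeries V) :
    triRightMu D A (mulNuSubLambdaSubMu V T) = mulNuSubLambdaSubMu V (triRightMu D A T) := by
  rw [triRightMu_apply, triSwap_mulNu, triRightLambda_mulNu, triSwap_mulNu]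
  rfl

/-- Multiplication by ν is right composition with ∂ on each slice, hence commutes with left
composition by A. -/
theorem triLeft_mulNu (A : laurentInv V) (T : triSeries V) :
    triLeft D A (mulNuSubLambdaSubMu V T) = mulNuSubLambdaSubMu V (triLeft D A T) := by
  have h : ∀ (T : triSeries V) (m n : ℤ), sliceNu m n (mulNuSubLambdaSubMu V T) =
      compHom D (sliceNu m n T) (single 1 1) - sliceNu (m - 1) n T - sliceNu m (n - 1) T := by
    intro T m n
    refine laurentInv_ext fun p => ?_
    rw [coe_sub_apply, coe_sub_apply, compHom_single_one]
    rfl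
  have key : ∀ m n, sliceNu m n (triLeft D A (mulNuSubLambdaSubMu V T)) =
      sliceNu m n (mulNuSubLambdaSubMu V (triLeft D A T)) := by
    intro m n
    rw [h]
    change compHom D A _ = compHom D (compHom D A _) _ - compHom D A _ - compHom D A _
    rw [h, map_sub, map_sub, compHom_assoc]
  exact triSeries_ext fun m n p => congrArg (fun X : laurentInv V => X.1 p) (key m n)

end TriOps
end DiracReduction

namespace DiracReduction

/-! ### Matrices of operators -/

section MatAct

variable {X Y Z W W' U : Type*} [AddCommGroup X] [AddCommGroup Y] [AddCommGroup Z]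
  [AddCommGroup W] [AddCommGroup W'] [AddCommGroup U] {l m n o : ℕ}

/-- Product of matrices of symbols. -/
noncomputable def matAct (β : X →+ Y →+ Z) (D : Y →+ Y) (A : Matrix (Fin l) (Fin m) (laurentInv X))
    (B : Matrix (Fin m) (Fin n) (laurentInv Y)) : Matrix (Fin l) (Fin n) (laurentInv Z) :=
  fun i j => ∑ k, act β D (A i k) (B k j)

theorem matAct_apply (β : X →+ Y →+ Z) (D : Y →+ Y) (A : Matrix (Fin l) (Fin m) (laurentInv X))
    (B : Matrix (Fin m) (Fin n) (laurentInv Y)) (i : Fin l) (j : Fin n) :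
    matAct β D A B i j = ∑ k, act β D (A i k) (B k j) := rfl

theorem matAct_assoc {β₁₂ : X →+ Y →+ W} {β₃ : W →+ Z →+ U} {β₂₃ : Y →+ Z →+ W'}
    {β₁ : X →+ W' →+ U} {DY : Y →+ Y} {DZ : Z →+ Z} {DW : W' →+ W'}
    (h : ∀ A B C, act β₃ DZ (act β₁₂ DY A B) C = act β₁ DW A (act β₂₃ DZ B C))
    (A : Matrix (Fin l) (Fin m) (laurentInv X)) (B : Matrix (Fin m) (Fin n) (laurentInv Y))
    (C : Matrix (Fin n) (Fin o) (laurentInv Z)) :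
    matAct β₃ DZ (matAct β₁₂ DY A B) C = matAct β₁ DW A (matAct β₂₃ DZ B C) := by
  ext1 i j
  simp only [matAct_apply, map_sum, AddMonoidHom.finsetSum_apply, h]
  exact Finset.sum_comm

variable (β : X →+ Y →+ Z) (D : Y →+ Y)

theorem matAct_add (A : Matrix (Fin l) (Fin m) (laurentInv X))
    (B C : Matrix (Fin m) (Fin n) (laurentInv Y)) :
    matAct β D A (B + C) = matAct β D A B + matAct β D A C := by
  ext1 i j
  simp only [matAct_apply, Matrix.add_apply, map_add, Finset.sum_add_distrib]

theorem add_matAct (A B : Matrix (Fin l) (Fin m) (laurentInv X))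
    (C : Matrix (Fin m) (Fin n) (laurentInv Y)) :
    matAct β D (A + B) C = matAct β D A C + matAct β D B C := by
  ext1 i j
  simp only [matAct_apply, Matrix.add_apply, map_add, Finset.sum_add_distrib,
    AddMonoidHom.add_apply]

theorem matAct_neg (A : Matrix (Fin l) (Fin m) (laurentInv X))
    (B : Matrix (Fin m) (Fin n) (laurentInv Y)) :
    matAct β D A (-B) = -matAct β D A B := by
  ext1 i j
  simp only [matAct_apply, Matrix.neg_apply, map_neg, Finset.sum_neg_distrib]

theorem neg_matAct (A : Matrix (Fin l) (Fin m) (laurentInv X))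
    (B : Matrix (Fin m) (Fin n) (laurentInv Y)) :
    matAct β D (-A) B = -matAct β D A B := by
  ext1 i j
  simp only [matAct_apply, Matrix.neg_apply, map_neg, Finset.sum_neg_distrib,
    AddMonoidHom.neg_apply]

theorem matAct_sub (A : Matrix (Fin l) (Fin m) (laurentInv X))
    (B C : Matrix (Fin m) (Fin n) (laurentInv Y)) :
    matAct β D A (B - C) = matAct β D A B - matAct β D A C := by
  rw [sub_eq_add_neg, matAct_add, matAct_neg, ← sub_eq_add_neg]

theorem sub_matAct (A B : Matrix (Fin l) (Fin m) (laurentInv X))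
    (C : Matrix (Fin m) (Fin n) (laurentInv Y)) :
    matAct β D (A - B) C = matAct β D A C - matAct β D B C := by
  rw [sub_eq_add_neg, add_matAct, neg_matAct, ← sub_eq_add_neg]

theorem matAct_zero (A : Matrix (Fin l) (Fin m) (laurentInv X)) :
    matAct β D A (0 : Matrix (Fin m) (Fin n) (laurentInv Y)) = 0 := by
  ext1 i j
  simp only [matAct_apply, Matrix.zero_apply, map_zero, Finset.sum_const_zero]

theorem zero_matAct (B : Matrix (Fin m) (Fin n) (laurentInv Y)) :
    matAct β D (0 : Matrix (Fin l) (Fin m) (laurentInv X)) B = 0 := by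
  ext1 i j
  simp only [matAct_apply, Matrix.zero_apply, map_zero, Finset.sum_const_zero,
    AddMonoidHom.zero_apply]

end MatAct

section MatComp

variable {F V : Type*} [Field F] [CommRing V] [Algebra F V] (D : Derivation F V V)
  {k l m n : ℕ}

theorem matComp_apply (A : Matrix (Fin l) (Fin m) (PsDO V))
    (B : Matrix (Fin m) (Fin n) (PsDO V)) (i : Fin l) (j : Fin n) :
    matComp D A B i j = ∑ k, compHom D (A i k) (B k j) := rfl

theorem matComp_assoc (A : Matrix (Fin k) (Fin l) (PsDO V)) (B : Matrix (Fin l) (Fin m) (PsDO V))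
    (C : Matrix (Fin m) (Fin n) (PsDO V)) :
    matComp D (matComp D A B) C = matComp D A (matComp D B C) :=
  matAct_assoc (compHom_assoc D) A B C

theorem matOne_apply (i j : Fin m) : matOne V m i j = if i = j then single 0 1 else 0 := by
  rw [matOne, Matrix.diagonal_apply]
  rfl

theorem matOne_matComp (A : Matrix (Fin m) (Fin n) (PsDO V)) : matComp D (matOne V m) A = A := by
  ext1 i j
  rw [matComp_apply, Finset.sum_eq_single_of_mem i (Finset.mem_univ _)]
  · rw [matOne_apply, if_pos rfl, compHom_one_left]
  · intro k _ hk
    rw [matOne_apply, if_neg hk.symm, map_zero, AddMonoidHom.zero_apply]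

theorem matComp_matOne (A : Matrix (Fin m) (Fin n) (PsDO V)) : matComp D A (matOne V n) = A := by
  ext1 i j
  rw [matComp_apply, Finset.sum_eq_single_of_mem j (Finset.mem_univ _)]
  · rw [matOne_apply, if_pos rfl, compHom_one_right]
  · intro k _ hk
    rw [matOne_apply, if_neg hk, map_zero]

theorem matAdjoint_apply (A : Matrix (Fin l) (Fin m) (PsDO V)) (i : Fin m) (j : Fin l) :
    matAdjoint D A i j = adjHom D (A j i) := rfl

theorem adjHom_compHom (A B : laurentInv V) :
    adjHom D (compHom D A B) = compHom D (adjHom D B) (adjHom D A) := Psd.adj_mul (D := D) A B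

theorem adjHom_adjHom (A : laurentInv V) : adjHom D (adjHom D A) = A := Psd.adj_adj (D := D) A

theorem adjHom_const (a : V) : adjHom D (single 0 a) = single 0 a := Psd.adj_const (D := D) a

theorem matAdjoint_matComp (A : Matrix (Fin l) (Fin m) (PsDO V))
    (B : Matrix (Fin m) (Fin n) (PsDO V)) :
    matAdjoint D (matComp D A B) = matComp D (matAdjoint D B) (matAdjoint D A) := by
  ext1 i j
  simp only [matAdjoint_apply, matComp_apply, map_sum, adjHom_compHom]

theorem matAdjoint_matAdjoint (A : Matrix (Fin l) (Fin m) (PsDO V)) :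
    matAdjoint D (matAdjoint D A) = A := by
  ext1 i j
  simp only [matAdjoint_apply, adjHom_adjHom]

theorem matAdjoint_sub (A B : Matrix (Fin l) (Fin m) (PsDO V)) :
    matAdjoint D (A - B) = matAdjoint D A - matAdjoint D B := by
  ext1 i j
  simp only [matAdjoint_apply, Matrix.sub_apply, map_sub]

theorem matAdjoint_matOne : matAdjoint D (matOne V m) = matOne V m := by
  ext1 i j
  rw [matAdjoint_apply, matOne_apply, matOne_apply]
  by_cases h : i = j
  · rw [if_pos h, if_pos h.symm, adjHom_const]
  · rw [if_neg h, if_neg (fun h' => h h'.symm), map_zero]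

theorem matComp_sub (A : Matrix (Fin l) (Fin m) (PsDO V)) (B C : Matrix (Fin m) (Fin n) (PsDO V)) :
    matComp D A (B - C) = matComp D A B - matComp D A C :=
  matAct_sub (AddMonoidHom.mul (R := V)) (dHom D) A B C

theorem sub_matComp (A B : Matrix (Fin l) (Fin m) (PsDO V)) (C : Matrix (Fin m) (Fin n) (PsDO V)) :
    matComp D (A - B) C = matComp D A C - matComp D B C :=
  sub_matAct (AddMonoidHom.mul (R := V)) (dHom D) A B C

theorem matComp_neg (A : Matrix (Fin l) (Fin m) (PsDO V)) (B : Matrix (Fin m) (Fin n) (PsDO V)) :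
    matComp D A (-B) = -matComp D A B :=
  matAct_neg (AddMonoidHom.mul (R := V)) (dHom D) A B

theorem neg_matComp (A : Matrix (Fin l) (Fin m) (PsDO V)) (B : Matrix (Fin m) (Fin n) (PsDO V)) :
    matComp D (-A) B = -matComp D A B :=
  neg_matAct (AddMonoidHom.mul (R := V)) (dHom D) A B

theorem matComp_zero (A : Matrix (Fin l) (Fin m) (PsDO V)) :
    matComp D A (0 : Matrix (Fin m) (Fin n) (PsDO V)) = 0 :=
  matAct_zero (AddMonoidHom.mul (R := V)) (dHom D) A

theorem zero_matComp (B : Matrix (Fin m) (Fin n) (PsDO V)) :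
    matComp D (0 : Matrix (Fin l) (Fin m) (PsDO V)) B = 0 :=
  zero_matAct (AddMonoidHom.mul (R := V)) (dHom D) B

/-- The inverse of a skewadjoint matrix is skewadjoint. -/
theorem matAdjoint_inverse {A B : Matrix (Fin m) (Fin m) (PsDO V)} (h : IsMatInverse D A B)
    (hA : matAdjoint D A = -A) : matAdjoint D B = -B := by
  have h1 : matComp D (matAdjoint D B) A = -matOne V m := by
    rw [← matAdjoint_matOne D, ← h.1, matAdjoint_matComp, hA, matComp_neg, neg_neg]
  calc matAdjoint D B = matComp D (matAdjoint D B) (matComp D A B) := by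
        rw [h.1, matComp_matOne]
    _ = -B := by rw [← matComp_assoc, h1, neg_matComp, matOne_matComp]

end MatComp

/-! ### Fréchet derivatives and the Master Formula -/

namespace DifferentialFunctionAlgebra

variable {F V : Type*} [Field F] [CommRing V] [Algebra F V] {ℓ m : ℕ}
  (𝒱 : DifferentialFunctionAlgebra F V ℓ)

/-- The entries `∑ₙ (∂f/∂uᵢ⁽ⁿ⁾) ∂ⁿ` of the Frechet derivative of `f`. -/
def fr (i : Fin ℓ) : V →+ laurentInv V where
  toFun f := 𝒱.frechet (fun _ : Fin 1 => f) 0 i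
  map_zero' := laurentInv_ext fun n => by simp [frechet]
  map_add' f g := laurentInv_ext fun n => by
    simp only [frechet, coe_add_apply, map_add]
    split_ifs <;> simp

theorem frechet_eq_fr (θ : Fin m → V) (α : Fin m) (i : Fin ℓ) :
    𝒱.frechet θ α i = 𝒱.fr i (θ α) := rfl

theorem fr_apply (i : Fin ℓ) (f : V) (n : ℤ) :
    (𝒱.fr i f).1 n = if 0 ≤ n then 𝒱.pd i n.toNat f else 0 := rfl

theorem fr_isDifferential (i : Fin ℓ) (f : V) : PsDO.IsDifferential (𝒱.fr i f) := fun n hn => by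
  rw [fr_apply, if_neg (by omega)]

theorem exists_pd_bound (f : V) : ∃ K : ℕ, ∀ i n, K ≤ n → 𝒱.pd i n f = 0 := by
  obtain ⟨N, hN⟩ := ((𝒱.pd_finite f).image Prod.snd).bddAbove
  refine ⟨N + 1, fun i n hn => ?_⟩
  by_contra h
  have := hN ⟨(i, n), h, rfl⟩
  simp only at this
  omega

theorem fr_eq_sum (i : Fin ℓ) (f : V) (K : ℕ) (hK : ∀ n, K ≤ n → 𝒱.pd i n f = 0) :
    𝒱.fr i f = ∑ n ∈ Finset.range K, single (n : ℤ) (𝒱.pd i n f) := by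
  refine laurentInv_ext fun q => ?_
  rw [coe_sum_apply, fr_apply]
  simp only [single_apply]
  split_ifs with h
  · by_cases hq : q.toNat < K
    · rw [Finset.sum_eq_single_of_mem q.toNat (Finset.mem_range.2 hq), if_pos (by omega)]
      intro n _ hn
      exact if_neg (by omega)
    · rw [hK _ (by omega), Finset.sum_eq_zero]
      intro n hn
      rw [Finset.mem_range] at hn
      exact if_neg (by omega)
  · rw [Finset.sum_eq_zero]
    intro n hn
    exact if_neg (by omega)

theorem fr_mul (i : Fin ℓ) (f g : V) : 𝒱.fr i (f * g) =
    compHom 𝒱.D (single 0 f) (𝒱.fr i g) + compHom 𝒱.D (single 0 g) (𝒱.fr i f) := by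
  refine laurentInv_ext fun q => ?_
  rw [coe_add_apply, compHom_const, compHom_const, fr_apply, fr_apply, fr_apply]
  split_ifs <;> simp

end DifferentialFunctionAlgebra

theorem compHom_x_apply {F V : Type*} [Field F] [CommRing V] [Algebra F V] (D : Derivation F V V)
    (X : laurentInv V) (q : ℤ) :
    (compHom D (single 1 1) X).1 q = X.1 (q - 1) + D (X.1 q) := by
  rw [compHom, act_single_left, finsum_nat_eq_sum _ 1, Finset.sum_range_succ, Finset.sum_range_one]
  · simp
  · intro k hk
    have : Ring.choose (1 : ℤ) k = 0 := by
      have := Ring.choose_natCast (R := ℤ) 1 k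
      rw [Nat.cast_one] at this
      rw [this, Nat.choose_eq_zero_of_lt hk, Nat.cast_zero]
    rw [this, zero_smul]

namespace DifferentialFunctionAlgebra

variable {F V : Type*} [Field F] [CommRing V] [Algebra F V] {ℓ m : ℕ}
  (𝒱 : DifferentialFunctionAlgebra F V ℓ)

/-- This is the commutation rule between ∂/∂uᵢ⁽ⁿ⁾ and ∂, collected over all n; for n = 0 there is no
lower partial derivative. -/
theorem fr_D (i : Fin ℓ) (f : V) : 𝒱.fr i (𝒱.D f) = compHom 𝒱.D (single 1 1) (𝒱.fr i f) := by
  refine laurentInv_ext fun q => ?_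
  rw [compHom_x_apply, fr_apply, fr_apply, fr_apply]
  by_cases h0 : 0 ≤ q
  · obtain ⟨n, rfl⟩ := Int.eq_ofNat_of_zero_le h0
    cases n with
    | zero => simp [𝒱.pd_zero_D]
    | succ n =>
      have : ((n + 1 : ℕ) : ℤ) - 1 = n := by push_cast; ring
      rw [this, if_pos (by omega), if_pos (by omega), if_pos (by omega), Int.toNat_natCast,
        Int.toNat_natCast, 𝒱.pd_succ_D, add_comm]
  · rw [if_neg h0, if_neg (by omega), if_neg h0, map_zero, add_zero]

theorem fr_u (i j : Fin ℓ) : 𝒱.fr j (𝒱.u i) = if j = i then single 0 1 else 0 := by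
  refine laurentInv_ext fun q => ?_
  rw [fr_apply, u, 𝒱.pd_incl, MvPolynomial.pderiv_X]
  by_cases h : j = i
  · rw [if_pos h, single_apply, h]
    by_cases hq : q = 0
    · simp [hq]
    · rw [if_neg hq]
      split_ifs with h0
      · have : (i, q.toNat) ≠ (i, 0) := fun h => hq (by
          have := (Prod.ext_iff.1 h).2
          simp only at this
          omega)
        rw [Pi.single_eq_of_ne' this, map_zero]
      · rfl
  · rw [if_neg h, Pi.single_eq_of_ne' (fun h' => h (Prod.ext_iff.1 h').1), map_zero, ite_self]
    rfl

theorem adjHom_fr (i : Fin ℓ) (f : V) (K : ℕ) (hK : ∀ n, K ≤ n → 𝒱.pd i n f = 0) :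
    adjHom 𝒱.D (𝒱.fr i f) = ∑ k ∈ Finset.range K,
      compHom 𝒱.D (single (k : ℤ) ((-1) ^ k)) (single 0 (𝒱.pd i k f)) := by
  rw [𝒱.fr_eq_sum i f K hK, map_sum]
  refine Finset.sum_congr rfl fun k _ => ?_
  rw [adjHom_single]
  have : ((-1 : V) ^ k) = ((k : ℤ).negOnePow : ℤ) • 1 := by
    rw [Int.negOnePow_def]
    simp
  rw [this, map_zsmul, map_zsmul]
  rfl

/-- The sum over k assembles (-λ-∂)ᵏ ∂f/∂uᵢ⁽ᵏ⁾ into the adjoint of the Fréchet derivative of f, and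
the sum over n assembles the Fréchet derivative of g. -/
theorem masterBracket_eq (H : Matrix (Fin ℓ) (Fin ℓ) (PsDO V)) (f g : V) :
    𝒱.masterBracket H f g = ∑ i, ∑ j, compHom 𝒱.D (𝒱.fr j g)
      (compHom 𝒱.D (H j i) (adjHom 𝒱.D (𝒱.fr i f))) := by
  obtain ⟨K, hK⟩ := 𝒱.exists_pd_bound f
  obtain ⟨L, hL⟩ := 𝒱.exists_pd_bound g
  refine Finset.sum_congr rfl fun i _ => Finset.sum_congr rfl fun j _ => ?_
  rw [𝒱.adjHom_fr i f K (hK i), 𝒱.fr_eq_sum j g L (hL j),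
    finsum_eq_sum_of_support_subset (s := Finset.range K ×ˢ Finset.range L), Finset.sum_product]
  · simp only [map_sum, AddMonoidHom.finsetSum_apply]
    rfl
  · rintro ⟨k, n⟩ hx
    simp only [Finset.coe_product, Finset.coe_range, Set.mem_prod, Set.mem_Iio]
    by_contra h
    refine hx ?_
    simp only [comp_eq_compHom, monomial_eq_single]
    by_cases hk : k < K
    · rw [hL j n (by omega), map_zero, map_zero, AddMonoidHom.zero_apply]
    · rw [hK i k (by omega), map_zero, map_zero, map_zero, map_zero]

theorem masterBracket_eq_matComp (H : Matrix (Fin ℓ) (Fin ℓ) (PsDO V)) {n : ℕ} (θ : Fin m → V)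
    (η : Fin n → V) (α : Fin m) (β : Fin n) : 𝒱.masterBracket H (η β) (θ α) =
      matComp 𝒱.D (matComp 𝒱.D (𝒱.frechet θ) H) (matAdjoint 𝒱.D (𝒱.frechet η)) α β := by
  rw [masterBracket_eq]
  simp only [matComp_apply, matAdjoint_apply, frechet_eq_fr, map_sum, AddMonoidHom.finsetSum_apply,
    compHom_assoc]

theorem bracketMatrix_eq (H : Matrix (Fin ℓ) (Fin ℓ) (PsDO V)) (θ : Fin m → V) :
    bracketMatrix (𝒱.masterBracket H) θ = 𝒱.constraintOperator H θ := by
  ext1 α β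
  exact 𝒱.masterBracket_eq_matComp H θ θ α β

/-- Both corrections equal D_g ∘ H ∘ D_θ* ∘ C⁻¹ ∘ D_θ ∘ H ∘ D_f*, by associativity. -/
theorem diracBracket_eq (H : Matrix (Fin ℓ) (Fin ℓ) (PsDO V)) (θ : Fin m → V)
    (Cinv : Matrix (Fin m) (Fin m) (PsDO V)) (f g : V) :
    diracBracket 𝒱.D (𝒱.masterBracket H) θ Cinv f g =
      𝒱.masterBracket (𝒱.diracModification H θ Cinv) f g := by
  have h1 := fun H' => 𝒱.masterBracket_eq_matComp H' (fun _ : Fin 1 => g) (fun _ : Fin 1 => f) 0 0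
  have h2 := fun β => 𝒱.masterBracket_eq_matComp H (fun _ : Fin 1 => g) θ 0 β
  have h3 := fun α => 𝒱.masterBracket_eq_matComp H θ (fun _ : Fin 1 => f) α 0
  rw [h1, diracBracket, h1, diracModification]
  simp only [h2, h3, matComp_sub, sub_matComp, Matrix.sub_apply]
  congr 1
  simp only [← matComp_assoc]
  rw [Finset.sum_comm]
  simp only [comp_eq_compHom]
  simp only [← map_sum, ← matComp_apply]
  simp only [← matComp_assoc]

/-! ### Algebra of the Dirac projection -/

section Reduction

variable (H : Matrix (Fin ℓ) (Fin ℓ) (PsDO V)) (θ : Fin m → V)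
  (Cinv : Matrix (Fin m) (Fin m) (PsDO V))

/-- `C⁻¹ ∘ D_θ ∘ H`. -/
noncomputable def multiplier : Matrix (Fin m) (Fin ℓ) (PsDO V) :=
  matComp 𝒱.D Cinv (matComp 𝒱.D (𝒱.frechet θ) H)

/-- `H ∘ D_θ*`. -/
noncomputable def constraintField : Matrix (Fin ℓ) (Fin m) (PsDO V) :=
  matComp 𝒱.D H (matAdjoint 𝒱.D (𝒱.frechet θ))

/-- The projection `1 - D_θ* ∘ C⁻¹ ∘ D_θ ∘ H`. -/
noncomputable def diracProj : Matrix (Fin ℓ) (Fin ℓ) (PsDO V) :=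
  matOne V ℓ - matComp 𝒱.D (matAdjoint 𝒱.D (𝒱.frechet θ)) (𝒱.multiplier H θ Cinv)

theorem diracModification_eq : 𝒱.diracModification H θ Cinv =
    H - matComp 𝒱.D (𝒱.constraintField H θ) (𝒱.multiplier H θ Cinv) := rfl

theorem constraintOperator_eq : 𝒱.constraintOperator H θ =
    matComp 𝒱.D (𝒱.frechet θ) (𝒱.constraintField H θ) := matComp_assoc _ _ _ _

theorem diracModification_eq_comp_diracProj :
    𝒱.diracModification H θ Cinv = matComp 𝒱.D H (𝒱.diracProj H θ Cinv) := by
  rw [diracModification_eq, diracProj, matComp_sub, matComp_matOne, constraintField, matComp_assoc]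

variable {Cinv}

theorem multiplier_comp_adjoint (hC : IsMatInverse 𝒱.D (𝒱.constraintOperator H θ) Cinv) :
    matComp 𝒱.D (𝒱.multiplier H θ Cinv) (matAdjoint 𝒱.D (𝒱.frechet θ)) = matOne V m := by
  rw [multiplier, matComp_assoc]
  exact hC.2

theorem diracModification_comp_adjoint
    (hC : IsMatInverse 𝒱.D (𝒱.constraintOperator H θ) Cinv) :
    matComp 𝒱.D (𝒱.diracModification H θ Cinv) (matAdjoint 𝒱.D (𝒱.frechet θ)) = 0 := by
  rw [diracModification_eq, sub_matComp, matComp_assoc, 𝒱.multiplier_comp_adjoint H θ hC,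
    matComp_matOne]
  exact sub_self _

theorem frechet_comp_diracModification
    (hC : IsMatInverse 𝒱.D (𝒱.constraintOperator H θ) Cinv) :
    matComp 𝒱.D (𝒱.frechet θ) (𝒱.diracModification H θ Cinv) = 0 := by
  rw [diracModification_eq, matComp_sub, ← matComp_assoc, ← constraintOperator_eq, multiplier,
    ← matComp_assoc, hC.1, matOne_matComp, sub_self]

/-- W is a left inverse of D_θ*, so it annihilates the complementary projection Π. -/
theorem multiplier_comp_diracProj (hC : IsMatInverse 𝒱.D (𝒱.constraintOperator H θ) Cinv) :
    matComp 𝒱.D (𝒱.multiplier H θ Cinv) (𝒱.diracProj H θ Cinv) = 0 := by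
  rw [diracProj, matComp_sub, matComp_matOne, ← matComp_assoc, 𝒱.multiplier_comp_adjoint H θ hC,
    matOne_matComp, sub_self]

theorem adjoint_constraintOperator (hH : matAdjoint 𝒱.D H = -H) :
    matAdjoint 𝒱.D (𝒱.constraintOperator H θ) = -𝒱.constraintOperator H θ := by
  rw [constraintOperator, matAdjoint_matComp, matAdjoint_matComp, matAdjoint_matAdjoint, hH,
    neg_matComp, matComp_neg, matComp_assoc]

/-- H and C⁻¹ are both skewadjoint, and their signs cancel. -/
theorem adjoint_multiplier (hH : matAdjoint 𝒱.D H = -H)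
    (hC : IsMatInverse 𝒱.D (𝒱.constraintOperator H θ) Cinv) :
    matAdjoint 𝒱.D (𝒱.multiplier H θ Cinv) = matComp 𝒱.D (𝒱.constraintField H θ) Cinv := by
  rw [multiplier, matAdjoint_matComp, matAdjoint_matComp, hH,
    matAdjoint_inverse 𝒱.D hC (𝒱.adjoint_constraintOperator H θ hH), matComp_neg, neg_matComp,
    neg_matComp, neg_neg]
  rfl

theorem adjoint_constraintField (hH : matAdjoint 𝒱.D H = -H) :
    matAdjoint 𝒱.D (𝒱.constraintField H θ) = -matComp 𝒱.D (𝒱.frechet θ) H := by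
  rw [constraintField, matAdjoint_matComp, matAdjoint_matAdjoint, hH, matComp_neg]

theorem adjoint_diracModification (hH : matAdjoint 𝒱.D H = -H)
    (hC : IsMatInverse 𝒱.D (𝒱.constraintOperator H θ) Cinv) :
    matAdjoint 𝒱.D (𝒱.diracModification H θ Cinv) = -𝒱.diracModification H θ Cinv := by
  rw [diracModification_eq, matAdjoint_sub, hH, matAdjoint_matComp, 𝒱.adjoint_multiplier H θ hH hC,
    𝒱.adjoint_constraintField H θ hH, matComp_neg, matComp_assoc, multiplier]
  abel

theorem adjoint_diracProj :
    matAdjoint 𝒱.D (𝒱.diracProj H θ Cinv) = matOne V ℓ -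
      matComp 𝒱.D (matAdjoint 𝒱.D (𝒱.multiplier H θ Cinv)) (𝒱.frechet θ) := by
  rw [diracProj, matAdjoint_sub, matAdjoint_matOne, matAdjoint_matComp, matAdjoint_matAdjoint]

theorem adjoint_diracProj_comp_constraintField (hH : matAdjoint 𝒱.D H = -H)
    (hC : IsMatInverse 𝒱.D (𝒱.constraintOperator H θ) Cinv) :
    matComp 𝒱.D (matAdjoint 𝒱.D (𝒱.diracProj H θ Cinv)) (𝒱.constraintField H θ) = 0 := by
  rw [𝒱.adjoint_diracProj H θ, sub_matComp, matOne_matComp, matComp_assoc,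
    ← constraintOperator_eq, 𝒱.adjoint_multiplier H θ hH hC, matComp_assoc, hC.2, matComp_matOne,
    sub_self]

/-- Π* differs from 1 by a multiple of D_θ from the right, and D_θ annihilates H^D. -/
theorem adjoint_diracProj_comp_diracModification
    (hC : IsMatInverse 𝒱.D (𝒱.constraintOperator H θ) Cinv) :
    matComp 𝒱.D (matAdjoint 𝒱.D (𝒱.diracProj H θ Cinv)) (𝒱.diracModification H θ Cinv) =
      𝒱.diracModification H θ Cinv := by
  rw [𝒱.adjoint_diracProj H θ, sub_matComp, matOne_matComp, matComp_assoc,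
    𝒱.frechet_comp_diracModification H θ hC, matComp_zero, sub_zero]

theorem masterBracket_constraint_right (hC : IsMatInverse 𝒱.D (𝒱.constraintOperator H θ) Cinv)
    (α : Fin m) (f : V) : 𝒱.masterBracket (𝒱.diracModification H θ Cinv) f (θ α) = 0 := by
  have := 𝒱.masterBracket_eq_matComp (𝒱.diracModification H θ Cinv) θ (fun _ : Fin 1 => f) α 0
  rw [𝒱.frechet_comp_diracModification H θ hC, zero_matComp] at this
  exact this

theorem masterBracket_constraint_left (hC : IsMatInverse 𝒱.D (𝒱.constraintOperator H θ) Cinv)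
    (α : Fin m) (f : V) : 𝒱.masterBracket (𝒱.diracModification H θ Cinv) (θ α) f = 0 := by
  have := 𝒱.masterBracket_eq_matComp (𝒱.diracModification H θ Cinv) (fun _ : Fin 1 => f) θ 0 α
  rw [matComp_assoc, 𝒱.diracModification_comp_adjoint H θ hC, matComp_zero] at this
  exact this

end Reduction

end DifferentialFunctionAlgebra
end DiracReduction

namespace DiracReduction

/-! ### Three-sided products under the expansions -/

section Sandwich

variable {F V : Type*} [Field F] [CommRing V] [Algebra F V] (D : Derivation F V V)

/-- `A(ν + ∂) T(λ + ∂, μ + ∂) B(λ) C(μ)`. -/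
noncomputable def triSandwich (A B C : laurentInv V) : triSeries V →+ triSeries V :=
  (triLeft D A).comp ((triRightLambda D B).comp (triRightMu D C))

theorem triSandwich_apply (A B C : laurentInv V) (T : triSeries V) :
    triSandwich D A B C T = triLeft D A (triRightLambda D B (triRightMu D C T)) := rfl

theorem triSandwich_mulNu (A B C : laurentInv V) (T : triSeries V) :
    triSandwich D A B C (mulNuSubLambdaSubMu V T) =
      mulNuSubLambdaSubMu V (triSandwich D A B C T) := by
  rw [triSandwich_apply, triRightMu_mulNu, triRightLambda_mulNu, triLeft_mulNu]
  rfl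

/-- `A(λ + μ + ∂) X(λ + ∂, μ + ∂) B(λ) C(μ)` in `V((λ⁻¹))((μ⁻¹))`. -/
noncomputable def sandwich (A B C : laurentInv V) :
    laurentInv (laurentInv V) →+ laurentInv (laurentInv V) :=
  (act (leftMul D) (leftDer D) A).comp
    (((act (leftMul D).flip (dHom D)).flip C).comp (lmap ((compHom D).flip B)))

theorem sandwich_apply (A B C : laurentInv V) (X : laurentInv (laurentInv V)) :
    sandwich D A B C X = act (leftMul D) (leftDer D) A
      (act (leftMul D).flip (dHom D) (lmap ((compHom D).flip B) X) C) := rfl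

theorem sandwich_neg_left (A B C : laurentInv V) (X : laurentInv (laurentInv V)) :
    sandwich D (-A) B C X = -sandwich D A B C X := by
  simp only [sandwich_apply, map_neg, AddMonoidHom.neg_apply]

theorem lmap_flip_neg (B : laurentInv V) (X : laurentInv (laurentInv V)) :
    lmap ((compHom D).flip (-B)) X = -lmap ((compHom D).flip B) X :=
  laurentInv_ext fun q => by simp

theorem sandwich_neg_mid (A B C : laurentInv V) (X : laurentInv (laurentInv V)) :
    sandwich D A (-B) C X = -sandwich D A B C X := by
  rw [sandwich_apply, lmap_flip_neg, map_neg, AddMonoidHom.neg_apply, map_neg, sandwich_apply]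

/-- Multiplication from the right on the coefficients commutes with the right action. -/
theorem lmap_flip_act_right (A B : laurentInv V) (X : laurentInv (laurentInv V)) :
    lmap ((compHom D).flip B) (act (leftMul D).flip (dHom D) X A) =
      act (leftMul D).flip (dHom D) (lmap ((compHom D).flip B) X) A := by
  have := lmap_act (β := (leftMul D).flip) (D := dHom D) (β' := (leftMul D).flip) (D' := dHom D)
    ((compHom D).flip B) (AddMonoidHom.id V) ((compHom D).flip B)
    (fun x y => compHom_assoc D (single 0 y) x B) (fun _ => rfl) X A
  rwa [lmap_id] at this

/-- The adjoint turns left multiplication by functions into right multiplication, and left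
composition with ∂ into right composition with -∂; so it intertwines the two module structures. -/
theorem lmap_adj_act_left (A : laurentInv V) (X : laurentInv (laurentInv V)) :
    lmap (adjHom D) (act (leftMul D) (leftDer D) A X) =
      act (rightMul D) (rightDer D) A (lmap (adjHom D) X) := by
  have := lmap_act (β := leftMul D) (D := leftDer D) (β' := rightMul D) (D' := rightDer D)
    (AddMonoidHom.id V) (adjHom D) (adjHom D)
    (fun x y => by
      rw [leftMul_apply, adjHom_compHom, adjHom_const]
      rfl)
    (fun y => Psd.adj_x_mul (D := D) y) A X
  rwa [lmap_id] at this

theorem lmap_adj_act_right (A : laurentInv V) (X : laurentInv (laurentInv V)) :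
    lmap (adjHom D) (act (leftMul D).flip (dHom D) X A) =
      act (rightMul D).flip (dHom D) (lmap (adjHom D) X) A := by
  have := lmap_act (β := (leftMul D).flip) (D := dHom D) (β' := (rightMul D).flip) (D' := dHom D)
    (adjHom D) (AddMonoidHom.id V) (adjHom D)
    (fun x y => by
      rw [AddMonoidHom.flip_apply, leftMul_apply, adjHom_compHom, adjHom_const]
      rfl)
    (fun _ => rfl) X A
  rwa [lmap_id] at this

theorem lmap_adj_lmap_flip (B : laurentInv V) (X : laurentInv (laurentInv V)) :
    lmap (adjHom D) (lmap ((compHom D).flip B) X) =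
      lmap (compHom D (adjHom D B)) (lmap (adjHom D) X) :=
  laurentInv_ext fun q => adjHom_compHom D (X.1 q) B

theorem lmap_adj_sandwich (A B C : laurentInv V) (X : laurentInv (laurentInv V)) :
    lmap (adjHom D) (sandwich D A B C X) = lmap (compHom D (adjHom D B))
      (act (rightMul D) (rightDer D) A
        (act (rightMul D).flip (dHom D) (lmap (adjHom D) X) C)) := by
  rw [sandwich_apply, lmap_adj_act_left, lmap_adj_act_right, lmap_adj_lmap_flip, lmap_act_left,
    lmap_act_right]

theorem iotaMu_triSandwich (A B C : laurentInv V) (T : triSeries V) :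
    iotaMu (triSandwich D A B C T) = sandwich D A B C (iotaMu T) := by
  rw [triSandwich_apply, iotaMu_triLeft, iotaMu_triRightLambda, iotaMu_triRightMu,
    lmap_flip_act_right]
  rfl

theorem iotaMu_triSwap_triSandwich (A B C : laurentInv V) (T : triSeries V) :
    iotaMu (triSwap (triSandwich D A B C T)) = sandwich D A C B (iotaMu (triSwap T)) := by
  rw [triSandwich_apply, triSwap_triLeft, triSwap_triRightLambda, triSwap_triRightMu,
    iotaMu_triLeft, iotaMu_triRightMu, iotaMu_triRightLambda]
  rfl

/-- The roles rotate: C(μ) becomes the left factor C*, while A(ν), after the outer adjoint is pulled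
out, becomes the right factor A*. This matches the cyclic change of indices in the third Jacobi
term. -/
theorem iotaNu_triSandwich (A B C : laurentInv V) (T : triSeries V)
    (X : laurentInv (laurentInv V)) (h : iotaNu T = lmap (adjHom D) X) :
    iotaNu (triSandwich D A B C T) =
      lmap (adjHom D) (sandwich D (adjHom D C) (adjHom D A) B X) := by
  rw [triSandwich_apply, iotaNu_triLeft, iotaNu_triRightLambda, iotaNu_triRightMu,
    (isDiffModule_right D).left_right, h, lmap_adj_sandwich, adjHom_adjHom]

/-- After exchanging λ and μ it is B that multiplies in μ and becomes the left factor. -/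
theorem iotaNu_triSwap_triSandwich (A B C : laurentInv V) (T : triSeries V)
    (X : laurentInv (laurentInv V)) (h : iotaNu (triSwap T) = lmap (adjHom D) X) :
    iotaNu (triSwap (triSandwich D A B C T)) =
      lmap (adjHom D) (sandwich D (adjHom D B) (adjHom D A) C X) := by
  rw [triSandwich_apply, triSwap_triLeft, triSwap_triRightLambda, triSwap_triRightMu,
    iotaNu_triLeft, iotaNu_triRightMu, iotaNu_triRightLambda, h, lmap_adj_sandwich, adjHom_adjHom]

/-- `δ : V → V((λ⁻¹))` is a derivation commuting with `∂`, which acts on `V((λ⁻¹))` as `λ + ∂`. -/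
structure IsDiffDerivation (δ : V →+ laurentInv V) : Prop where
  map_mul : ∀ a b, δ (a * b) = leftMul D b (δ a) + leftMul D a (δ b)
  map_D : ∀ a, δ (D a) = leftDer D (δ a)

variable {D} in
theorem IsDiffDerivation.lmap_compHom {δ : V →+ laurentInv V} (hδ : IsDiffDerivation D δ)
    (A B : laurentInv V) : lmap δ (compHom D A B) =
      act (leftMul D).flip (dHom D) (lmap δ A) B + act (leftMul D) (leftDer D) A (lmap δ B) :=
  lmap_act_leibniz δ δ δ hδ.map_mul hδ.map_D A B

variable {D} in
theorem IsDiffDerivation.map_one {δ : V →+ laurentInv V} (hδ : IsDiffDerivation D δ) :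
    δ 1 = 0 := by
  have := hδ.map_mul 1 1
  rwa [mul_one, (isDiffModule_left D).one_act, left_eq_add] at this

end Sandwich

/-! ### Derivations along columns of H, and the Jacobi identity on generators -/

namespace DifferentialFunctionAlgebra

variable {F V : Type*} [Field F] [CommRing V] [Algebra F V] {ℓ m : ℕ}
  (𝒱 : DifferentialFunctionAlgebra F V ℓ)

theorem isDiffDerivation_fr (i : Fin ℓ) : IsDiffDerivation 𝒱.D (𝒱.fr i) where
  map_mul f g := by
    rw [fr_mul, add_comm]
    rfl
  map_D f := 𝒱.fr_D i f

/-- The derivation `f ↦ ∑ᵢ (D_f)ᵢ(λ + ∂) hᵢ(λ)` of `V` with values in `V((λ⁻¹))`. -/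
noncomputable def evol (h : Fin ℓ → laurentInv V) : V →+ laurentInv V :=
  ∑ p, ((compHom 𝒱.D).flip (h p)).comp (𝒱.fr p)

theorem evol_apply (h : Fin ℓ → laurentInv V) (f : V) :
    𝒱.evol h f = ∑ p, compHom 𝒱.D (𝒱.fr p f) (h p) := by
  simp [evol]

theorem lmap_evol (h : Fin ℓ → laurentInv V) (X : laurentInv V) :
    lmap (𝒱.evol h) X = ∑ p, lmap ((compHom 𝒱.D).flip (h p)) (lmap (𝒱.fr p) X) :=
  laurentInv_ext fun q => by
    rw [coe_sum_apply, lmap_apply, evol_apply]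
    rfl

theorem isDiffDerivation_evol (h : Fin ℓ → laurentInv V) : IsDiffDerivation 𝒱.D (𝒱.evol h) where
  map_mul f g := by
    simp only [evol_apply, map_sum, ← Finset.sum_add_distrib]
    refine Finset.sum_congr rfl fun p _ => ?_
    rw [fr_mul, map_add, AddMonoidHom.add_apply, compHom_assoc, compHom_assoc, add_comm]
    rfl
  map_D f := by
    simp only [evol_apply, map_sum]
    refine Finset.sum_congr rfl fun p _ => ?_
    rw [fr_D, compHom_assoc]
    rfl

theorem masterBracket_u_left (H : Matrix (Fin ℓ) (Fin ℓ) (PsDO V)) (i : Fin ℓ) (f : V) :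
    𝒱.masterBracket H (𝒱.u i) f = 𝒱.evol (fun p => H p i) f := by
  rw [masterBracket_eq, evol_apply, Finset.sum_eq_single_of_mem i (Finset.mem_univ _)]
  · refine Finset.sum_congr rfl fun j _ => ?_
    rw [fr_u, if_pos rfl, adjHom_const, compHom_one_right]
  · intro i' _ hi'
    refine Finset.sum_eq_zero fun j _ => ?_
    rw [fr_u, if_neg hi', map_zero, map_zero, map_zero]

theorem evol_u (h : Fin ℓ → laurentInv V) (k : Fin ℓ) : 𝒱.evol h (𝒱.u k) = h k := by
  rw [evol_apply, Finset.sum_eq_single_of_mem k (Finset.mem_univ _)]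
  · rw [fr_u, if_pos rfl, compHom_one_left]
  · intro i' _ hi'
    rw [fr_u, if_neg hi', map_zero, AddMonoidHom.zero_apply]

/-- Skewadjointness rewrites H ∘ D_f* as -(D_f ∘ H)*, so the bracket with a generator on the right
is also expressed by a derivation applied to f. -/
theorem masterBracket_u_right (H : Matrix (Fin ℓ) (Fin ℓ) (PsDO V)) (hH : matAdjoint 𝒱.D H = -H)
    (k : Fin ℓ) (f : V) :
    𝒱.masterBracket H f (𝒱.u k) = -adjHom 𝒱.D (𝒱.evol (fun p => H p k) f) := by
  rw [masterBracket_eq, evol_apply, map_sum, ← Finset.sum_neg_distrib]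
  refine Finset.sum_congr rfl fun i _ => ?_
  have h : adjHom 𝒱.D (H i k) = -H k i := congrFun (congrFun hH k) i
  rw [Finset.sum_eq_single_of_mem k (Finset.mem_univ _)]
  · rw [fr_u, if_pos rfl, compHom_one_left, adjHom_compHom, h, map_neg, AddMonoidHom.neg_apply,
      neg_neg]
  · intro j _ hj
    rw [fr_u, if_neg hj, map_zero, AddMonoidHom.zero_apply]

/-- The Jacobi identity on generators in terms of the entries of `H`. -/
theorem jacobiIdentity_iff (H : Matrix (Fin ℓ) (Fin ℓ) (PsDO V)) (hH : matAdjoint 𝒱.D H = -H)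
    (i j k : Fin ℓ) : JacobiIdentity (𝒱.masterBracket H) (𝒱.u i) (𝒱.u j) (𝒱.u k) ↔
      ∃ P Q R Z : triSeries V,
        iotaMu P = lmap (𝒱.evol fun p => H p i) (H k j) ∧
        iotaMu (triSwap Q) = lmap (𝒱.evol fun p => H p j) (H k i) ∧
        iotaNu R = lmap (adjHom 𝒱.D) (-lmap (𝒱.evol fun p => H p k) (H j i)) ∧
        P - Q - R = mulNuSubLambdaSubMu V Z := by
  have h : ∀ i j, 𝒱.masterBracket H (𝒱.u i) (𝒱.u j) = H j i := fun i j => by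
    rw [masterBracket_u_left, evol_u]
  have hx : ∀ X Y : laurentInv (laurentInv V), X = Y ↔ ∀ q p, (X.1 q).1 p = (Y.1 q).1 p :=
    fun X Y => ⟨fun h _ _ => by rw [h], fun h => laurentInv_ext fun q => laurentInv_ext (h q)⟩
  unfold JacobiIdentity
  have hq : ∀ P Q R : triSeries V, ((P : LambdaMuSpace V) - Q = R) ↔
      ∃ Z, P - Q - R = mulNuSubLambdaSubMu V Z := fun P Q R => by
    rw [← sub_eq_zero, ← QuotientAddGroup.mk_sub, ← QuotientAddGroup.mk_sub,
      QuotientAddGroup.eq_zero_iff, AddMonoidHom.mem_range]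
    exact ⟨fun ⟨Z, hZ⟩ => ⟨Z, hZ.symm⟩, fun ⟨Z, hZ⟩ => ⟨Z, hZ.symm⟩⟩
  simp only [h, 𝒱.masterBracket_u_left, 𝒱.masterBracket_u_right H hH, hq, hx]
  refine exists_congr fun P => exists_congr fun Q => exists_congr fun R => ?_
  have hneg : ∀ q p : ℤ, ((lmap (adjHom 𝒱.D) (-lmap (𝒱.evol fun p => H p k) (H j i))).1 q).1 p =
      (-adjHom 𝒱.D (𝒱.evol (fun p => H p k) ((H j i).1 q))).1 p := fun q p => by
    rw [map_neg]
    rfl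
  constructor
  · rintro ⟨h1, h2, h3, Z, hZ⟩
    exact ⟨Z, fun q p => h1 p q, fun q p => h2 q p, fun q p => (h3 q p).trans (hneg q p).symm, hZ⟩
  · rintro ⟨Z, h1, h2, h3, hZ⟩
    exact ⟨fun q p => h1 p q, fun q p => h2 q p, fun q p => (h3 q p).trans (hneg q p), Z, hZ⟩

/-! ### The derivative of the Dirac modification -/

section Reduction

variable (H : Matrix (Fin ℓ) (Fin ℓ) (PsDO V)) (θ : Fin m → V)
  {Cinv : Matrix (Fin m) (Fin m) (PsDO V)}

/-- Apply an additive map to all coefficients of the entries of a matrix. -/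
def matMap (δ : V →+ laurentInv V) {n o : ℕ} (A : Matrix (Fin n) (Fin o) (PsDO V)) :
    Matrix (Fin n) (Fin o) (laurentInv (laurentInv V)) := fun i j => lmap δ (A i j)

/-- The product of a matrix of operators with a matrix over `V((λ⁻¹))((μ⁻¹))`. -/
noncomputable def lprod {n o r : ℕ} (A : Matrix (Fin n) (Fin o) (PsDO V))
    (X : Matrix (Fin o) (Fin r) (laurentInv (laurentInv V))) :
    Matrix (Fin n) (Fin r) (laurentInv (laurentInv V)) :=
  matAct (leftMul 𝒱.D) (leftDer 𝒱.D) A X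

/-- The product of a matrix over `V((λ⁻¹))((μ⁻¹))` with a matrix of operators. -/
noncomputable def rprod {n o r : ℕ} (X : Matrix (Fin n) (Fin o) (laurentInv (laurentInv V)))
    (A : Matrix (Fin o) (Fin r) (PsDO V)) :
    Matrix (Fin n) (Fin r) (laurentInv (laurentInv V)) :=
  matAct (leftMul 𝒱.D).flip (dHom 𝒱.D) X A

section Prod

variable {a b c d : ℕ}

theorem lprod_lprod (A : Matrix (Fin a) (Fin b) (PsDO V)) (B : Matrix (Fin b) (Fin c) (PsDO V))
    (X : Matrix (Fin c) (Fin d) (laurentInv (laurentInv V))) :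
    𝒱.lprod A (𝒱.lprod B X) = 𝒱.lprod (matComp 𝒱.D A B) X :=
  (matAct_assoc (isDiffModule_left 𝒱.D).left_left A B X).symm

theorem rprod_rprod (X : Matrix (Fin a) (Fin b) (laurentInv (laurentInv V)))
    (A : Matrix (Fin b) (Fin c) (PsDO V)) (B : Matrix (Fin c) (Fin d) (PsDO V)) :
    𝒱.rprod (𝒱.rprod X A) B = 𝒱.rprod X (matComp 𝒱.D A B) :=
  matAct_assoc (isDiffModule_left 𝒱.D).right_right X A B

theorem rprod_lprod (A : Matrix (Fin a) (Fin b) (PsDO V))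
    (X : Matrix (Fin b) (Fin c) (laurentInv (laurentInv V))) (B : Matrix (Fin c) (Fin d) (PsDO V)) :
    𝒱.rprod (𝒱.lprod A X) B = 𝒱.lprod A (𝒱.rprod X B) :=
  matAct_assoc (isDiffModule_left 𝒱.D).left_right A X B

theorem lprod_one (X : Matrix (Fin a) (Fin b) (laurentInv (laurentInv V))) :
    𝒱.lprod (matOne V a) X = X := by
  ext1 i j
  rw [lprod, matAct_apply, Finset.sum_eq_single_of_mem i (Finset.mem_univ _)]
  · rw [matOne_apply, if_pos rfl, (isDiffModule_left 𝒱.D).one_left]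
  · intro k _ hk
    rw [matOne_apply, if_neg hk.symm, map_zero, AddMonoidHom.zero_apply]

theorem rprod_one (X : Matrix (Fin a) (Fin b) (laurentInv (laurentInv V))) :
    𝒱.rprod X (matOne V b) = X := by
  ext1 i j
  rw [rprod, matAct_apply, Finset.sum_eq_single_of_mem j (Finset.mem_univ _)]
  · rw [matOne_apply, if_pos rfl, (isDiffModule_left 𝒱.D).one_right]
  · intro k _ hk
    rw [matOne_apply, if_neg hk, map_zero]

theorem matMap_matComp {δ : V →+ laurentInv V} (hδ : IsDiffDerivation 𝒱.D δ)
    (A : Matrix (Fin a) (Fin b) (PsDO V)) (B : Matrix (Fin b) (Fin c) (PsDO V)) :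
    matMap δ (matComp 𝒱.D A B) = 𝒱.rprod (matMap δ A) B + 𝒱.lprod A (matMap δ B) := by
  ext1 i j
  rw [matMap, matComp_apply, map_sum, Matrix.add_apply, rprod, lprod, matAct_apply, matAct_apply,
    ← Finset.sum_add_distrib]
  exact Finset.sum_congr rfl fun k _ => hδ.lmap_compHom _ _

theorem lprod_neg (A : Matrix (Fin a) (Fin b) (PsDO V))
    (X : Matrix (Fin b) (Fin c) (laurentInv (laurentInv V))) :
    𝒱.lprod A (-X) = -𝒱.lprod A X :=
  matAct_neg _ _ _ _

theorem lprod_add (A : Matrix (Fin a) (Fin b) (PsDO V))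
    (X Y : Matrix (Fin b) (Fin c) (laurentInv (laurentInv V))) :
    𝒱.lprod A (X + Y) = 𝒱.lprod A X + 𝒱.lprod A Y :=
  matAct_add _ _ _ _ _

theorem lprod_sub (A : Matrix (Fin a) (Fin b) (PsDO V))
    (X Y : Matrix (Fin b) (Fin c) (laurentInv (laurentInv V))) :
    𝒱.lprod A (X - Y) = 𝒱.lprod A X - 𝒱.lprod A Y :=
  matAct_sub _ _ _ _ _

theorem add_lprod (A B : Matrix (Fin a) (Fin b) (PsDO V))
    (X : Matrix (Fin b) (Fin c) (laurentInv (laurentInv V))) :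
    𝒱.lprod (A + B) X = 𝒱.lprod A X + 𝒱.lprod B X :=
  add_matAct _ _ _ _ _

theorem neg_rprod (X : Matrix (Fin a) (Fin b) (laurentInv (laurentInv V)))
    (A : Matrix (Fin b) (Fin c) (PsDO V)) :
    𝒱.rprod (-X) A = -𝒱.rprod X A :=
  neg_matAct _ _ _ _

theorem rprod_add (X : Matrix (Fin a) (Fin b) (laurentInv (laurentInv V)))
    (A B : Matrix (Fin b) (Fin c) (PsDO V)) :
    𝒱.rprod X (A + B) = 𝒱.rprod X A + 𝒱.rprod X B :=
  matAct_add _ _ _ _ _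

theorem add_rprod (X Y : Matrix (Fin a) (Fin b) (laurentInv (laurentInv V)))
    (A : Matrix (Fin b) (Fin c) (PsDO V)) :
    𝒱.rprod (X + Y) A = 𝒱.rprod X A + 𝒱.rprod Y A :=
  add_matAct _ _ _ _ _

theorem sub_rprod (X Y : Matrix (Fin a) (Fin b) (laurentInv (laurentInv V)))
    (A : Matrix (Fin b) (Fin c) (PsDO V)) :
    𝒱.rprod (X - Y) A = 𝒱.rprod X A - 𝒱.rprod Y A :=
  sub_matAct _ _ _ _ _

end Prod

/-- Instead of differentiating C⁻¹, both sides of δ(H^D) are split by Π and Π*. The complementary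
parts are found by differentiating D_θ ∘ H^D = 0 and H^D ∘ D_θ* = 0. -/
theorem matMap_diracModification (hH : matAdjoint 𝒱.D H = -H)
    (hC : IsMatInverse 𝒱.D (𝒱.constraintOperator H θ) Cinv) {δ : V →+ laurentInv V}
    (hδ : IsDiffDerivation 𝒱.D δ) :
    matMap δ (𝒱.diracModification H θ Cinv) =
      𝒱.lprod (matAdjoint 𝒱.D (𝒱.diracProj H θ Cinv))
        (𝒱.rprod (matMap δ H) (𝒱.diracProj H θ Cinv)) -
      𝒱.lprod (matAdjoint 𝒱.D (𝒱.multiplier H θ Cinv))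
        (𝒱.rprod (matMap δ (𝒱.frechet θ)) (𝒱.diracModification H θ Cinv)) -
      𝒱.lprod (𝒱.diracModification H θ Cinv)
        (𝒱.rprod (matMap δ (matAdjoint 𝒱.D (𝒱.frechet θ))) (𝒱.multiplier H θ Cinv)) := by
  have hzero : ∀ a b, matMap δ (0 : Matrix (Fin a) (Fin b) (PsDO V)) = 0 := fun a b => by
    ext1 i j
    exact map_zero (lmap δ)
  have hsub : ∀ (a b : ℕ) (A B : Matrix (Fin a) (Fin b) (PsDO V)),
      matMap δ (A - B) = matMap δ A - matMap δ B := fun a b A B => by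
    ext1 i j
    exact map_sub (lmap δ) _ _
  have e1 := 𝒱.matMap_matComp hδ (𝒱.frechet θ) (𝒱.diracModification H θ Cinv)
  rw [𝒱.frechet_comp_diracModification H θ hC, hzero] at e1
  have e2 := 𝒱.matMap_matComp hδ (𝒱.diracModification H θ Cinv) (matAdjoint 𝒱.D (𝒱.frechet θ))
  rw [𝒱.diracModification_comp_adjoint H θ hC, hzero] at e2
  have e3 : matMap δ (𝒱.diracModification H θ Cinv) = matMap δ H -
      (𝒱.rprod (matMap δ (𝒱.constraintField H θ)) (𝒱.multiplier H θ Cinv) +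
      𝒱.lprod (𝒱.constraintField H θ) (matMap δ (𝒱.multiplier H θ Cinv))) := by
    rw [← 𝒱.matMap_matComp hδ, ← hsub]
    rfl
  -- The two decompositions of 1, to be inserted to the right and to the left of δ(H^D).
  have hPi : matOne V ℓ = 𝒱.diracProj H θ Cinv +
      matComp 𝒱.D (matAdjoint 𝒱.D (𝒱.frechet θ)) (𝒱.multiplier H θ Cinv) := by
    rw [diracProj, sub_add_cancel]
  have hPa : matOne V ℓ = matAdjoint 𝒱.D (𝒱.diracProj H θ Cinv) +
      matComp 𝒱.D (matAdjoint 𝒱.D (𝒱.multiplier H θ Cinv)) (𝒱.frechet θ) := by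
    rw [adjoint_diracProj, sub_add_cancel]
  have hPK := 𝒱.adjoint_diracProj_comp_constraintField H θ hH hC
  have hPH := 𝒱.adjoint_diracProj_comp_diracModification H θ hC
  have hWP := 𝒱.multiplier_comp_diracProj H θ hC
  generalize 𝒱.diracModification H θ Cinv = Ht at *
  generalize 𝒱.diracProj H θ Cinv = Pi at *
  generalize 𝒱.multiplier H θ Cinv = W at *
  generalize 𝒱.constraintField H θ = K at *
  generalize matAdjoint 𝒱.D (𝒱.frechet θ) = Da at *
  generalize matAdjoint 𝒱.D Pi = Pa at *
  generalize matAdjoint 𝒱.D W = Wa at *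
  generalize 𝒱.frechet θ = Df at *
  have s1 : matMap δ Ht = 𝒱.lprod Pa (matMap δ Ht) - 𝒱.lprod Wa (𝒱.rprod (matMap δ Df) Ht) := by
    conv_lhs => rw [← 𝒱.lprod_one (matMap δ Ht), hPa]
    rw [add_lprod, ← lprod_lprod, eq_neg_of_add_eq_zero_right e1.symm, lprod_neg, sub_eq_add_neg]
  have s2 : 𝒱.lprod Pa (matMap δ Ht) = 𝒱.lprod Pa (𝒱.rprod (matMap δ Ht) Pi) -
      𝒱.lprod Ht (𝒱.rprod (matMap δ Da) W) := by
    conv_lhs => rw [← 𝒱.rprod_one (matMap δ Ht), hPi]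
    rw [rprod_add, ← rprod_rprod, eq_neg_of_add_eq_zero_left e2.symm, neg_rprod, rprod_lprod,
      lprod_add, lprod_neg, lprod_lprod, hPH, sub_eq_add_neg]
  -- Between Π* and Π the correction K ∘ W contributes nothing: WΠ = 0 kills the term with δ(K), and
  -- Π*K = 0 the one with δ(W).
  have s3 : 𝒱.lprod Pa (𝒱.rprod (matMap δ Ht) Pi) = 𝒱.lprod Pa (𝒱.rprod (matMap δ H) Pi) := by
    rw [e3]
    have : 𝒱.lprod Pa (𝒱.rprod (𝒱.rprod (matMap δ K) W + 𝒱.lprod K (matMap δ W)) Pi) = 0 := by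
      rw [add_rprod, rprod_rprod, hWP, rprod_lprod]
      rw [show 𝒱.rprod (matMap δ K) (0 : Matrix (Fin m) (Fin ℓ) (PsDO V)) = 0 from
        matAct_zero _ _ _, zero_add, lprod_lprod, hPK]
      exact zero_matAct _ _ _
    rw [sub_rprod, lprod_sub, this, sub_zero]
  rw [s1, s2, s3]
  abel

end Reduction

end DifferentialFunctionAlgebra
end DiracReduction

namespace DiracReduction

/-! ### Sums of three-sided products, and Hessians -/

section SandwichSum

variable {F V : Type*} [Field F] [CommRing V] [Algebra F V] (D : Derivation F V V) {n o r : ℕ}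

/-- `∑ A_x(ν + ∂) T_xyz(λ + ∂, μ + ∂) B_y(λ) C_z(μ)`. -/
noncomputable def triSandwichSum (A : Fin n → laurentInv V) (B : Fin o → laurentInv V)
    (C : Fin r → laurentInv V) (T : Fin n → Fin o → Fin r → triSeries V) : triSeries V :=
  ∑ x, ∑ y, ∑ z, triSandwich D (A x) (B y) (C z) (T x y z)

/-- `∑ A_x(λ + μ + ∂) X_xyz(λ + ∂, μ + ∂) B_y(λ) C_z(μ)` in `V((λ⁻¹))((μ⁻¹))`. -/
noncomputable def sandwichSum (A : Fin n → laurentInv V) (B : Fin o → laurentInv V)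
    (C : Fin r → laurentInv V) (X : Fin n → Fin o → Fin r → laurentInv (laurentInv V)) :
    laurentInv (laurentInv V) :=
  ∑ x, ∑ y, ∑ z, sandwich D (A x) (B y) (C z) (X x y z)

theorem triSandwichSum_sub (A : Fin n → laurentInv V) (B : Fin o → laurentInv V)
    (C : Fin r → laurentInv V) (S T : Fin n → Fin o → Fin r → triSeries V) :
    triSandwichSum D A B C (fun x y z => S x y z - T x y z) =
      triSandwichSum D A B C S - triSandwichSum D A B C T := by
  simp only [triSandwichSum, map_sub, Finset.sum_sub_distrib]

theorem triSandwichSum_mulNu (A : Fin n → laurentInv V) (B : Fin o → laurentInv V)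
    (C : Fin r → laurentInv V) (T : Fin n → Fin o → Fin r → triSeries V) :
    triSandwichSum D A B C (fun x y z => mulNuSubLambdaSubMu V (T x y z)) =
      mulNuSubLambdaSubMu V (triSandwichSum D A B C T) := by
  simp only [triSandwichSum, map_sum, triSandwich_mulNu]

theorem sandwichSum_neg (A : Fin n → laurentInv V) (B : Fin o → laurentInv V)
    (C : Fin r → laurentInv V) (X : Fin n → Fin o → Fin r → laurentInv (laurentInv V)) :
    sandwichSum D A B C (fun x y z => -X x y z) = -sandwichSum D A B C X := by
  simp only [sandwichSum, map_neg, Finset.sum_neg_distrib]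

theorem sandwichSum_neg_left (A : Fin n → laurentInv V) (B : Fin o → laurentInv V)
    (C : Fin r → laurentInv V) (X : Fin n → Fin o → Fin r → laurentInv (laurentInv V)) :
    sandwichSum D (fun x => -A x) B C X = -sandwichSum D A B C X := by
  simp only [sandwichSum, sandwich_neg_left, Finset.sum_neg_distrib]

theorem sandwichSum_neg_mid (A : Fin n → laurentInv V) (B : Fin o → laurentInv V)
    (C : Fin r → laurentInv V) (X : Fin n → Fin o → Fin r → laurentInv (laurentInv V)) :
    sandwichSum D A (fun y => -B y) C X = -sandwichSum D A B C X := by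
  simp only [sandwichSum, sandwich_neg_mid, Finset.sum_neg_distrib]

variable (A : Fin n → laurentInv V) (B : Fin o → laurentInv V) (C : Fin r → laurentInv V)
  {T : Fin n → Fin o → Fin r → triSeries V}

theorem iotaMu_triSandwichSum {X : Fin n → Fin o → Fin r → laurentInv (laurentInv V)}
    (h : ∀ x y z, iotaMu (T x y z) = X x y z) :
    iotaMu (triSandwichSum D A B C T) = sandwichSum D A B C X := by
  simp only [triSandwichSum, sandwichSum, map_sum, iotaMu_triSandwich, h]

theorem iotaMu_triSwap_triSandwichSum {X : Fin n → Fin r → Fin o → laurentInv (laurentInv V)}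
    (h : ∀ x y z, iotaMu (triSwap (T x y z)) = X x z y) :
    iotaMu (triSwap (triSandwichSum D A B C T)) = sandwichSum D A C B X := by
  simp only [triSandwichSum, sandwichSum, map_sum, iotaMu_triSwap_triSandwich, h]
  exact Finset.sum_congr rfl fun x _ => Finset.sum_comm

theorem iotaNu_triSandwichSum {X : Fin r → Fin n → Fin o → laurentInv (laurentInv V)}
    (h : ∀ x y z, iotaNu (T x y z) = lmap (adjHom D) (X z x y)) :
    iotaNu (triSandwichSum D A B C T) = lmap (adjHom D)
      (sandwichSum D (fun z => adjHom D (C z)) (fun x => adjHom D (A x)) B X) := by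
  simp only [triSandwichSum, sandwichSum, map_sum, iotaNu_triSandwich D _ _ _ _ _ (h _ _ _)]
  exact (Finset.sum_congr rfl fun x _ => Finset.sum_comm).trans Finset.sum_comm

theorem iotaNu_triSwap_triSandwichSum {X : Fin o → Fin n → Fin r → laurentInv (laurentInv V)}
    (h : ∀ x y z, iotaNu (triSwap (T x y z)) = lmap (adjHom D) (X y x z)) :
    iotaNu (triSwap (triSandwichSum D A B C T)) = lmap (adjHom D)
      (sandwichSum D (fun y => adjHom D (B y)) (fun x => adjHom D (A x)) C X) := by
  simp only [triSandwichSum, sandwichSum, map_sum, iotaNu_triSwap_triSandwich D _ _ _ _ _ (h _ _ _)]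
  exact Finset.sum_comm

end SandwichSum

namespace DifferentialFunctionAlgebra

variable {F V : Type*} [Field F] [CommRing V] [Algebra F V] {ℓ m : ℕ}
  (𝒱 : DifferentialFunctionAlgebra F V ℓ)

/-- The Hessian polynomial ∑ ∂²f/∂u_q⁽ᵏ⁾∂u_p⁽ⁿ⁾ λᵏ μⁿ serves for both orders of differentiation,
since partial derivatives commute. -/
theorem exists_hessian (q p : Fin ℓ) (f : V) : ∃ S : triSeries V,
    iotaMu S = lmap (𝒱.fr q) (𝒱.fr p f) ∧ iotaMu (triSwap S) = lmap (𝒱.fr p) (𝒱.fr q f) := by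
  obtain ⟨K, hK⟩ := 𝒱.exists_pd_bound f
  refine ⟨∑ n ∈ Finset.range K, triLambda n (𝒱.fr q (𝒱.pd p n f)), ?_, ?_⟩
  · rw [𝒱.fr_eq_sum p f K (hK p)]
    simp only [map_sum, lmap_single, iotaMu_triLambda]
  · simp only [map_sum, iotaMu_triSwap_triLambda]
    refine laurentInv_ext fun k => ?_
    rw [coe_sum_apply, lmap_apply]
    simp only [lmap_apply, fr_apply]
    split_ifs with h
    · rw [𝒱.fr_eq_sum p _ K fun n hn => by rw [𝒱.pd_comm, hK p n hn, map_zero]]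
      exact Finset.sum_congr rfl fun n _ => by rw [𝒱.pd_comm]
    · simp

theorem map_neg_one_pow_eq_zero {D : Derivation F V V} {δ : V →+ laurentInv V}
    (hδ : IsDiffDerivation D δ) (k : ℕ) : δ ((-1) ^ k) = 0 := by
  rcases neg_one_pow_eq_or V k with h | h <;> simp [h, hδ.map_one]

/-- The signs (-1)ⁿ are constants, killed by a derivation, so only the partial derivatives of f are
differentiated. -/
theorem lmap_fr_adj_fr (q p : Fin ℓ) (f : V) {K : ℕ} (hK : ∀ n, K ≤ n → 𝒱.pd p n f = 0) :
    lmap (𝒱.fr q) (adjHom 𝒱.D (𝒱.fr p f)) = ∑ n ∈ Finset.range K,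
      act (leftMul 𝒱.D) (leftDer 𝒱.D) (single (n : ℤ) ((-1) ^ n))
        (single 0 (𝒱.fr q (𝒱.pd p n f))) := by
  rw [𝒱.adjHom_fr p f K hK, map_sum]
  refine Finset.sum_congr rfl fun n _ => ?_
  rw [(𝒱.isDiffDerivation_fr q).lmap_compHom, lmap_single, lmap_single,
    map_neg_one_pow_eq_zero (𝒱.isDiffDerivation_fr q), map_zero, map_zero,
    AddMonoidHom.zero_apply, zero_add]

/-- One polynomial, ∑ (-ν-∂)ⁿ ∂²f/∂u_q⁽ᵏ⁾∂u_p⁽ⁿ⁾ λᵏ, has to produce all three expansions: the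
corresponding term occurs in two terms of the Jacobi identity and must cancel. Commuting partial
derivatives identify the last two expansions. -/
theorem exists_adjoint_hessian (q p : Fin ℓ) (f : V) : ∃ S : triSeries V,
    iotaMu S = lmap (𝒱.fr q) (adjHom 𝒱.D (𝒱.fr p f)) ∧
    iotaNu S = lmap (adjHom 𝒱.D) (lmap (𝒱.fr p) (𝒱.fr q f)) ∧
    iotaNu (triSwap S) = lmap (adjHom 𝒱.D) (lmap (𝒱.fr p) (adjHom 𝒱.D (𝒱.fr q f))) := by
  obtain ⟨K, hK⟩ := 𝒱.exists_pd_bound f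
  refine ⟨∑ n ∈ Finset.range K, triLeft 𝒱.D (single (n : ℤ) ((-1) ^ n))
    (triLambda 0 (𝒱.fr q (𝒱.pd p n f))), ?_, ?_, ?_⟩
  · simp only [map_sum, iotaMu_triLeft, iotaMu_triLambda, 𝒱.lmap_fr_adj_fr q p f (hK p)]
  · simp only [map_sum, iotaNu_triLeft, iotaNu_triLambda 𝒱.D, Int.negOnePow_zero, Units.val_one,
      one_smul, (isDiffModule_right 𝒱.D).one_left]
    refine laurentInv_ext fun k => ?_
    rw [coe_sum_apply]
    simp only [lmap_apply, fr_apply]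
    split_ifs with h
    · rw [𝒱.adjHom_fr p _ K fun n hn => by rw [𝒱.pd_comm, hK p n hn, map_zero]]
      exact Finset.sum_congr rfl fun n _ => by rw [𝒱.pd_comm]
    · simp
  · simp only [map_sum, triSwap_triLeft, iotaNu_triLeft, iotaNu_triSwap_triLambda 𝒱.D,
      𝒱.lmap_fr_adj_fr p q f (hK q), lmap_adj_act_left, lmap_single]
    simp only [fun n => 𝒱.adjHom_fr q (𝒱.pd p n f) K fun k hk => by rw [𝒱.pd_comm, hK q k hk, map_zero],
      fun n => 𝒱.adjHom_fr p (𝒱.pd q n f) K fun k hk => by rw [𝒱.pd_comm, hK p k hk, map_zero],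
      map_sum, AddMonoidHom.finsetSum_apply, (isDiffModule_right 𝒱.D).left_left, IsDiffModule.const_left,
      lmap_single, lmap_act_left, rightMul_apply, compHom_single_zero, one_mul]
    rw [Finset.sum_comm]
    exact Finset.sum_congr rfl fun n _ => Finset.sum_congr rfl fun k _ => by rw [𝒱.pd_comm]

end DifferentialFunctionAlgebra
end DiracReduction

/-! ### The Jacobi identity for the Dirac modification -/

namespace DiracReduction
namespace DifferentialFunctionAlgebra

variable {F V : Type*} [Field F] [CommRing V] [Algebra F V] {ℓ m : ℕ}
  (𝒱 : DifferentialFunctionAlgebra F V ℓ)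

theorem lprod_rprod_apply {a b c d : ℕ} (A : Matrix (Fin a) (Fin b) (PsDO V))
    (X : Matrix (Fin b) (Fin c) (laurentInv (laurentInv V))) (C : Matrix (Fin c) (Fin d) (PsDO V))
    (Y : Fin ℓ → Matrix (Fin b) (Fin c) (laurentInv (laurentInv V))) (B : Fin ℓ → laurentInv V)
    (hX : ∀ x z, X x z = ∑ y, lmap ((compHom 𝒱.D).flip (B y)) (Y y x z)) (k : Fin a) (j : Fin d) :
    𝒱.lprod A (𝒱.rprod X C) k j =
      sandwichSum 𝒱.D (A k) B (fun z => C z j) (fun x y z => Y y x z) := by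
  rw [lprod, matAct_apply]
  refine Finset.sum_congr rfl fun x _ => ?_
  rw [rprod, matAct_apply]
  simp only [hX, map_sum, AddMonoidHom.finsetSum_apply]
  rw [Finset.sum_comm]
  rfl

variable (H : Matrix (Fin ℓ) (Fin ℓ) (PsDO V)) (θ : Fin m → V)
  {Cinv : Matrix (Fin m) (Fin m) (PsDO V)}

/-- The direction of differentiation enters only as a right factor, so composing H with Q composes
the result with Q. -/
theorem lmap_evol_matComp (Q : Matrix (Fin ℓ) (Fin ℓ) (PsDO V)) (i : Fin ℓ) (X : laurentInv V) :
    lmap (𝒱.evol fun p => matComp 𝒱.D H Q p i) X =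
      ∑ a, lmap ((compHom 𝒱.D).flip (Q a i)) (lmap (𝒱.evol fun p => H p a) X) := by
  refine laurentInv_ext fun q => ?_
  rw [coe_sum_apply]
  simp only [lmap_apply, evol_apply, matComp_apply, map_sum, AddMonoidHom.flip_apply,
    compHom_assoc]
  exact Finset.sum_comm

theorem lmap_evol_diracModification (hH : matAdjoint 𝒱.D H = -H)
    (hC : IsMatInverse 𝒱.D (𝒱.constraintOperator H θ) Cinv) (i j k : Fin ℓ) :
    lmap (𝒱.evol fun p => 𝒱.diracModification H θ Cinv p i) (𝒱.diracModification H θ Cinv k j) =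
      sandwichSum 𝒱.D (matAdjoint 𝒱.D (𝒱.diracProj H θ Cinv) k)
        (fun a => 𝒱.diracProj H θ Cinv a i) (fun b => 𝒱.diracProj H θ Cinv b j)
        (fun c a b => lmap (𝒱.evol fun p => H p a) (H c b)) -
      sandwichSum 𝒱.D (matAdjoint 𝒱.D (𝒱.multiplier H θ Cinv) k)
        (fun q => 𝒱.diracModification H θ Cinv q i) (fun p => 𝒱.diracModification H θ Cinv p j)
        (fun α q p => lmap (𝒱.fr q) (𝒱.fr p (θ α))) -
      sandwichSum 𝒱.D (𝒱.diracModification H θ Cinv k)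
        (fun q => 𝒱.diracModification H θ Cinv q i) (fun α => 𝒱.multiplier H θ Cinv α j)
        (fun p q α => lmap (𝒱.fr q) (adjHom 𝒱.D (𝒱.fr p (θ α)))) := by
  have h := congrFun (congrFun (𝒱.matMap_diracModification H θ hH hC
    (𝒱.isDiffDerivation_evol fun p => 𝒱.diracModification H θ Cinv p i)) k) j
  rw [Matrix.sub_apply, Matrix.sub_apply] at h
  refine h.trans (congrArg₂ (· - ·) (congrArg₂ (· - ·) ?_ ?_) ?_)
  · refine 𝒱.lprod_rprod_apply _ _ _ (fun a => matMap (𝒱.evol fun p => H p a) H)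
      (fun a => 𝒱.diracProj H θ Cinv a i) (fun x z => ?_) k j
    -- Only in the first summand is the direction rewritten as a column of H ∘ Π, to reach the
    -- Jacobi terms of H; the others keep the column of H^D.
    rw [matMap, 𝒱.diracModification_eq_comp_diracProj H θ]
    exact 𝒱.lmap_evol_matComp H _ i _
  · exact 𝒱.lprod_rprod_apply _ _ _ (fun q => matMap (𝒱.fr q) (𝒱.frechet θ))
      (fun q => 𝒱.diracModification H θ Cinv q i) (fun x z => 𝒱.lmap_evol _ _) k j
  · exact 𝒱.lprod_rprod_apply _ _ _ (fun q => matMap (𝒱.fr q) (matAdjoint 𝒱.D (𝒱.frechet θ)))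
      (fun q => 𝒱.diracModification H θ Cinv q i) (fun x z => 𝒱.lmap_evol _ _) k j

/-- Each of the three terms is the transform by Π, Π and Π* of the term for H, plus Hessian terms
that occur in pairs and cancel. -/
theorem jacobiIdentity_diracModification (hH : matAdjoint 𝒱.D H = -H)
    (hC : IsMatInverse 𝒱.D (𝒱.constraintOperator H θ) Cinv)
    (hJ : ∀ i j k, JacobiIdentity (𝒱.masterBracket H) (𝒱.u i) (𝒱.u j) (𝒱.u k)) (i j k : Fin ℓ) :
    JacobiIdentity (𝒱.masterBracket (𝒱.diracModification H θ Cinv)) (𝒱.u i) (𝒱.u j) (𝒱.u k) := by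
  have hskew := 𝒱.adjoint_diracModification H θ hH hC
  rw [𝒱.jacobiIdentity_iff _ hskew]
  simp only [𝒱.lmap_evol_diracModification H θ hH hC]
  simp only [𝒱.jacobiIdentity_iff H hH] at hJ
  choose P Q R Z hP hQ hR hZ using hJ
  choose S hS hS' using fun q p f => 𝒱.exists_hessian q p f
  choose T hT hT' hT'' using fun q p f => 𝒱.exists_adjoint_hessian q p f
  have hadj : ∀ a b, adjHom 𝒱.D (𝒱.diracModification H θ Cinv a b) =
      -𝒱.diracModification H θ Cinv b a := fun a b => congrFun (congrFun hskew b) a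
  have hPi : ∀ a b, adjHom 𝒱.D (matAdjoint 𝒱.D (𝒱.diracProj H θ Cinv) a b) =
      𝒱.diracProj H θ Cinv b a := fun a b => adjHom_adjHom _ _
  generalize 𝒱.diracModification H θ Cinv = Ht at *
  let PhiA := matAdjoint 𝒱.D (𝒱.diracProj H θ Cinv) k
  let Phi (T : Fin ℓ → Fin ℓ → Fin ℓ → triSeries V) : triSeries V := triSandwichSum 𝒱.D PhiA
    (fun a => 𝒱.diracProj H θ Cinv a i) (fun b => 𝒱.diracProj H θ Cinv b j) fun c a b => T a b c
  let B (i j : Fin ℓ) : triSeries V := triSandwichSum 𝒱.D (Ht k) (fun q => Ht q i)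
    (fun α => 𝒱.multiplier H θ Cinv α j) fun p q α => T q p (θ α)
  let C : triSeries V := triSandwichSum 𝒱.D (matAdjoint 𝒱.D (𝒱.multiplier H θ Cinv) k)
    (fun q => Ht q i) (fun p => Ht p j) fun α q p => S q p (θ α)
  -- `C`, quadratic in H^D, is shared by the first two terms by symmetry of the Hessian. The third
  -- term picks up `B i j` from the first and the swapped `B j i` from the second.
  refine ⟨Phi P - C - B i j, Phi Q - C - triSwap (B j i), Phi R - B i j + triSwap (B j i),
    Phi Z, ?_, ?_, ?_, ?_⟩
  · rw [map_sub, map_sub]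
    refine congrArg₂ _ (congrArg₂ _ ?_ ?_) ?_
    · exact iotaMu_triSandwichSum _ _ _ _ fun c a b => hP a b c
    · exact iotaMu_triSandwichSum _ _ _ _ fun α q p => hS q p (θ α)
    · exact iotaMu_triSandwichSum _ _ _ _ fun p q α => hT q p (θ α)
  · rw [map_sub, map_sub, map_sub, map_sub, triSwap_triSwap]
    refine congrArg₂ _ (congrArg₂ _ ?_ ?_) ?_
    · exact iotaMu_triSwap_triSandwichSum _ _ _ _ fun c a b => hQ a b c
    · exact iotaMu_triSwap_triSandwichSum _ _ _ _ fun α q p => hS' q p (θ α)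
    · exact iotaMu_triSandwichSum _ _ _ _ fun p q α => hT q p (θ α)
  · have h1 : iotaNu (Phi R) = lmap (adjHom 𝒱.D) (-sandwichSum 𝒱.D
        (matAdjoint 𝒱.D (𝒱.diracProj H θ Cinv) j) (fun a => 𝒱.diracProj H θ Cinv a k)
        (fun b => 𝒱.diracProj H θ Cinv b i) fun c a b => lmap (𝒱.evol fun p => H p a) (H c b)) := by
      rw [← sandwichSum_neg]
      refine (iotaNu_triSandwichSum _ _ _ _ fun c a b => hR a b c).trans ?_
      simp only [PhiA, hPi]
      rfl
    -- Adjoints rotate this H^D-type term into one of W-type; its sign comes from (H^D)* = -H^D.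
    have h2 : iotaNu (B i j) = lmap (adjHom 𝒱.D) (-sandwichSum 𝒱.D
        (matAdjoint 𝒱.D (𝒱.multiplier H θ Cinv) j) (fun q => Ht q k) (fun p => Ht p i)
        fun α q p => lmap (𝒱.fr q) (𝒱.fr p (θ α))) := by
      rw [← sandwichSum_neg_mid]
      refine (iotaNu_triSandwichSum _ _ _ _ fun p q α => hT' q p (θ α)).trans ?_
      simp only [hadj]
      rfl
    -- Two factors H^D are replaced by their adjoints here, so the signs cancel.
    have h3 : iotaNu (triSwap (B j i)) = lmap (adjHom 𝒱.D) (sandwichSum 𝒱.D (Ht j)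
        (fun q => Ht q k) (fun α => 𝒱.multiplier H θ Cinv α i)
        fun p q α => lmap (𝒱.fr q) (adjHom 𝒱.D (𝒱.fr p (θ α)))) := by
      refine (iotaNu_triSwap_triSandwichSum _ _ _ _ fun p q α => hT'' q p (θ α)).trans ?_
      simp only [hadj]
      rw [sandwichSum_neg_mid, sandwichSum_neg_left, neg_neg]
    rw [map_add, map_sub, h1, h2, h3, ← map_sub, ← map_add]
    exact congrArg _ (by abel)
  -- All Hessian terms drop out of the alternating sum, which is the image under `Phi` of a multiple
  -- of ν - λ - μ, hence again such a multiple.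
  · have h := triSandwichSum_mulNu 𝒱.D PhiA (fun a => 𝒱.diracProj H θ Cinv a i)
      (fun b => 𝒱.diracProj H θ Cinv b j) fun c a b => Z a b c
    simp only [← hZ, triSandwichSum_sub] at h
    rw [← h]
    simp only [Phi]
    abel

end DifferentialFunctionAlgebra
end DiracReduction

namespace DiracReduction

/-! ### Rational operators and the Ore condition -/

section Rational

variable {F V : Type*} [Field F] [CommRing V] [Algebra F V] (D : Derivation F V V)

theorem choose_eq_zero_of_lt {n : ℤ} {k : ℕ} (hn : 0 ≤ n) (hk : n < k) : Ring.choose n k = 0 := by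
  lift n to ℕ using hn
  rw [Ring.choose_natCast, Nat.choose_eq_zero_of_lt (by omega), Nat.cast_zero]

theorem isDifferential_single (n : ℕ) (a : V) : PsDO.IsDifferential (single (n : ℤ) a) :=
  fun q hq => by rw [single_apply, if_neg (by omega)]

theorem PsDO.IsDifferential.sum {ι : Type*} {s : Finset ι} {A : ι → PsDO V}
    (h : ∀ i ∈ s, (A i).IsDifferential) : PsDO.IsDifferential (∑ i ∈ s, A i) := fun q hq => by
  rw [coe_sum_apply]
  exact Finset.sum_eq_zero fun i hi => h i hi q hq

theorem PsDO.IsDifferential.add {A B : PsDO V} (hA : A.IsDifferential) (hB : B.IsDifferential) :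
    PsDO.IsDifferential (A + B) := fun q hq => by
  rw [coe_add_apply, hA q hq, hB q hq, add_zero]

theorem PsDO.IsDifferential.neg {A : PsDO V} (hA : A.IsDifferential) :
    PsDO.IsDifferential (-A) := fun q hq => by
  rw [coe_neg_apply, hA q hq, neg_zero]

theorem PsDO.IsDifferential.comp {A B : PsDO V} (hA : A.IsDifferential) (hB : B.IsDifferential) :
    PsDO.IsDifferential (compHom D A B) := fun q hq => by
  refine finsum_eq_zero_of_forall_eq_zero fun x => ?_
  by_cases h : x.1 < 0
  · simp [hA _ h]
  by_cases h' : q - x.1 + x.2 < 0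
  · simp [hB _ h']
  rw [choose_eq_zero_of_lt (by omega) (by omega), zero_smul]

theorem PsDO.IsDifferential.adjoint {A : PsDO V} (hA : A.IsDifferential) :
    PsDO.IsDifferential (adjHom D A) := fun q hq => by
  rw [adjHom_apply]
  refine finsum_eq_zero_of_forall_eq_zero fun k => ?_
  by_cases h : q + k < 0
  · simp [hA _ h]
  rw [choose_eq_zero_of_lt (by omega) (by omega), mul_zero, zero_smul]

theorem compHom_leading {A B : PsDO V} {N M : ℤ} (hA : OrdLE A N) (hB : OrdLE B M) :
    (compHom D A B).1 (N + M) = A.1 N * B.1 M := by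
  rw [compHom, act_apply, finsum_eq_single _ (N, 0)]
  · simp
  · rintro ⟨n, k⟩ hx
    by_cases h : N < n
    · simp [hA _ h]
    · have h' : M < N + M - n + k := by
        by_contra h'
        exact hx (Prod.ext (by simp only; omega) (by simp only; omega))
      rw [hB _ h', iterate_map_zero, map_zero, smul_zero]

theorem exists_leading {A : PsDO V} (hA : A ≠ 0) : ∃ N, OrdLE A N ∧ A.1 N ≠ 0 := by
  obtain ⟨n, hn⟩ : ∃ n, A.1 n ≠ 0 := by
    by_contra! h
    exact hA (laurentInv_ext h)
  obtain ⟨N, hN⟩ := exists_ordLE A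
  obtain ⟨m, hm, hmax⟩ := Int.exists_greatest_of_bdd (P := fun n => A.1 n ≠ 0)
    ⟨N, fun z hz => not_lt.1 fun h => hz (hN z h)⟩ ⟨n, hn⟩
  exact ⟨m, fun k hk => by_contra fun h => absurd (hmax k h) (by omega), hm⟩

/-- Leading coefficients multiply, and V is a domain. -/
theorem compHom_ne_zero [IsDomain V] {A B : PsDO V} (hA : A ≠ 0) (hB : B ≠ 0) :
    compHom D A B ≠ 0 := by
  obtain ⟨N, hN, hN'⟩ := exists_leading hA
  obtain ⟨M, hM, hM'⟩ := exists_leading hB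
  intro h
  have := compHom_leading D hN hM
  rw [h] at this
  exact mul_ne_zero hN' hM' this.symm

theorem eq_zero_of_compHom_eq_zero [IsDomain V] {A B : PsDO V} (hA : A ≠ 0)
    (h : compHom D A B = 0) : B = 0 :=
  by_contra fun hB => compHom_ne_zero D hA hB h

/-- A system of linear equations over `V[∂]` with more unknowns than equations has a non-zero
solution, the unknowns being multiplied from the right. -/
theorem exists_left_kernel [Nontrivial V] {ι κ : Type*} [Fintype ι] [Fintype κ]
    (M : ι → κ → PsDO V)
    (hM : ∀ i j, (M i j).IsDifferential) (h : Fintype.card ι < Fintype.card κ) :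
    ∃ x : κ → PsDO V, (∀ j, (x j).IsDifferential) ∧ x ≠ 0 ∧
      ∀ i, ∑ j, compHom D (x j) (M i j) = 0 := by
  choose R hR using fun i j => exists_ordLE (M i j)
  obtain ⟨r, hr⟩ : ∃ r : ℕ, ∀ i j, OrdLE (M i j) r := by
    refine ⟨Finset.univ.sup fun x : ι × κ => (R x.1 x.2).toNat, fun i j => (hR i j).mono ?_⟩
    have := Finset.le_sup (f := fun x : ι × κ => (R x.1 x.2).toNat) (Finset.mem_univ (i, j))
    simp only at this
    omega
  -- Unknowns of order at most d have at least (|ι| + 1)(d + 1) coefficients, while the equations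
  -- impose |ι|(d + r + 1) = |ι|(d + 1) + d conditions; this d makes the first number larger by one.
  let d := Fintype.card ι * r
  let X (y : κ × Fin (d + 1) → V) (j : κ) : PsDO V :=
    ∑ k : Fin (d + 1), single ((k : ℕ) : ℤ) (y (j, k))
  have hX : ∀ y j (k : Fin (d + 1)), (X y j).1 ((k : ℕ) : ℤ) = y (j, k) := fun y j k => by
    rw [coe_sum_apply, Finset.sum_eq_single_of_mem k (Finset.mem_univ _), single_apply_same]
    intro b _ hb
    rw [single_apply, if_neg fun h => hb (Fin.ext (by omega))]
  have hXd : ∀ y j, (X y j).IsDifferential := fun y j =>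
    PsDO.IsDifferential.sum fun k _ => isDifferential_single _ _
  have hXo : ∀ y j, OrdLE (X y j) d := fun y j q hq => by
    rw [coe_sum_apply]
    exact Finset.sum_eq_zero fun k _ => by rw [single_apply, if_neg (by omega)]
  -- With the unknowns as left factors, multiplying them by a function multiplies the result from
  -- the left, so the system is V-linear in their coefficients.
  let f : (κ × Fin (d + 1) → V) →ₗ[V] (ι × Fin (d + r + 1) → V) :=
    { toFun := fun y x => (∑ j, compHom D (X y j) (M x.1 j)).1 ((x.2 : ℕ) : ℤ)
      map_add' := fun y z => by
        ext x
        have : ∀ j, X (y + z) j = X y j + X z j := fun j => by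
          simp only [X, Pi.add_apply, map_add, Finset.sum_add_distrib]
        simp only [this, map_add, AddMonoidHom.add_apply, Finset.sum_add_distrib, coe_add_apply,
          Pi.add_apply]
      map_smul' := fun a y => by
        ext x
        have : ∀ j, X (a • y) j = compHom D (single 0 a) (X y j) := fun j => by
          refine laurentInv_ext fun q => ?_
          rw [compHom_const]
          simp only [X, coe_sum_apply, single_apply, Finset.mul_sum, Pi.smul_apply, smul_eq_mul,
            mul_ite, mul_zero]
        simp only [this, compHom_assoc, ← map_sum, compHom_const]
        rfl }
  have hf : ¬Function.Injective f := fun hinj => by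
    have h1 := card_le_of_injective V f hinj
    simp only [Fintype.card_prod, Fintype.card_fin] at h1
    have h2 : (Fintype.card ι + 1) * (d + 1) ≤ Fintype.card κ * (d + 1) :=
      Nat.mul_le_mul_right _ h
    have h3 : Fintype.card ι * (d + r + 1) = Fintype.card ι * (d + 1) + d := by
      simp only [d]
      ring
    rw [add_mul, one_mul] at h2
    omega
  obtain ⟨y, hy, hy0⟩ : ∃ y, f y = 0 ∧ y ≠ 0 := by
    by_contra! hc
    exact hf ((injective_iff_map_eq_zero f).2 hc)
  refine ⟨X y, hXd y, fun h0 => hy0 ?_, fun i => laurentInv_ext fun q => ?_⟩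
  · ext ⟨j, k⟩
    rw [← hX y j k, h0]
    rfl
  · by_cases hq : q < 0
    · exact PsDO.IsDifferential.sum (fun j _ => (hXd y j).comp D (hM i j)) q hq
    by_cases hq' : d + r < q
    · rw [coe_sum_apply]
      exact Finset.sum_eq_zero fun j _ => (hXo y j).act (hr i j) q hq'
    have h' : (∑ j, compHom D (X y j) (M i j)).1 ((q.toNat : ℕ) : ℤ) = 0 :=
      congrFun hy (i, ⟨q.toNat, by omega⟩)
    rwa [Int.toNat_of_nonneg (not_lt.1 hq)] at h'

/-- The adjoint preserves V[∂] and reverses products, so this is the left-factor version for the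
adjoint system. -/
theorem exists_right_kernel [Nontrivial V] {ι κ : Type*} [Fintype ι] [Fintype κ]
    (M : ι → κ → PsDO V)
    (hM : ∀ i j, (M i j).IsDifferential) (h : Fintype.card ι < Fintype.card κ) :
    ∃ x : κ → PsDO V, (∀ j, (x j).IsDifferential) ∧ x ≠ 0 ∧
      ∀ i, ∑ j, compHom D (M i j) (x j) = 0 := by
  obtain ⟨y, hyd, hy0, hy⟩ := exists_left_kernel D (fun i j => adjHom D (M i j))
    (fun i j => (hM i j).adjoint D) h
  refine ⟨fun j => adjHom D (y j), fun j => (hyd j).adjoint D, fun h0 => hy0 ?_, fun i => ?_⟩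
  · ext1 j
    rw [← adjHom_adjHom (D := D) (y j), congrFun h0 j]
    exact map_zero _
  · have := congrArg (adjHom D) (hy i)
    rw [map_sum, map_zero] at this
    simpa only [adjHom_compHom, adjHom_adjHom] using this

variable {D} in
theorem PsDO.IsRational.neg {A : PsDO V} (hA : A.IsRational D) : PsDO.IsRational D (-A) := by
  obtain ⟨P, Q, hP, hQ, hQ0, h⟩ := hA
  refine ⟨-P, Q, hP.neg, hQ, hQ0, ?_⟩
  rw [← h, comp_eq_compHom, comp_eq_compHom, map_neg, AddMonoidHom.neg_apply]

variable [IsDomain V]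

/-- The Ore condition. -/
theorem exists_common_multiple {A B : PsDO V} (hA : A.IsDifferential) (hB : B.IsDifferential)
    (hB0 : B ≠ 0) : ∃ x y : PsDO V, x.IsDifferential ∧ y.IsDifferential ∧ x ≠ 0 ∧
      compHom D A x = compHom D B y := by
  obtain ⟨x, hxd, hx0, hx⟩ := exists_right_kernel D (ι := Fin 1) (fun _ => ![A, B])
    (fun _ j => by fin_cases j <;> assumption) (by simp)
  have h := hx 0
  rw [Fin.sum_univ_two] at h
  simp only [Matrix.cons_val_zero, Matrix.cons_val_one] at h
  refine ⟨x 0, -x 1, hxd 0, (hxd 1).neg, fun h0 => hx0 ?_, ?_⟩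
  -- If the first component vanished, B times the second would be zero, making the whole solution
  -- zero.
  · rw [h0, map_zero, zero_add] at h
    ext1 j
    fin_cases j
    · exact h0
    · exact eq_zero_of_compHom_eq_zero D hB0 h
  · rw [map_neg]
    exact eq_neg_of_add_eq_zero_left h

theorem single_zero_one_ne_zero : (single 0 1 : PsDO V) ≠ 0 := fun h => by
  have := congrArg (fun A : PsDO V => A.1 0) h
  simp only [single_apply_same] at this
  exact one_ne_zero this

variable {D}

namespace PsDO

theorem IsDifferential.isRational {A : PsDO V} (hA : A.IsDifferential) : A.IsRational D :=
  ⟨A, single 0 1, hA, isDifferential_single 0 1, single_zero_one_ne_zero, compHom_one_right D A⟩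

theorem IsRational.add {A B : PsDO V} (hA : A.IsRational D) (hB : B.IsRational D) :
    IsRational D (A + B) := by
  obtain ⟨P, Q, hP, hQ, hQ0, h⟩ := hA
  obtain ⟨P', Q', hP', hQ', hQ0', h'⟩ := hB
  obtain ⟨x, y, hx, hy, hx0, hxy⟩ := exists_common_multiple D hQ hQ' hQ0'
  refine ⟨compHom D P x + compHom D P' y, compHom D Q x, (hP.comp D hx).add (hP'.comp D hy),
    hQ.comp D hx, compHom_ne_zero D hQ0 hx0, ?_⟩
  rw [← h, ← h', comp_eq_compHom, comp_eq_compHom, comp_eq_compHom, map_add,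
    AddMonoidHom.add_apply, compHom_assoc, compHom_assoc, hxy]

theorem IsRational.sub {A B : PsDO V} (hA : A.IsRational D) (hB : B.IsRational D) :
    IsRational D (A - B) := by
  rw [sub_eq_add_neg]
  exact hA.add hB.neg

/-- With A = P Q⁻¹, B = P' Q'⁻¹ and P' x = Q y, the denominator Q' moves outside: A ∘ B ∘ (Q' x) = P
y. -/
theorem IsRational.comp {A B : PsDO V} (hA : A.IsRational D) (hB : B.IsRational D) :
    IsRational D (compHom D A B) := by
  obtain ⟨P, Q, hP, hQ, hQ0, h⟩ := hA
  obtain ⟨P', Q', hP', hQ', hQ0', h'⟩ := hB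
  obtain ⟨x, y, hx, hy, hx0, hxy⟩ := exists_common_multiple D hP' hQ hQ0
  refine ⟨compHom D P y, compHom D Q' x, hP.comp D hy,
    hQ'.comp D hx, compHom_ne_zero D hQ0' hx0, ?_⟩
  rw [comp_eq_compHom] at h h' ⊢
  rw [compHom_assoc, ← compHom_assoc D B, h', hxy, ← compHom_assoc, h]

theorem IsRational.sum {ι : Type*} (s : Finset ι) {A : ι → PsDO V}
    (h : ∀ i ∈ s, (A i).IsRational D) : IsRational D (∑ i ∈ s, A i) :=
  Finset.sum_induction _ _ (fun _ _ => IsRational.add)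
    (IsDifferential.isRational fun _ _ => rfl) h

theorem exists_common_denominator {ι : Type*} (s : Finset ι) {A : ι → PsDO V}
    (h : ∀ i ∈ s, (A i).IsRational D) : ∃ b : PsDO V, b.IsDifferential ∧ b ≠ 0 ∧
      ∀ i ∈ s, IsDifferential (compHom D (A i) b) := by
  classical
  induction s using Finset.induction_on with
  | empty => exact ⟨single 0 1, isDifferential_single 0 1, single_zero_one_ne_zero, by simp⟩
  | insert a s ha ih =>
    obtain ⟨b, hb, hb0, hbs⟩ := ih fun i hi => h i (Finset.mem_insert_of_mem hi)
    obtain ⟨P, Q, hP, hQ, hQ0, hA⟩ := h a (Finset.mem_insert_self a s)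
    obtain ⟨x, y, hx, hy, hx0, hxy⟩ := exists_common_multiple D hb hQ hQ0
    refine ⟨compHom D b x, hb.comp D hx, compHom_ne_zero D hb0 hx0, fun i hi => ?_⟩
    rcases Finset.mem_insert.1 hi with rfl | hi
    · rw [hxy, ← compHom_assoc]
      rw [comp_eq_compHom] at hA
      rw [hA]
      exact hP.comp D hy
    · rw [← compHom_assoc]
      exact (hbs i hi).comp D hx

end PsDO

theorem isRational_matComp {l m n : ℕ} {A : Matrix (Fin l) (Fin m) (PsDO V)}
    {B : Matrix (Fin m) (Fin n) (PsDO V)} (hA : ∀ i j, (A i j).IsRational D)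
    (hB : ∀ i j, (B i j).IsRational D) (i : Fin l) (j : Fin n) :
    (matComp D A B i j).IsRational D :=
  PsDO.IsRational.sum _ fun k _ => (hA i k).comp (hB k j)

/-- The inverse of a matrix of rational operators has rational entries. -/
theorem isRational_inverse {m : ℕ} {A B : Matrix (Fin m) (Fin m) (PsDO V)}
    (h : matComp D B A = matOne V m) (hA : ∀ i j, (A i j).IsRational D) (i j : Fin m) :
    (B i j).IsRational D := by
  choose b hb hb0 hAb using fun β => PsDO.exists_common_denominator Finset.univ
    fun α (_ : α ∈ Finset.univ) => hA α β
  -- Clearing a denominator in each column of A gives m equations in m + 1 unknowns, ∑ A_{αβ} b_β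
  -- x_β = δ_{αj} x_none, solvable over V[∂].
  obtain ⟨x, hxd, hx0, hx⟩ := exists_right_kernel D
    (fun (α : Fin m) (β : Option (Fin m)) => β.elim (-if α = j then single 0 1 else 0)
      fun β => compHom D (A α β) (b β))
    (fun α β => by
      cases β with
      | none =>
        refine PsDO.IsDifferential.neg ?_
        split_ifs
        · exact isDifferential_single 0 1
        · exact fun _ _ => rfl
      | some β => exact hAb β α (Finset.mem_univ α)) (by simp)
  -- Applying the left inverse B to the system writes column j of B as fractions with the common
  -- denominator x_none.
  have hsol : ∀ β, compHom D (b β) (x (some β)) = compHom D (B β j) (x none) := by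
    obtain ⟨X, hX⟩ : ∃ X : Matrix (Fin m) (Fin 1) (PsDO V),
        ∀ β o, X β o = compHom D (b β) (x (some β)) := ⟨fun β _ => _, fun _ _ => rfl⟩
    have h1 : ∀ α, matComp D A X α 0 = if α = j then x none else 0 := fun α => by
      have := hx α
      rw [Fintype.sum_option] at this
      simp only [Option.elim] at this
      rw [map_neg, AddMonoidHom.neg_apply, neg_add_eq_zero] at this
      simp only [matComp_apply, hX, ← compHom_assoc, ← this]
      split_ifs
      · rw [compHom_one_left]
      · rw [map_zero, AddMonoidHom.zero_apply]
    intro β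
    have h2 : matComp D B (matComp D A X) β 0 = X β 0 := by
      rw [← matComp_assoc, h, matOne_matComp]
    rw [← hX β 0, ← h2, matComp_apply, Finset.sum_eq_single_of_mem j (Finset.mem_univ _), h1,
      if_pos rfl]
    intro k _ hk
    rw [h1, if_neg hk, map_zero]
  -- The denominator is non-zero: otherwise every b_β x_β would vanish, and with it the whole
  -- solution.
  refine ⟨compHom D (b i) (x (some i)), x none, (hb i).comp D (hxd _), hxd none, fun h0 => hx0 ?_,
    (hsol i).symm⟩
  ext1 β
  cases β with
  | none => exact h0
  | some β =>
    refine eq_zero_of_compHom_eq_zero D (hb0 β) ?_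
    rw [hsol, h0, map_zero]

end Rational

namespace DifferentialFunctionAlgebra

variable {F V : Type*} [Field F] [CommRing V] [IsDomain V] [Algebra F V] {ℓ m : ℕ}
  (𝒱 : DifferentialFunctionAlgebra F V ℓ)

theorem isRational_diracModification (H : Matrix (Fin ℓ) (Fin ℓ) (PsDO V)) (θ : Fin m → V)
    {Cinv : Matrix (Fin m) (Fin m) (PsDO V)}
    (hC : IsMatInverse 𝒱.D (𝒱.constraintOperator H θ) Cinv)
    (hH : ∀ i j, (H i j).IsRational 𝒱.D) (i j : Fin ℓ) :
    (𝒱.diracModification H θ Cinv i j).IsRational 𝒱.D := by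
  have hD : ∀ α i, (𝒱.frechet θ α i).IsRational 𝒱.D := fun α i =>
    (𝒱.fr_isDifferential i (θ α)).isRational
  have hDa : ∀ i α, (matAdjoint 𝒱.D (𝒱.frechet θ) i α).IsRational 𝒱.D := fun i α =>
    ((𝒱.fr_isDifferential i (θ α)).adjoint 𝒱.D).isRational
  have hCinv := isRational_inverse hC.2
    (isRational_matComp (isRational_matComp hD hH) hDa)
  exact (hH i j).sub (isRational_matComp (isRational_matComp hH hDa)
    (isRational_matComp hCinv (isRational_matComp hD hH)) i j)

end DifferentialFunctionAlgebra
end DiracReduction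

theorem proposition6p1 {F V : Type*} [Field F] [CharZero F] [CommRing V] [IsDomain V]
    [Algebra F V] {ℓ m : ℕ} (𝒱 : DiracReduction.DifferentialFunctionAlgebra F V ℓ)
    (H : Matrix (Fin ℓ) (Fin ℓ) (DiracReduction.PsDO V))
    (hH : 𝒱.IsNonlocalPoissonStructure H)
    (θ : Fin m → V)
    (Cinv : Matrix (Fin m) (Fin m) (DiracReduction.PsDO V))
    (hC : DiracReduction.IsMatInverse 𝒱.D (𝒱.constraintOperator H θ) Cinv) :
    -- the matrix of brackets of the constraints is `C`, so that `Cinv` is its inverse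
    DiracReduction.bracketMatrix (𝒱.masterBracket H) θ = 𝒱.constraintOperator H θ ∧
    -- (a)
    (∀ f g : V, DiracReduction.diracBracket 𝒱.D (𝒱.masterBracket H) θ Cinv f g =
      𝒱.masterBracket (𝒱.diracModification H θ Cinv) f g) ∧
    𝒱.IsNonlocalPoissonStructure (𝒱.diracModification H θ Cinv) ∧
    -- (b)
    DiracReduction.matComp 𝒱.D (𝒱.diracModification H θ Cinv)
      (DiracReduction.matAdjoint 𝒱.D (𝒱.frechet θ)) = 0 ∧
    DiracReduction.matComp 𝒱.D (𝒱.frechet θ) (𝒱.diracModification H θ Cinv) = 0 ∧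
    (∀ (α : Fin m) (f : V),
      𝒱.masterBracket (𝒱.diracModification H θ Cinv) f (θ α) = 0 ∧
      𝒱.masterBracket (𝒱.diracModification H θ Cinv) (θ α) f = 0) := by
  have hH' := hH.skewadjoint
  refine ⟨𝒱.bracketMatrix_eq H θ, 𝒱.diracBracket_eq H θ Cinv,
    ⟨𝒱.adjoint_diracModification H θ hH' hC, 𝒱.isRational_diracModification H θ hC hH.rational,
      𝒱.jacobiIdentity_diracModification H θ hH' hC hH.jacobi⟩,
    𝒱.diracModification_comp_adjoint H θ hC, 𝒱.frechet_comp_diracModification H θ hC,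
    fun α f => ⟨𝒱.masterBracket_constraint_right H θ hC α f,
      𝒱.masterBracket_constraint_left H θ hC α f⟩⟩
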